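/- Let $L>0$. The dumbbell graph consists of two loops $e_1,e_3$, parameterized by $[-\pi,\pi]$ and attached at the vertices $v_1$ and $v_2$ respectively, and of a central edge $e_2$ from $v_1$ to $v_2$, parameterized by $[-L,L]$. A standing wave of frequency $\Lambda\in\mathbb R$ is a real function $\Phi=(\phi_1,\phi_2,\phi_3)$ on the graph, $C^2$ on each closed edge, with $-\phi_j''-2\phi_j^3-\Lambda\phi_j=0$ on each edge, continuous at the vertices, $\phi_1(-\pi)=\phi_1(\pi)=\phi_2(-L)$, $\phi_3(-\pi)=\phi_3(\pi)=\phi_2(L)$, and with zero flux: $\phi_1'(-\pi)-\phi_1'(\pi)+\phi_2'(-L)=0$, $-\phi_2'(L)+\phi_3'(-\pi)-\phi_3'(\pi)=0$. A loop $e_j$ ($j=1,3$) is complete if $\phi_j'(\pi)=\phi_j'(-\pi)$ and incomplete if $\phi_j'(\pi)=-\phi_j'(-\pi)$. Let $K(\kappa)=\int_0^{\pi/2}(1-\kappa^2\sin^2\theta)^{-1/2}\,d\theta$ be the complete elliptic integral. A cnoidal solution of period $T$ is $\psi(x)=\kappa\beta\,\mathrm{cn}(\beta x-\tau,\kappa)$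 with $0<\kappa<1$, $\beta>0$, $\tau\in\mathbb R$, $\beta^2(1-2\kappa^2)=\Lambda$, $T=4K(\kappa)/\beta$. A dnoidal solution of period $T$ is $\psi(x)=\pm b\,\mathrm{dn}(bx-\tau,k)$ with $0<k<1$, $b>0$, $\tau\in\mathbb R$, $b^2(2-k^2)=-\Lambda$, $T=2K(k)/b$. A triple $(n_1,m,n_3)$ has entries in $\mathbb Z\cup\{\text{the symbol }\Lambda\}$. A standing wave has type $(n_1,m,n_3)$ if, for $i=1,3$: $\phi_i\equiv0$ if $n_i=0$; $\Lambda<0$ and $\phi_i$ is one of the constants $\pm\sqrt{-\Lambda/2}$ if $n_i$ is the symbol $\Lambda$; $\phi_i$ consists of exactly $n_i$ periods of a cnoidal solution if $n_i>0$, and of exactly $|n_i|$ periods of a dnoidal solution if $n_i<0$; and likewise for $m$ and $\phi_2$, with half-periods instead of periods. Put $\Lambda^*=(\pi/(2L))^2$. We say that at $\Lambda_0$ the type $t$ bifurcates from the type $s$ if: there is no standing wave of type $t$ with $\Lambda\ge\Lambda_0$; there are standing waves of type $s$ at $\Lambda=\Lambda_0$; and for each such standing wave $\Phi_0$ there are an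 $H^1$-continuous family of standing waves of type $s$, defined for $\Lambda$ in an open interval around $\Lambda_0$ and equal to $\Phi_0$ at $\Lambda_0$, and an $H^1$-continuous family $(\Phi_\Lambda)_{\Lambda\le\Lambda_0}$ with $\Phi_{\Lambda_0}=\Phi_0$ and $\Phi_\Lambda$ a standing wave of frequency $\Lambda$ and of type $t$ for all $\Lambda<\Lambda_0$. Then the following hold. 1. (Period bounds) Cnoidal and dnoidal solutions solve $-\psi''-2\psi^3-\Lambda\psi=0$ on $\mathbb R$, and $T$ is their least positive period. The set of periods of cnoidal solutions is $(0,T_{\rm cn}^{\max})$ with $T_{\rm cn}^{\max}=2\pi/\sqrt\Lambda$ if $\Lambda>0$, and $(0,\infty)$ if $\Lambda\le0$. For $\Lambda<0$ the set of periods of dnoidal solutions is $(T_{\rm dn}^{\min},\infty)$ with $T_{\rm dn}^{\min}=\pi\sqrt2/\sqrt{-\Lambda}$. 2. (Families) Each loop of a standing wave is complete or incomplete, so every standing wave has two incomplete loops, or two complete loops, or one of each. 3. (Classification) A function on the graph is a standing wave of frequency $\Lambda$ with two complete loops if and only if there is exactly one triple $(n_1,m,n_3)$ such that it is a standing wave of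 frequency $\Lambda$ and type $(n_1,m,n_3)$. 4. (Thresholds) For a standing wave of type $(n_1,m,n_3)$ and frequency $\Lambda$: $n_i>0$ implies $\Lambda<n_i^2$; $n_i<0$ implies $\Lambda<-n_i^2/2$; $m>0$ implies $\Lambda<m^2\Lambda^*$; $m<0$ implies $\Lambda<-m^2\Lambda^*/2$. 5. (Branches) The type $(0,0,0)$ exists for all $\Lambda$. The other types emerge as $\Lambda$ decreases: - At $\Lambda=n_1^2$, for integers $n_1>0$: $(n_1,0,n_1)$ and $(n_1,0,0)$ bifurcate from $(0,0,0)$; and $(n_1,0,n_3)$ bifurcates from $(0,0,n_3)$ for all integers $n_3>n_1$. - At $\Lambda=m^2\Lambda^*$, for integers $m>0$: $(n_1,m,n_3)$ bifurcates from $(n_1,0,n_3)$ for all integers $n_1,n_3$ with $m<2Ln_1/\pi$ and $m<2Ln_3/\pi$. - At $\Lambda=0$: $(\Lambda,\Lambda,\Lambda)$ bifurcates from $(0,0,0)$; and for all integers $n_1,n_3\ge0$, $(\tilde n_1,\Lambda,\tilde n_3)$ bifurcates from $(n_1,0,n_3)$, where $\tilde n=n$ if $n>0$ and $\tilde n$ is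 the symbol $\Lambda$ if $n=0$. - At $\Lambda=-m^2\Lambda^*/2$, for integers $m>0$: $(n_1,-m,n_3)$ bifurcates from $(n_1,\Lambda,n_3)$ for all nonzero integers $n_1,n_3$ such that, for $i=1,3$, $n_i>0$ or $-m^2\Lambda^*/2<-n_i^2/2$ (so that the type $(n_1,\Lambda,n_3)$ exists there). If moreover $m$ is odd and $n_1\ne n_3$, then for every $\Lambda<-m^2\Lambda^*/2$ there are standing waves of types $(n_1,-m,n_3)$ and $(n_3,-m,n_1)$ with the same restriction to the oriented edge $e_2$, and no two such standing waves are related by the group generated by the symmetries of the graph: reversal of $e_1$; reversal of $e_3$; exchange of $e_1$ with $e_3$ together with reversal of $e_2$. - At $\Lambda=-n_1^2/2$, for integers $n_1>0$: $(-n_1,\Lambda,-n_1)$ and $(-n_1,\Lambda,\Lambda)$ bifurcate from $(\Lambda,\Lambda,\Lambda)$; and $(-n_1,\Lambda,n_3)$ bifurcates from $(\Lambda,\Lambda,n_3)$ for all integers $n_3>-n_1$, $n_3\ne0$. If there are no resonances, i.e. if $2Ln\neq m\pi$ for all integers $n\ge1$, $m\ge0$, this list is complete: up to interchanging $n_1$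 and $n_3$, every triple that is the type of some standing wave is $(0,0,0)$ or one of the bifurcating types above. 6. (Countability) For every $\Lambda\in\mathbb R$, each of the three families of standing waves of frequency $\Lambda$ (two incomplete loops; two complete loops; one of each) is countably infinite, also after removal of the members it shares with the other two families; and infinitely many triples occur as types of standing waves of frequency $\Lambda$. -/

import Mathlib

open Real Set Filter Topology

/-! ### Jacobi elliptic functions of a real argument, with modulus `k`, `0 ≤ k < 1` -/

/-- Incomplete elliptic integral of the first kind. -/
noncomputable def ellipticF (k φ : ℝ) : ℝ :=
  ∫ θ in (0 : ℝ)..φ, 1 / √(1 - k ^ 2 * sin θ ^ 2)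

/-- Complete elliptic integral of the first kind. -/
noncomputable def ellipticK (k : ℝ) : ℝ := ellipticF k (π / 2)

/-- Jacobi amplitude, the inverse of `ellipticF k` (for `0 ≤ k < 1` this is an increasing
bijection of the line). -/
noncomputable def jacobiAm (u k : ℝ) : ℝ := Function.invFun (ellipticF k) u

noncomputable def jacobiCn (u k : ℝ) : ℝ := cos (jacobiAm u k)

noncomputable def jacobiDn (u k : ℝ) : ℝ := √(1 - k ^ 2 * sin (jacobiAm u k) ^ 2)

/-- `ψ = κβ cn(βx - τ, κ)` with `β² (1 - 2κ²) = Λ`, and `T = 4K(κ)/β` is its period. For `Λ ≠ 0`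
this says `(κβ)² = κ²Λ/(1-2κ²)`, `T = 4K(κ)√((1-2κ²)/Λ)`, with `κ < 1/√2` if `Λ > 0` and
`κ > 1/√2` if `Λ < 0`; for `Λ = 0` it says `κ = 1/√2` with `β` free. -/
def IsCnoidal (Λ T : ℝ) (ψ : ℝ → ℝ) : Prop :=
  ∃ κ ∈ Ioo (0 : ℝ) 1, ∃ β : ℝ, 0 < β ∧ β ^ 2 * (1 - 2 * κ ^ 2) = Λ ∧
    T = 4 * ellipticK κ / β ∧ ∃ τ : ℝ, ∀ x, ψ x = κ * β * jacobiCn (β * x - τ) κ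

/-- `ψ = ± b dn(bx - τ, k)` with `b² = Λ/(k² - 2)`, and `T = 2K(k)/b` is its period. -/
def IsDnoidal (Λ T : ℝ) (ψ : ℝ → ℝ) : Prop :=
  ∃ k ∈ Ioo (0 : ℝ) 1, ∃ b : ℝ, 0 < b ∧ b ^ 2 * (2 - k ^ 2) = -Λ ∧
    T = 2 * ellipticK k / b ∧ ∃ τ σ : ℝ, (σ = 1 ∨ σ = -1) ∧
      ∀ x, ψ x = σ * b * jacobiDn (b * x - τ) k

noncomputable def TcnMax (Λ : ℝ) : ℝ := 2 * π / √Λ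

noncomputable def TdnMin (Λ : ℝ) : ℝ := π * √2 / √(-Λ)

/-! ### The dumbbell graph and its standing waves

The loops `e₁` and `e₃` are parameterized by `[-π, π]`, the central edge `e₂` by `[-L, L]`; it runs
from the vertex `v₁` of `e₁` to the vertex `v₂` of `e₃`. -/

/-- A real function on the graph, by its components on the edges. Only the values of `e₁`, `e₃` on
`[-π, π]` and of `e₂` on `[-L, L]` matter. -/
structure GraphFun where
  e₁ : ℝ → ℝ
  e₂ : ℝ → ℝ
  e₃ : ℝ → ℝ

/-- The honest function on the graph behind a `GraphFun`: junk outside the edges is forgotten. -/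
def GraphFun.onGraph (L : ℝ) (Φ : GraphFun) :
    (Icc (-π) π → ℝ) × (Icc (-L) L → ℝ) × (Icc (-π) π → ℝ) :=
  ((Icc (-π) π).domRestrict Φ.e₁, (Icc (-L) L).domRestrict Φ.e₂, (Icc (-π) π).domRestrict Φ.e₃)

/-- `φ` is of class `C²` on `[-ℓ, ℓ]` and solves `-φ'' - 2φ³ - Λφ = 0` there. -/
def SolvesOnEdge (Λ ℓ : ℝ) (φ : ℝ → ℝ) : Prop :=
  ContDiffOn ℝ 2 φ (Icc (-ℓ) ℓ) ∧
    ∀ x ∈ Ioo (-ℓ) ℓ, -deriv (deriv φ) x - 2 * φ x ^ 3 - Λ * φ x = 0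

/-- Derivative on an edge `[-ℓ, ℓ]`, one-sided at the end points. -/
noncomputable def edgeDeriv (ℓ : ℝ) (φ : ℝ → ℝ) (x : ℝ) : ℝ := derivWithin φ (Icc (-ℓ) ℓ) x

/-- Real stationary solutions `Φ` of frequency `Λ` with Kirchhoff conditions at both vertices:
continuity and vanishing total flux, both ends of a loop being counted. -/
structure IsStandingWave (L Λ : ℝ) (Φ : GraphFun) : Prop where
  eq₁ : SolvesOnEdge Λ π Φ.e₁
  eq₂ : SolvesOnEdge Λ L Φ.e₂
  eq₃ : SolvesOnEdge Λ π Φ.e₃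
  cont₁ : Φ.e₁ (-π) = Φ.e₁ π ∧ Φ.e₁ π = Φ.e₂ (-L)
  cont₂ : Φ.e₃ (-π) = Φ.e₃ π ∧ Φ.e₃ π = Φ.e₂ L
  flux₁ : edgeDeriv π Φ.e₁ (-π) - edgeDeriv π Φ.e₁ π + edgeDeriv L Φ.e₂ (-L) = 0
  flux₂ : -edgeDeriv L Φ.e₂ L + edgeDeriv π Φ.e₃ (-π) - edgeDeriv π Φ.e₃ π = 0

def CompleteLoop (φ : ℝ → ℝ) : Prop := edgeDeriv π φ π = edgeDeriv π φ (-π)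

def IncompleteLoop (φ : ℝ → ℝ) : Prop := edgeDeriv π φ π = -edgeDeriv π φ (-π)

/-! The three families of standing waves of a given frequency. -/

def TwoIncomplete (L Λ : ℝ) : Set GraphFun :=
  {Φ | IsStandingWave L Λ Φ ∧ IncompleteLoop Φ.e₁ ∧ IncompleteLoop Φ.e₃}

def TwoComplete (L Λ : ℝ) : Set GraphFun :=
  {Φ | IsStandingWave L Λ Φ ∧ CompleteLoop Φ.e₁ ∧ CompleteLoop Φ.e₃}

def OneOfEach (L Λ : ℝ) : Set GraphFun :=
  {Φ | IsStandingWave L Λ Φ ∧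
    (IncompleteLoop Φ.e₁ ∧ CompleteLoop Φ.e₃ ∨ CompleteLoop Φ.e₁ ∧ IncompleteLoop Φ.e₃)}

/-! ### Labels and triples -/

/-- The label of an edge: an integer, or the symbol `Λ` (here `lam`). -/
inductive Label where
  | int (n : ℤ)
  | lam

/-- The solution `φ` on the edge `[-ℓ, ℓ]` has the given label, where periods are counted in units
of `u` times the period of the cn or dn function (`u = 1` on the loops, `u = 1/2` on the central
edge). -/
def EdgeHasLabel (Λ ℓ u : ℝ) (φ : ℝ → ℝ) : Label → Prop
  | .lam => Λ < 0 ∧ (EqOn φ (fun _ => √(-Λ / 2)) (Icc (-ℓ) ℓ) ∨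
      EqOn φ (fun _ => -√(-Λ / 2)) (Icc (-ℓ) ℓ))
  | .int n =>
      (n = 0 ∧ EqOn φ (fun _ => 0) (Icc (-ℓ) ℓ)) ∨
      (0 < n ∧ ∃ T ψ, IsCnoidal Λ T ψ ∧ EqOn φ ψ (Icc (-ℓ) ℓ) ∧ 2 * ℓ = (n : ℝ) * (u * T)) ∨
      (n < 0 ∧ ∃ T ψ, IsDnoidal Λ T ψ ∧ EqOn φ ψ (Icc (-ℓ) ℓ) ∧ 2 * ℓ = |(n : ℝ)| * (u * T))

/-- A triple `(n₁, m, n₃)`. -/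
structure Triple where
  n₁ : Label
  m : Label
  n₃ : Label

def Triple.swap (t : Triple) : Triple := ⟨t.n₃, t.m, t.n₁⟩

/-- `Φ` is a standing wave of frequency `Λ` classified by the triple `t`. -/
def HasType (L Λ : ℝ) (Φ : GraphFun) (t : Triple) : Prop :=
  IsStandingWave L Λ Φ ∧ EdgeHasLabel Λ π 1 Φ.e₁ t.n₁ ∧
    EdgeHasLabel Λ L (1 / 2) Φ.e₂ t.m ∧ EdgeHasLabel Λ π 1 Φ.e₃ t.n₃

/-! ### Branches and bifurcations -/

/-- Square of the distance in `H¹` of the graph. -/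
noncomputable def h1DistSq (L : ℝ) (Φ Ψ : GraphFun) : ℝ :=
  (∫ x in (-π)..π, ((Φ.e₁ x - Ψ.e₁ x) ^ 2 + (deriv Φ.e₁ x - deriv Ψ.e₁ x) ^ 2)) +
  (∫ x in (-L)..L, ((Φ.e₂ x - Ψ.e₂ x) ^ 2 + (deriv Φ.e₂ x - deriv Ψ.e₂ x) ^ 2)) +
  ∫ x in (-π)..π, ((Φ.e₃ x - Ψ.e₃ x) ^ 2 + (deriv Φ.e₃ x - deriv Ψ.e₃ x) ^ 2)

/-- A family `Λ ↦ Φ Λ` of functions on the graph is continuous into `H¹` on the set `S`. -/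
def H1ContinuousOn (L : ℝ) (S : Set ℝ) (Φ : ℝ → GraphFun) : Prop :=
  ∀ Λ₁ ∈ S, Tendsto (fun Λ => h1DistSq L (Φ Λ) (Φ Λ₁)) (𝓝[S] Λ₁) (𝓝 0)

/-- As `Λ` decreases through `Λ₀`, solutions of type `t` bifurcate from those of type `s`: no
solution of type `t` exists for `Λ ≥ Λ₀`; solutions of type `s` exist at `Λ₀`; and through each of
these passes a branch of type `s`, defined on both sides of `Λ₀`, from which there emanates at `Λ₀`
a branch of type `t`, defined for all `Λ < Λ₀`. -/
def BifurcatesFrom (L Λ₀ : ℝ) (t s : Triple) : Prop :=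
  (∀ Λ, Λ₀ ≤ Λ → ∀ Φ, ¬ HasType L Λ Φ t) ∧
  (∃ Φ₀, HasType L Λ₀ Φ₀ s) ∧
  ∀ Φ₀, HasType L Λ₀ Φ₀ s →
    (∃ ε > 0, ∃ Ψ : ℝ → GraphFun, Ψ Λ₀ = Φ₀ ∧
      H1ContinuousOn L (Ioo (Λ₀ - ε) (Λ₀ + ε)) Ψ ∧
      ∀ Λ ∈ Ioo (Λ₀ - ε) (Λ₀ + ε), HasType L Λ (Ψ Λ) s) ∧
    (∃ Φ : ℝ → GraphFun, Φ Λ₀ = Φ₀ ∧ H1ContinuousOn L (Iic Λ₀) Φ ∧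
      ∀ Λ < Λ₀, HasType L Λ (Φ Λ) t)

/-- `Λ* = (π / (2L))²`. -/
noncomputable def LamStar (L : ℝ) : ℝ := (π / (2 * L)) ^ 2

/-- The label of a loop with `n ≥ 0` periods of cn next to a nonzero constant central edge: a loop
on which the solution vanished now carries the constant too. -/
def Label.besideConst (n : ℤ) : Label := if n = 0 then .lam else .int n

/-- The list of bifurcations: `BranchTable L Λ₀ t s` says that the list has the entry
"at `Λ = Λ₀`, solutions of type `t` bifurcate from those of type `s`". -/
inductive BranchTable (L : ℝ) : ℝ → Triple → Triple → Prop
  | cnBothLoops (n : ℤ) (hn : 0 < n) :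
      BranchTable L ((n : ℝ) ^ 2) ⟨.int n, .int 0, .int n⟩ ⟨.int 0, .int 0, .int 0⟩
  | cnOneLoop (n : ℤ) (hn : 0 < n) :
      BranchTable L ((n : ℝ) ^ 2) ⟨.int n, .int 0, .int 0⟩ ⟨.int 0, .int 0, .int 0⟩
  | cnSecondLoop (n₁ n₃ : ℤ) (h₁ : 0 < n₁) (h₃ : n₁ < n₃) :
      BranchTable L ((n₁ : ℝ) ^ 2) ⟨.int n₁, .int 0, .int n₃⟩ ⟨.int 0, .int 0, .int n₃⟩
  | cnCentre (n₁ m n₃ : ℤ) (hm : 0 < m)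
      (h₁ : (m : ℝ) < 2 * L * n₁ / π) (h₃ : (m : ℝ) < 2 * L * n₃ / π) :
      BranchTable L ((m : ℝ) ^ 2 * LamStar L)
        ⟨.int n₁, .int m, .int n₃⟩ ⟨.int n₁, .int 0, .int n₃⟩
  | const : BranchTable L 0 ⟨.lam, .lam, .lam⟩ ⟨.int 0, .int 0, .int 0⟩
  | constCentre (n₁ n₃ : ℤ) (h₁ : 0 ≤ n₁) (h₃ : 0 ≤ n₃) :
      BranchTable L 0 ⟨.besideConst n₁, .lam, .besideConst n₃⟩ ⟨.int n₁, .int 0, .int n₃⟩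
  | dnCentre (n₁ m n₃ : ℤ) (hm : 0 < m)
      (h₁ : 0 < n₁ ∨ (n₁ < 0 ∧ -((m : ℝ) ^ 2 * LamStar L / 2) < -((n₁ : ℝ) ^ 2 / 2)))
      (h₃ : 0 < n₃ ∨ (n₃ < 0 ∧ -((m : ℝ) ^ 2 * LamStar L / 2) < -((n₃ : ℝ) ^ 2 / 2))) :
      BranchTable L (-((m : ℝ) ^ 2 * LamStar L / 2))
        ⟨.int n₁, .int (-m), .int n₃⟩ ⟨.int n₁, .lam, .int n₃⟩
  | dnBothLoops (n : ℤ) (hn : 0 < n) :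
      BranchTable L (-((n : ℝ) ^ 2 / 2)) ⟨.int (-n), .lam, .int (-n)⟩ ⟨.lam, .lam, .lam⟩
  | dnOneLoop (n : ℤ) (hn : 0 < n) :
      BranchTable L (-((n : ℝ) ^ 2 / 2)) ⟨.int (-n), .lam, .lam⟩ ⟨.lam, .lam, .lam⟩
  | dnSecondLoop (n₁ n₃ : ℤ) (h₁ : 0 < n₁) (h₃ : -n₁ < n₃) (h : n₃ ≠ 0) :
      BranchTable L (-((n₁ : ℝ) ^ 2 / 2)) ⟨.int (-n₁), .lam, .int n₃⟩ ⟨.lam, .lam, .int n₃⟩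

/-! ### Symmetries of the graph -/

/-- Reverse the direction of `e₁`. -/
def GraphFun.R₁ (Φ : GraphFun) : GraphFun := ⟨fun x => Φ.e₁ (-x), Φ.e₂, Φ.e₃⟩

/-- Exchange `e₁` and `e₃` (and the vertices) and reverse the direction of `e₂`. -/
def GraphFun.R₂ (Φ : GraphFun) : GraphFun := ⟨Φ.e₃, fun x => Φ.e₂ (-x), Φ.e₁⟩

/-- Reverse the direction of `e₃`. -/
def GraphFun.R₃ (Φ : GraphFun) : GraphFun := ⟨Φ.e₁, Φ.e₂, fun x => Φ.e₃ (-x)⟩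

/-- `Φ` and `Ψ`, as functions on the graph, lie in one orbit of the group generated by `R₁`, `R₂`,
`R₃` (which are involutions). -/
def SymmetryRelated (L : ℝ) : GraphFun → GraphFun → Prop :=
  Relation.ReflTransGen fun Φ Ψ =>
    Ψ.onGraph L = Φ.R₁.onGraph L ∨ Ψ.onGraph L = Φ.R₂.onGraph L ∨ Ψ.onGraph L = Φ.R₃.onGraph L

/-! The equation is a conservative system with first integral `energy`, that is v² + u⁴ + Λu². Up to
translation and sign the energy determines the solution: cnoidal solutions have positive energy,
dnoidal ones energy strictly between -Λ²/4 and 0, and the constants ±√(-Λ/2) have energy -Λ²/4. The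
only ambiguous level is 0, which holds the zero solution and, for Λ < 0, the homoclinic sech
solutions. Hence every initial value problem has an explicit global solution (`exists_isSol`), and
edges may be treated as pieces of orbits on the line. At fixed Λ the energy is a strictly monotone
function of the period (`cnEnergy_lt`, `dnEnergy_lt`).

A complete loop contributes no net flux at its vertex. If both loops are complete, the solution on
the central edge is therefore at rest at both ends and has period 4L, while the loops have period
2π; so each edge has a label, and a label amounts to an energy (`Label.eq_of_energy_eq`, with the
zero solution treated apart). At a vertex the positions agree and the central edge is at rest, so
the energy of the loop exceeds that of the central edge by the square of the velocity of the loop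
there. Conversely, valid labels whose energies satisfy these two inequalities are realized, provided
that a zero loop sits beside a zero centre (`Triple.Admissible`, `TypeData.hasType`).
Classification, thresholds and branches thereby become statements about label energies as functions
of Λ. At its threshold a cnoidal label has the energy 0 of the zero solution and a dnoidal label the
energy -Λ²/4 of a constant. Energies are continuous up to the threshold, and amplitudes and
velocities are obtained from them by square roots, which yields the bifurcations
(`bifurcatesFrom_of_emerges`). Comparing energies of labels of one kind means comparing periods;
absence of resonances makes these comparisons strict, and the list is complete
(`Triple.Admissible.mem_table`).

An incomplete loop is even about its midpoint, so a wave with such a first loop is shot from the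
value p at the midpoint. What remains to be satisfied on the other side is one equation in p,
analytic because the flow is (`contDiff_flowMap`). Its solutions are countable as soon as it is not
an identity (`exists_midVelocity_ne_zero`, `exists_centreEnd_snd_ne_zero`). Solutions of arbitrarily
large amplitude come from a phase count: passing from n to n + 1/2 periods on the loop with n large
raises the frequency on the central edge by a definite factor, since the flux condition doubles the
velocity at the vertex, and the phase at a fixed point of that edge sweeps an interval of length at
least 2 (`exists_cnPhase_eq`). -/

/-! ### Global solutions of the stationary equation -/

/-- `u` solves `-u'' - 2u³ - Λu = 0` on the line and `v = u'`. -/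
def IsSol (Λ : ℝ) (u v : ℝ → ℝ) : Prop :=
  ∀ x, HasDerivAt u (v x) x ∧ HasDerivAt v (-2 * u x ^ 3 - Λ * u x) x

/-- The first integral, at position `a` and velocity `b`. -/
def energy (Λ a b : ℝ) : ℝ := b ^ 2 + a ^ 4 + Λ * a ^ 2

/-- The vector field of the stationary equation, as a first order system. -/
def field (Λ : ℝ) (z : ℝ × ℝ) : ℝ × ℝ := (z.2, -2 * z.1 ^ 3 - Λ * z.1)

/-- The cubic field is only locally Lipschitz; uniqueness is argued on a ball containing both
trajectories. The factor c is the time rescaling that reduces [0, h] to the unit interval. -/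
lemma lipschitzOnWith_field (c Λ R : ℝ) :
    ∃ K, LipschitzOnWith K (fun z => c • field Λ z) (Metric.closedBall 0 R) := by
  have h : ContDiff ℝ 1 (fun z => c • field Λ z) := by unfold field; fun_prop
  exact (h.locallyLipschitz.locallyLipschitzOn).exists_lipschitzOnWith_of_compact
    (isCompact_closedBall 0 R)

/-- One-sided derivatives are what curves on the unit interval have after constant extension to the
line, which is how solutions of the integral equation arise. -/
lemma field_unique_right {c Λ a b : ℝ} {f g : ℝ → ℝ × ℝ}
    (hf : ContinuousOn f (Icc a b)) (hg : ContinuousOn g (Icc a b))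
    (hf' : ∀ t ∈ Ico a b, HasDerivWithinAt f (c • field Λ (f t)) (Ici t) t)
    (hg' : ∀ t ∈ Ico a b, HasDerivWithinAt g (c • field Λ (g t)) (Ici t) t)
    (h : f a = g a) : EqOn f g (Icc a b) := by
  obtain ⟨R₁, h₁⟩ := (isCompact_Icc.image_of_continuousOn hf).isBounded.subset_closedBall 0
  obtain ⟨R₂, h₂⟩ := (isCompact_Icc.image_of_continuousOn hg).isBounded.subset_closedBall 0
  obtain ⟨K, hK⟩ := lipschitzOnWith_field c Λ (max R₁ R₂)
  refine ODE_solution_unique_of_mem_Icc_right (v := fun _ z => c • field Λ z)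
    (s := fun _ => Metric.closedBall 0 (max R₁ R₂)) (fun _ _ => hK) hf hf' ?_ hg hg' ?_ h
  · intro t ht
    exact Metric.closedBall_subset_closedBall (le_max_left _ _)
      (h₁ (mem_image_of_mem f (Ico_subset_Icc_self ht)))
  · intro t ht
    exact Metric.closedBall_subset_closedBall (le_max_right _ _)
      (h₂ (mem_image_of_mem g (Ico_subset_Icc_self ht)))

lemma field_unique {Λ a b t₀ : ℝ} {f g : ℝ → ℝ × ℝ} (ht₀ : t₀ ∈ Ioo a b)
    (hf : ContinuousOn f (Icc a b)) (hg : ContinuousOn g (Icc a b))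
    (hf' : ∀ t ∈ Ioo a b, HasDerivAt f (field Λ (f t)) t)
    (hg' : ∀ t ∈ Ioo a b, HasDerivAt g (field Λ (g t)) t)
    (h : f t₀ = g t₀) : EqOn f g (Icc a b) := by
  obtain ⟨R₁, h₁⟩ := (isCompact_Icc.image_of_continuousOn hf).isBounded.subset_closedBall 0
  obtain ⟨R₂, h₂⟩ := (isCompact_Icc.image_of_continuousOn hg).isBounded.subset_closedBall 0
  obtain ⟨K, hK⟩ := lipschitzOnWith_field 1 Λ (max R₁ R₂)
  simp only [one_smul] at hK
  refine ODE_solution_unique_of_mem_Icc (v := fun _ => field Λ)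
    (s := fun _ => Metric.closedBall 0 (max R₁ R₂)) (fun _ _ => hK) ht₀ hf hf' ?_ hg hg' ?_ h
  · intro t ht
    exact Metric.closedBall_subset_closedBall (le_max_left _ _)
      (h₁ (mem_image_of_mem f (Ioo_subset_Icc_self ht)))
  · intro t ht
    exact Metric.closedBall_subset_closedBall (le_max_right _ _)
      (h₂ (mem_image_of_mem g (Ioo_subset_Icc_self ht)))

namespace IsSol

variable {Λ : ℝ} {u v u' v' : ℝ → ℝ}

lemma continuous_left (h : IsSol Λ u v) : Continuous u :=
  continuous_iff_continuousAt.2 fun x => (h x).1.continuousAt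

lemma continuous_right (h : IsSol Λ u v) : Continuous v :=
  continuous_iff_continuousAt.2 fun x => (h x).2.continuousAt

lemma deriv_left (h : IsSol Λ u v) : deriv u = v := funext fun x => (h x).1.deriv

lemma deriv_right (h : IsSol Λ u v) : deriv v = fun x => -2 * u x ^ 3 - Λ * u x :=
  funext fun x => (h x).2.deriv

lemma contDiff (h : IsSol Λ u v) : ContDiff ℝ 2 u := by
  have hu : Differentiable ℝ u := fun x => (h x).1.differentiableAt
  have hv : Differentiable ℝ v := fun x => (h x).2.differentiableAt
  rw [show (2 : WithTop ℕ∞) = 1 + 1 by norm_num, contDiff_succ_iff_deriv]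
  refine ⟨hu, by simp, ?_⟩
  rw [h.deriv_left, contDiff_one_iff_deriv]
  refine ⟨hv, ?_⟩
  rw [h.deriv_right]
  have := h.continuous_left
  fun_prop

lemma deriv_deriv (h : IsSol Λ u v) (x : ℝ) :
    -deriv (deriv u) x - 2 * u x ^ 3 - Λ * u x = 0 := by
  rw [h.deriv_left, h.deriv_right]; ring

lemma hasDerivAt_prod (h : IsSol Λ u v) (x : ℝ) :
    HasDerivAt (fun x => (u x, v x)) (field Λ (u x, v x)) x :=
  (h x).1.prodMk (h x).2

lemma unique (h : IsSol Λ u v) (h' : IsSol Λ u' v') {x₀ : ℝ} (hu : u x₀ = u' x₀)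
    (hv : v x₀ = v' x₀) : u = u' ∧ v = v' := by
  have key : ∀ x, u x = u' x ∧ v x = v' x := by
    intro x
    have := field_unique (Λ := Λ) (a := min x x₀ - 1) (b := max x x₀ + 1) (t₀ := x₀)
      (f := fun x => (u x, v x)) (g := fun x => (u' x, v' x))
      ⟨by linarith [min_le_right x x₀], by linarith [le_max_right x x₀]⟩
      (h.continuous_left.prodMk h.continuous_right).continuousOn
      (h'.continuous_left.prodMk h'.continuous_right).continuousOn
      (fun t _ => h.hasDerivAt_prod t) (fun t _ => h'.hasDerivAt_prod t) (by simp [hu, hv])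
      (⟨by linarith [min_le_left x x₀], by linarith [le_max_left x x₀]⟩ :
        x ∈ Icc (min x x₀ - 1) (max x x₀ + 1))
    simpa using this
  exact ⟨funext fun x => (key x).1, funext fun x => (key x).2⟩

lemma energy_eq (h : IsSol Λ u v) (x y : ℝ) : energy Λ (u x) (v x) = energy Λ (u y) (v y) := by
  have hd : ∀ x, HasDerivAt (fun x => energy Λ (u x) (v x)) 0 x := by
    intro x
    have := (((h x).2.pow 2).add ((h x).1.pow 4)).add (((h x).1.pow 2).const_mul Λ)
    refine (this.congr_deriv ?_).congr_of_eventuallyEq (Eventually.of_forall fun y => ?_)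
    · simp; ring
    · simp [energy]
  exact is_const_of_deriv_eq_zero (fun x => (hd x).differentiableAt) (fun x => (hd x).deriv) x y

lemma comp_add (h : IsSol Λ u v) (c : ℝ) : IsSol Λ (fun x => u (x + c)) (fun x => v (x + c)) :=
  fun x => ⟨(h (x + c)).1.comp_add_const x c, (h (x + c)).2.comp_add_const x c⟩

lemma comp_neg (h : IsSol Λ u v) : IsSol Λ (fun x => u (-x)) (fun x => -v (-x)) := by
  intro x
  have hn := hasDerivAt_neg x
  exact ⟨((h (-x)).1.comp x hn).congr_deriv (by ring),
    ((h (-x)).2.comp x hn).neg.congr_deriv (by ring)⟩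

lemma neg (h : IsSol Λ u v) : IsSol Λ (fun x => -u x) (fun x => -v x) := by
  intro x
  exact ⟨(h x).1.neg, (h x).2.neg.congr_deriv (by ring)⟩

lemma zero (Λ : ℝ) : IsSol Λ (fun _ => 0) (fun _ => 0) := by
  intro x
  exact ⟨hasDerivAt_const x 0, (hasDerivAt_const x (0 : ℝ)).congr_deriv (by ring)⟩

lemma const {c : ℝ} (hc : 2 * c ^ 2 = -Λ) : IsSol Λ (fun _ => c) (fun _ => 0) := by
  intro x
  exact ⟨hasDerivAt_const x c, (hasDerivAt_const x (0 : ℝ)).congr_deriv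
    (by linear_combination c * hc)⟩

lemma periodic_of_eq (h : IsSol Λ u v) {x T : ℝ} (hu : u (x + T) = u x) (hv : v (x + T) = v x) :
    Function.Periodic u T ∧ Function.Periodic v T := by
  obtain ⟨h₁, h₂⟩ := (h.comp_add T).unique h (x₀ := x) hu hv
  exact ⟨fun y => congrFun h₁ y, fun y => congrFun h₂ y⟩

/-- Reflection in a point preserves the equation, and at a critical point it preserves the data as
well. -/
lemma eq_reflect (h : IsSol Λ u v) {x₀ : ℝ} (hv : v x₀ = 0) (x : ℝ) :
    u (2 * x₀ - x) = u x ∧ v (2 * x₀ - x) = -v x := by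
  have h₁ := (h.comp_neg).comp_add (-(2 * x₀))
  obtain ⟨h₂, h₃⟩ := h₁.unique h (x₀ := x₀) (by ring_nf) (by ring_nf; simp [hv])
  have e : -(x + -(2 * x₀)) = 2 * x₀ - x := by ring
  have h₄ := congrFun h₂ x
  have h₅ := congrFun h₃ x
  simp only [e] at h₄ h₅
  exact ⟨h₄, by linarith⟩

end IsSol

/-! ### Solutions on an edge -/

lemma edgeDeriv_eq_of_eqOn {ℓ : ℝ} (hℓ : 0 < ℓ) {φ u v : ℝ → ℝ} {Λ : ℝ} (h : IsSol Λ u v)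
    (he : EqOn φ u (Icc (-ℓ) ℓ)) {x : ℝ} (hx : x ∈ Icc (-ℓ) ℓ) : edgeDeriv ℓ φ x = v x := by
  rw [edgeDeriv, derivWithin_congr he (he hx)]
  exact (h x).1.hasDerivWithinAt.derivWithin (uniqueDiffOn_Icc (by linarith) x hx)

lemma IsSol.solvesOnEdge {ℓ : ℝ} {φ u v : ℝ → ℝ} {Λ : ℝ} (h : IsSol Λ u v)
    (he : EqOn φ u (Icc (-ℓ) ℓ)) : SolvesOnEdge Λ ℓ φ := by
  refine ⟨h.contDiff.contDiffOn.congr he, fun x hx => ?_⟩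
  have h₁ : φ =ᶠ[𝓝 x] u := by
    filter_upwards [Icc_mem_nhds hx.1 hx.2] with y hy using he hy
  rw [h₁.deriv.deriv_eq, h₁.eq_of_nhds]
  exact h.deriv_deriv x

/-- A solution on an edge extends to the line, as soon as the initial value problem has global
solutions. -/
lemma SolvesOnEdge.exists_isSol {Λ ℓ : ℝ} (hℓ : 0 < ℓ) {φ : ℝ → ℝ} (h : SolvesOnEdge Λ ℓ φ)
    (hex : ∀ a b, ∃ u v, IsSol Λ u v ∧ u 0 = a ∧ v 0 = b) :
    ∃ u v, IsSol Λ u v ∧ EqOn φ u (Icc (-ℓ) ℓ) := by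
  set S := Icc (-ℓ) ℓ
  have hS : UniqueDiffOn ℝ S := uniqueDiffOn_Icc (by linarith)
  set w := derivWithin φ S
  have hw : ContDiffOn ℝ 1 w S := h.1.derivWithin hS (by norm_num)
  obtain ⟨u, v, huv, hu0, hv0⟩ := hex (φ 0) (w 0)
  refine ⟨u, v, huv, ?_⟩
  have hd : ∀ t ∈ Ioo (-ℓ) ℓ, HasDerivAt φ (w t) t := fun t ht =>
    ((h.1.differentiableOn (by norm_num) t (Ioo_subset_Icc_self ht)).hasDerivWithinAt).hasDerivAt
      (Icc_mem_nhds ht.1 ht.2)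
  have hd' : ∀ t ∈ Ioo (-ℓ) ℓ, HasDerivAt w (-2 * φ t ^ 3 - Λ * φ t) t := by
    intro t ht
    have h₁ := ((hw.differentiableOn (by norm_num) t
      (Ioo_subset_Icc_self ht)).hasDerivWithinAt).hasDerivAt (Icc_mem_nhds ht.1 ht.2)
    have h₂ : deriv φ =ᶠ[𝓝 t] w := by
      filter_upwards [Ioo_mem_nhds ht.1 ht.2] with y hy using (hd y hy).deriv
    have h₃ := h.2 t ht
    rw [h₂.deriv_eq, h₁.deriv] at h₃
    exact h₁.congr_deriv (by linarith)
  have := field_unique (Λ := Λ) (a := -ℓ) (b := ℓ) (t₀ := 0)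
      (f := fun x => (φ x, w x)) (g := fun x => (u x, v x))
      ⟨by linarith, hℓ⟩ (h.1.continuousOn.prodMk hw.continuousOn)
      (huv.continuous_left.prodMk huv.continuous_right).continuousOn
      (fun t ht => (hd t ht).prodMk (hd' t ht)) (fun t _ => huv.hasDerivAt_prod t)
      (by simp [hu0, hv0])
  exact fun x hx => congrArg Prod.fst (this hx)

/-- Two global solutions that agree on an edge agree everywhere. -/
lemma IsSol.eq_of_eqOn {Λ ℓ : ℝ} (hℓ : 0 < ℓ) {u v u' v' : ℝ → ℝ} (h : IsSol Λ u v)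
    (h' : IsSol Λ u' v') (he : EqOn u u' (Icc (-ℓ) ℓ)) : u = u' ∧ v = v' := by
  have h0 : (0 : ℝ) ∈ Icc (-ℓ) ℓ := ⟨by linarith, hℓ.le⟩
  refine h.unique h' (x₀ := 0) (he h0) ?_
  rw [← edgeDeriv_eq_of_eqOn hℓ h' he h0, ← edgeDeriv_eq_of_eqOn hℓ h (fun _ _ => rfl) h0]


/-! ### Elliptic integrals and the amplitude -/

section Elliptic

variable {k : ℝ}

lemma one_sub_sq_mul_sin_sq_pos (hk : k ^ 2 < 1) (θ : ℝ) : 0 < 1 - k ^ 2 * sin θ ^ 2 := by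
  nlinarith [sin_sq_le_one θ, sq_nonneg k, sq_nonneg (sin θ)]

lemma continuous_elliptic_integrand (hk : k ^ 2 < 1) :
    Continuous fun θ : ℝ => 1 / √(1 - k ^ 2 * sin θ ^ 2) := by
  refine continuous_const.div (by fun_prop) fun θ => ?_
  exact (sqrt_pos.2 (one_sub_sq_mul_sin_sq_pos hk θ)).ne'

lemma intervalIntegrable_elliptic (hk : k ^ 2 < 1) (a b : ℝ) :
    IntervalIntegrable (fun θ : ℝ => 1 / √(1 - k ^ 2 * sin θ ^ 2)) MeasureTheory.volume a b :=
  (continuous_elliptic_integrand hk).intervalIntegrable a b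

lemma hasDerivAt_ellipticF (hk : k ^ 2 < 1) (φ : ℝ) :
    HasDerivAt (ellipticF k) (1 / √(1 - k ^ 2 * sin φ ^ 2)) φ :=
  (continuous_elliptic_integrand hk).integral_hasStrictDerivAt 0 φ |>.hasDerivAt

lemma strictMono_ellipticF (hk : k ^ 2 < 1) : StrictMono (ellipticF k) := by
  refine strictMono_of_deriv_pos fun φ => ?_
  rw [(hasDerivAt_ellipticF hk φ).deriv]
  exact one_div_pos.2 (sqrt_pos.2 (one_sub_sq_mul_sin_sq_pos hk φ))

lemma continuous_ellipticF (hk : k ^ 2 < 1) : Continuous (ellipticF k) :=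
  continuous_iff_continuousAt.2 fun φ => (hasDerivAt_ellipticF hk φ).continuousAt

@[simp] lemma ellipticF_zero : ellipticF k 0 = 0 := by simp [ellipticF]

lemma ellipticF_neg (φ : ℝ) : ellipticF k (-φ) = -ellipticF k φ := by
  have := intervalIntegral.integral_comp_neg (a := 0) (b := φ)
    (fun θ : ℝ => 1 / √(1 - k ^ 2 * sin θ ^ 2))
  simp only [sin_neg, neg_sq, neg_zero] at this
  rw [ellipticF, ellipticF, this, intervalIntegral.integral_symm]

lemma ellipticF_add_pi (hk : k ^ 2 < 1) (φ : ℝ) :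
    ellipticF k (φ + π) = ellipticF k φ + ellipticF k π := by
  have hp : Function.Periodic (fun θ : ℝ => 1 / √(1 - k ^ 2 * sin θ ^ 2)) π := by
    intro θ; simp [sin_add_pi]
  have h₁ := hp.intervalIntegral_add_eq φ 0
  rw [ellipticF, ellipticF, ellipticF, ← intervalIntegral.integral_add_adjacent_intervals
    (intervalIntegrable_elliptic hk 0 φ) (intervalIntegrable_elliptic hk φ (φ + π)), h₁, zero_add]

lemma ellipticF_pi (hk : k ^ 2 < 1) : ellipticF k π = 2 * ellipticK k := by
  have h := ellipticF_add_pi hk (-(π / 2))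
  rw [ellipticF_neg, show -(π / 2) + π = π / 2 by ring] at h
  rw [ellipticK]; linarith

lemma ellipticF_add_int_mul_pi (hk : k ^ 2 < 1) (φ : ℝ) (n : ℤ) :
    ellipticF k (φ + n * π) = ellipticF k φ + n * (2 * ellipticK k) := by
  induction n using Int.induction_on with
  | zero => simp
  | succ n ih =>
    have := ellipticF_add_pi hk (φ + n * π)
    rw [ellipticF_pi hk] at this
    push_cast at ih ⊢
    rw [show φ + ((n : ℝ) + 1) * π = φ + n * π + π by ring, this, ih]; ring
  | pred n ih =>
    have := ellipticF_add_pi hk (φ + (-(n : ℝ) - 1) * π)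
    rw [ellipticF_pi hk, show φ + (-(n : ℝ) - 1) * π + π = φ + -(n : ℝ) * π by ring] at this
    push_cast at ih ⊢
    linarith

lemma ellipticF_int_mul_pi (hk : k ^ 2 < 1) (n : ℤ) :
    ellipticF k (n * π) = n * (2 * ellipticK k) := by
  have := ellipticF_add_int_mul_pi hk 0 n
  simpa using this

lemma ellipticK_pos (hk : k ^ 2 < 1) : 0 < ellipticK k := by
  have := strictMono_ellipticF hk (show (0 : ℝ) < π / 2 by positivity)
  rwa [ellipticF_zero] at this

/-- Unbounded in both directions because each step by π adds 2K. -/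
lemma bijective_ellipticF (hk : k ^ 2 < 1) : Function.Bijective (ellipticF k) := by
  refine ⟨(strictMono_ellipticF hk).injective, fun y => ?_⟩
  have hK := ellipticK_pos hk
  obtain ⟨n, hn⟩ := exists_nat_gt (|y| / (2 * ellipticK k))
  rw [div_lt_iff₀ (by positivity)] at hn
  have h₁ := ellipticF_int_mul_pi hk n
  have h₂ := ellipticF_int_mul_pi hk (-n)
  push_cast at h₁ h₂
  have := mem_range_of_exists_le_of_exists_ge (continuous_ellipticF hk) (c := y)
    ⟨-(n : ℝ) * π, by rw [h₂]; linarith [neg_abs_le y]⟩ ⟨n * π, by rw [h₁]; linarith [le_abs_self y]⟩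
  exact this

lemma ellipticF_jacobiAm (hk : k ^ 2 < 1) (u : ℝ) : ellipticF k (jacobiAm u k) = u :=
  Function.rightInverse_invFun (bijective_ellipticF hk).2 u

lemma jacobiAm_ellipticF (hk : k ^ 2 < 1) (φ : ℝ) : jacobiAm (ellipticF k φ) k = φ :=
  Function.leftInverse_invFun (bijective_ellipticF hk).1 φ

lemma strictMono_jacobiAm (hk : k ^ 2 < 1) : StrictMono fun u => jacobiAm u k := by
  intro u v huv
  rw [← (strictMono_ellipticF hk).lt_iff_lt, ellipticF_jacobiAm hk, ellipticF_jacobiAm hk]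
  exact huv

lemma continuous_jacobiAm (hk : k ^ 2 < 1) : Continuous fun u => jacobiAm u k :=
  (strictMono_jacobiAm hk).monotone.continuous_of_surjective
    fun φ => ⟨ellipticF k φ, jacobiAm_ellipticF hk φ⟩

lemma hasDerivAt_jacobiAm (hk : k ^ 2 < 1) (u : ℝ) :
    HasDerivAt (fun u => jacobiAm u k) (√(1 - k ^ 2 * sin (jacobiAm u k) ^ 2)) u := by
  have hp := sqrt_pos.2 (one_sub_sq_mul_sin_sq_pos hk (jacobiAm u k))
  have h := HasDerivAt.of_local_left_inverse (f := ellipticF k) (g := fun u => jacobiAm u k)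
    (continuous_jacobiAm hk).continuousAt (hasDerivAt_ellipticF hk _) (one_div_pos.2 hp).ne'
    (Eventually.of_forall fun u => ellipticF_jacobiAm hk u)
  simpa using h

lemma jacobiAm_add (hk : k ^ 2 < 1) (u : ℝ) (n : ℤ) :
    jacobiAm (u + n * (2 * ellipticK k)) k = jacobiAm u k + n * π := by
  apply (strictMono_ellipticF hk).injective
  rw [ellipticF_jacobiAm hk, ellipticF_add_int_mul_pi hk, ellipticF_jacobiAm hk]

lemma jacobiDn_sq (hk : k ^ 2 < 1) (u : ℝ) :
    jacobiDn u k ^ 2 = 1 - k ^ 2 * sin (jacobiAm u k) ^ 2 :=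
  sq_sqrt (one_sub_sq_mul_sin_sq_pos hk _).le

lemma jacobiDn_pos (hk : k ^ 2 < 1) (u : ℝ) : 0 < jacobiDn u k :=
  sqrt_pos.2 (one_sub_sq_mul_sin_sq_pos hk _)

lemma hasDerivAt_jacobiCn (hk : k ^ 2 < 1) (u : ℝ) :
    HasDerivAt (fun u => jacobiCn u k) (-(sin (jacobiAm u k) * jacobiDn u k)) u := by
  have := (hasDerivAt_jacobiAm hk u).cos
  exact this.congr_deriv (by rw [jacobiDn]; ring)

lemma hasDerivAt_jacobiDn (hk : k ^ 2 < 1) (u : ℝ) :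
    HasDerivAt (fun u => jacobiDn u k) (-(k ^ 2 * sin (jacobiAm u k) * jacobiCn u k)) u := by
  have hd := jacobiDn_pos hk u
  have h₁ := (((hasDerivAt_jacobiAm hk u).sin.pow 2).const_mul (k ^ 2)).const_sub 1
  have h₂ := h₁.sqrt (one_sub_sq_mul_sin_sq_pos hk _).ne'
  refine h₂.congr_deriv ?_
  change _ / (2 * jacobiDn u k) = _
  rw [div_eq_iff (by positivity)]
  simp only [jacobiCn, jacobiDn]
  ring

lemma hasDerivAt_sin_jacobiAm (hk : k ^ 2 < 1) (u : ℝ) :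
    HasDerivAt (fun u => sin (jacobiAm u k)) (jacobiCn u k * jacobiDn u k) u :=
  (hasDerivAt_jacobiAm hk u).sin

end Elliptic

/-! ### The cnoidal and dnoidal solutions -/

/-- Derivative of the cnoidal solution. -/
noncomputable def cnVel (κ β τ x : ℝ) : ℝ :=
  -(κ * β ^ 2 * (sin (jacobiAm (β * x - τ) κ) * jacobiDn (β * x - τ) κ))

/-- Derivative of the dnoidal solution. -/
noncomputable def dnVel (k b σ τ x : ℝ) : ℝ :=
  -(σ * b ^ 2 * (k ^ 2 * sin (jacobiAm (b * x - τ) k) * jacobiCn (b * x - τ) k))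

lemma hasDerivAt_affine (β τ x : ℝ) : HasDerivAt (fun x => β * x - τ) β x := by
  simpa using ((hasDerivAt_id x).const_mul β).sub_const τ

/-- Differentiating twice leaves a polynomial identity in s = sin am, c = cn, d = dn, modulo d² = 1
- κ²s² and s² + c² = 1. -/
lemma isSol_cn {κ : ℝ} (hκ : κ ^ 2 < 1) (β τ : ℝ) :
    IsSol (β ^ 2 * (1 - 2 * κ ^ 2)) (fun x => κ * β * jacobiCn (β * x - τ) κ)
      (cnVel κ β τ) := by
  intro x
  have ha := hasDerivAt_affine β τ x
  constructor
  · refine (((hasDerivAt_jacobiCn hκ _).comp x ha).const_mul (κ * β)).congr_deriv ?_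
    simp only [cnVel]; ring
  · refine ((((hasDerivAt_sin_jacobiAm hκ _).comp x ha).mul
      ((hasDerivAt_jacobiDn hκ _).comp x ha)).const_mul (κ * β ^ 2)).neg.congr_deriv ?_
    have h₁ := jacobiDn_sq hκ (β * x - τ)
    have h₂ := sin_sq_add_cos_sq (jacobiAm (β * x - τ) κ)
    simp only [Function.comp_def, jacobiCn] at *
    set s := sin (jacobiAm (β * x - τ) κ)
    set c := cos (jacobiAm (β * x - τ) κ)
    set d := jacobiDn (β * x - τ) κ
    linear_combination (-κ * β ^ 3 * c) * h₁ + (2 * κ ^ 3 * β ^ 3 * c) * h₂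

lemma isSol_dn {k : ℝ} (hk : k ^ 2 < 1) (b τ : ℝ) {σ : ℝ} (hσ : σ ^ 2 = 1) :
    IsSol (-(b ^ 2 * (2 - k ^ 2))) (fun x => σ * b * jacobiDn (b * x - τ) k)
      (dnVel k b σ τ) := by
  intro x
  have ha := hasDerivAt_affine b τ x
  constructor
  · refine (((hasDerivAt_jacobiDn hk _).comp x ha).const_mul (σ * b)).congr_deriv ?_
    simp only [dnVel]; ring
  · refine (((((hasDerivAt_sin_jacobiAm hk _).comp x ha).const_mul (k ^ 2)).mul
      ((hasDerivAt_jacobiCn hk _).comp x ha)).const_mul (σ * b ^ 2)).neg.congr_deriv ?_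
    have h₁ := jacobiDn_sq hk (b * x - τ)
    have h₂ := sin_sq_add_cos_sq (jacobiAm (b * x - τ) k)
    simp only [Function.comp_def, jacobiCn] at *
    set s := sin (jacobiAm (b * x - τ) k)
    set c := cos (jacobiAm (b * x - τ) k)
    set d := jacobiDn (b * x - τ) k
    linear_combination (2 * σ * b ^ 3 * d) * h₁ + (-σ * b ^ 3 * k ^ 2 * d) * h₂ +
      (2 * σ * b ^ 3 * d ^ 3) * hσ


/-! ### Energies and initial data of the explicit solutions -/

lemma energy_cn {κ : ℝ} (hκ : κ ^ 2 < 1) (β τ x : ℝ) :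
    energy (β ^ 2 * (1 - 2 * κ ^ 2)) (κ * β * jacobiCn (β * x - τ) κ) (cnVel κ β τ x) =
      κ ^ 2 * β ^ 4 * (1 - κ ^ 2) := by
  have h₁ := jacobiDn_sq hκ (β * x - τ)
  have h₂ := sin_sq_add_cos_sq (jacobiAm (β * x - τ) κ)
  simp only [energy, cnVel, jacobiCn] at *
  set s := sin (jacobiAm (β * x - τ) κ)
  set c := cos (jacobiAm (β * x - τ) κ)
  set d := jacobiDn (β * x - τ) κ
  have hc : c ^ 2 = 1 - s ^ 2 := by linarith
  have hc4 : c ^ 4 = (1 - s ^ 2) ^ 2 := by rw [← hc]; ring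
  calc _ = κ ^ 2 * β ^ 4 * s ^ 2 * d ^ 2 + κ ^ 4 * β ^ 4 * c ^ 4 +
        β ^ 2 * (1 - 2 * κ ^ 2) * κ ^ 2 * β ^ 2 * c ^ 2 := by ring
    _ = _ := by rw [h₁, hc, hc4]; ring

lemma energy_dn {k : ℝ} (hk : k ^ 2 < 1) (b τ x : ℝ) {σ : ℝ} (hσ : σ ^ 2 = 1) :
    energy (-(b ^ 2 * (2 - k ^ 2))) (σ * b * jacobiDn (b * x - τ) k) (dnVel k b σ τ x) =
      -(b ^ 4 * (1 - k ^ 2)) := by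
  have h₁ := jacobiDn_sq hk (b * x - τ)
  have h₂ := sin_sq_add_cos_sq (jacobiAm (b * x - τ) k)
  simp only [energy, dnVel, jacobiCn] at *
  set s := sin (jacobiAm (b * x - τ) k)
  set c := cos (jacobiAm (b * x - τ) k)
  set d := jacobiDn (b * x - τ) k
  have hc : c ^ 2 = 1 - s ^ 2 := by linarith
  calc _ = σ ^ 2 * (b ^ 4 * k ^ 4 * s ^ 2 * c ^ 2) + (σ ^ 2) ^ 2 * b ^ 4 * (d ^ 2) ^ 2 +
        -(b ^ 2 * (2 - k ^ 2)) * σ ^ 2 * b ^ 2 * d ^ 2 := by ring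
    _ = _ := by rw [h₁, hc, hσ]; ring

/-- The energy relation factors as (a² - κ²β²)(a² + β²(1 - κ²)) = -b², and the second factor is
positive. -/
lemma abs_div_le_one_of_energy {κ β a b : ℝ} (hκ : κ ∈ Ioo (0 : ℝ) 1) (hβ : 0 < β)
    (h : energy (β ^ 2 * (1 - 2 * κ ^ 2)) a b = κ ^ 2 * β ^ 4 * (1 - κ ^ 2)) :
    -1 ≤ a / (κ * β) ∧ a / (κ * β) ≤ 1 := by
  have hκ1 : κ ^ 2 < 1 := by nlinarith [hκ.1, hκ.2]
  have hA : 0 < κ * β := mul_pos hκ.1 hβ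
  have hle : a ^ 2 ≤ (κ * β) ^ 2 := by
    by_contra hcon
    push Not at hcon
    have h₁ : 0 < a ^ 2 + β ^ 2 * (1 - κ ^ 2) := by
      have : 0 < β ^ 2 * (1 - κ ^ 2) := mul_pos (by positivity) (by linarith)
      positivity
    have h₂ := mul_pos (sub_pos.2 hcon) h₁
    rw [energy] at h
    nlinarith [sq_nonneg b]
  have habs := abs_le_of_sq_le_sq' hle hA.le
  exact ⟨by rw [le_div_iff₀ hA]; linarith [habs.1], by rw [div_le_iff₀ hA]; linarith [habs.2]⟩

/-- The position fixes the cosine of the phase, and the energy then fixes the velocity up to sign.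
The condition on b sin φ selects the sign: were the velocity -b, then b² ≤ 0. -/
lemma cn_data_of_cos_eq {κ β a b φ : ℝ} (hκ : κ ∈ Ioo (0 : ℝ) 1) (hβ : 0 < β)
    (h : energy (β ^ 2 * (1 - 2 * κ ^ 2)) a b = κ ^ 2 * β ^ 4 * (1 - κ ^ 2))
    (hφ : cos φ = a / (κ * β)) (hs : b * sin φ ≤ 0) :
    κ * β * jacobiCn (β * 0 - -ellipticF κ φ) κ = a ∧ cnVel κ β (-ellipticF κ φ) 0 = b := by
  have hκ1 : κ ^ 2 < 1 := by nlinarith [hκ.1, hκ.2]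
  have hA : 0 < κ * β := mul_pos hκ.1 hβ
  have hcn : κ * β * jacobiCn (β * 0 - -ellipticF κ φ) κ = a := by
    simp only [jacobiCn, mul_zero, zero_sub, neg_neg, jacobiAm_ellipticF hκ1, hφ]
    exact mul_div_cancel₀ _ hA.ne'
  refine ⟨hcn, ?_⟩
  have hen := energy_cn hκ1 β (-ellipticF κ φ) 0
  rw [hcn, ← h] at hen
  have hsq : cnVel κ β (-ellipticF κ φ) 0 ^ 2 = b ^ 2 := by
    simp only [energy] at hen; linarith
  have hv : cnVel κ β (-ellipticF κ φ) 0 =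
      -(κ * β ^ 2 * (sin φ * jacobiDn (ellipticF κ φ) κ)) := by
    simp only [cnVel, mul_zero, zero_sub, neg_neg, jacobiAm_ellipticF hκ1]
  have hd := jacobiDn_pos hκ1 (ellipticF κ φ)
  rcases sq_eq_sq_iff_eq_or_eq_neg.1 hsq with h' | h'
  · exact h'
  · have h3 : b ^ 2 = b * sin φ * (κ * β ^ 2 * jacobiDn (ellipticF κ φ) κ) := by
      rw [hv] at h'
      linear_combination b * h'
    have h4 : 0 < κ * β ^ 2 * jacobiDn (ellipticF κ φ) κ := by have := hκ.1; positivity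
    have h5 : b ^ 2 ≤ 0 := by rw [h3]; exact mul_nonpos_of_nonpos_of_nonneg hs h4.le
    have h6 : b = 0 := by nlinarith
    rw [h', h6, neg_zero]

lemma sin_arccos_nonneg (x : ℝ) : 0 ≤ sin (arccos x) := sin_arccos x ▸ sqrt_nonneg _

/-- Every pair of initial data with the energy of a cnoidal solution is met by a translate. -/
lemma exists_cn_data {κ β a b : ℝ} (hκ : κ ∈ Ioo (0 : ℝ) 1) (hβ : 0 < β)
    (h : energy (β ^ 2 * (1 - 2 * κ ^ 2)) a b = κ ^ 2 * β ^ 4 * (1 - κ ^ 2)) :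
    ∃ τ, κ * β * jacobiCn (β * 0 - τ) κ = a ∧ cnVel κ β τ 0 = b := by
  obtain ⟨h1, h2⟩ := abs_div_le_one_of_energy hκ hβ h
  have hs0 := sin_arccos_nonneg (a / (κ * β))
  rcases le_total b 0 with hb | hb
  · exact ⟨_, cn_data_of_cos_eq hκ hβ h (cos_arccos h1 h2)
      (mul_nonpos_of_nonpos_of_nonneg hb hs0)⟩
  · refine ⟨_, cn_data_of_cos_eq (φ := -arccos (a / (κ * β))) hκ hβ h
      (by rw [cos_neg, cos_arccos h1 h2]) ?_⟩
    rw [sin_neg]; nlinarith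

/-- Every pair of initial data with the energy of a dnoidal solution is met by a translate, up to
the sign. -/
lemma exists_dn_data {k b a c : ℝ} (hk : k ∈ Ioo (0 : ℝ) 1) (hb : 0 < b)
    (h : energy (-(b ^ 2 * (2 - k ^ 2))) a c = -(b ^ 4 * (1 - k ^ 2))) :
    ∃ τ σ : ℝ, (σ = 1 ∨ σ = -1) ∧ σ * b * jacobiDn (b * 0 - τ) k = a ∧ dnVel k b σ τ 0 = c := by
  have hk1 : k ^ 2 < 1 := by nlinarith [hk.1, hk.2]
  have hk0 := hk.1
  -- This factorization of the energy relation confines a² to the range of the squared dn wave,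
  -- between b²(1 - k²) and b².
  have hprod : (a ^ 2 - b ^ 2) * (a ^ 2 - b ^ 2 * (1 - k ^ 2)) = -c ^ 2 := by
    rw [energy] at h; linarith
  have hlo : b ^ 2 * (1 - k ^ 2) ≤ a ^ 2 := by
    by_contra hcon
    push Not at hcon
    have : a ^ 2 < b ^ 2 := by nlinarith [mul_pos (sq_pos_of_pos hb) (sq_pos_of_pos hk0)]
    nlinarith [mul_pos (sub_pos.2 hcon) (sub_pos.2 this), sq_nonneg c]
  have hhi : a ^ 2 ≤ b ^ 2 := by
    by_contra hcon
    push Not at hcon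
    have : b ^ 2 * (1 - k ^ 2) < a ^ 2 := by
      nlinarith [mul_pos (sq_pos_of_pos hb) (sq_pos_of_pos hk0)]
    nlinarith [mul_pos (sub_pos.2 hcon) (sub_pos.2 this), sq_nonneg c]
  have ha0 : a ≠ 0 := by
    rintro rfl
    nlinarith [mul_pos (sq_pos_of_pos hb) (sub_pos.2 hk1)]
  obtain ⟨σ, hσ, hσa⟩ : ∃ σ : ℝ, (σ = 1 ∨ σ = -1) ∧ σ * |a| = a := by
    rcases abs_cases a with ⟨h, _⟩ | ⟨h, _⟩
    · exact ⟨1, Or.inl rfl, by rw [h]; ring⟩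
    · exact ⟨-1, Or.inr rfl, by rw [h]; ring⟩
  have hσ2 : σ ^ 2 = 1 := by rcases hσ with rfl | rfl <;> norm_num
  -- y is the sine of the amplitude to be reached, from 1 - k²y² = a²/b².
  set y := √((1 - a ^ 2 / b ^ 2) / k ^ 2) with hy
  have hy0 : 0 ≤ (1 - a ^ 2 / b ^ 2) / k ^ 2 := by
    apply div_nonneg _ (sq_nonneg k)
    rw [sub_nonneg, div_le_one (by positivity)]; exact hhi
  have hy1 : y ≤ 1 := by
    rw [hy, sqrt_le_one, div_le_one (by positivity), sub_le_iff_le_add, ← sub_le_iff_le_add',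
      le_div_iff₀ (by positivity)]
    linarith
  have hysq : y ^ 2 * k ^ 2 = 1 - a ^ 2 / b ^ 2 := by
    rw [hy, sq_sqrt hy0]; field_simp
  -- As for cn, the energy leaves only the sign of the velocity open, and the sign of sin φ settles
  -- it.
  have key : ∀ φ : ℝ, sin φ ^ 2 = y ^ 2 → 0 ≤ cos φ → σ * c * sin φ ≤ 0 →
      ∃ τ σ : ℝ, (σ = 1 ∨ σ = -1) ∧ σ * b * jacobiDn (b * 0 - τ) k = a ∧
        dnVel k b σ τ 0 = c := by
    intro φ hφ hcos hs
    have hdn : σ * b * jacobiDn (b * 0 - -ellipticF k φ) k = a := by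
      simp only [jacobiDn, mul_zero, zero_sub, neg_neg, jacobiAm_ellipticF hk1]
      rw [hφ, show 1 - k ^ 2 * y ^ 2 = (|a| / b) ^ 2 by rw [div_pow, sq_abs]; linarith,
        sqrt_sq (by positivity), mul_assoc, mul_div_cancel₀ _ hb.ne', hσa]
    refine ⟨-ellipticF k φ, σ, hσ, hdn, ?_⟩
    have hen := energy_dn hk1 b (-ellipticF k φ) 0 hσ2
    rw [hdn, ← h] at hen
    have hsq : dnVel k b σ (-ellipticF k φ) 0 ^ 2 = c ^ 2 := by
      simp only [energy] at hen; linarith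
    have hv : dnVel k b σ (-ellipticF k φ) 0 = -(σ * b ^ 2 * (k ^ 2 * sin φ * cos φ)) := by
      simp only [dnVel, jacobiCn, mul_zero, zero_sub, neg_neg, jacobiAm_ellipticF hk1]
    rcases sq_eq_sq_iff_eq_or_eq_neg.1 hsq with h' | h'
    · exact h'
    · have h3 : c ^ 2 = σ * c * sin φ * (b ^ 2 * k ^ 2 * cos φ) := by
        rw [hv] at h'
        linear_combination c * h'
      have h4 : 0 ≤ b ^ 2 * k ^ 2 * cos φ := by positivity
      have h5 : c ^ 2 ≤ 0 := by rw [h3]; exact mul_nonpos_of_nonpos_of_nonneg hs h4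
      have h6 : c = 0 := by nlinarith
      rw [h', h6, neg_zero]
  have hy0' : 0 ≤ y := sqrt_nonneg _
  have hsin : sin (arcsin y) = y := sin_arcsin (by linarith) hy1
  rcases le_total (σ * c) 0 with hc | hc
  · exact key (arcsin y) (by rw [hsin]) (cos_arcsin_nonneg y)
      (mul_nonpos_of_nonpos_of_nonneg hc (by rw [hsin]; exact hy0'))
  · exact key (-arcsin y) (by rw [sin_neg, hsin]; ring) (by rw [cos_neg]; exact cos_arcsin_nonneg y)
      (by rw [sin_neg, hsin]; nlinarith)

/-- The parameter `β` of a cnoidal solution, in terms of the energy. -/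
noncomputable def cnBeta (Λ E : ℝ) : ℝ := √√(Λ ^ 2 + 4 * E)

/-- The modulus of a cnoidal solution, in terms of the energy. -/
noncomputable def cnKappa (Λ E : ℝ) : ℝ := √((1 - Λ / √(Λ ^ 2 + 4 * E)) / 2)

/-- Since (1 - 2κ²)² + 4κ²(1 - κ²) = 1, eliminating κ gives β⁴ = Λ² + 4E, after which κ² = (1 -
Λ/β²)/2. -/
lemma cn_param_of_energy {Λ E : ℝ} (hE : 0 < E) :
    cnKappa Λ E ∈ Ioo (0 : ℝ) 1 ∧ 0 < cnBeta Λ E ∧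
      cnBeta Λ E ^ 2 * (1 - 2 * cnKappa Λ E ^ 2) = Λ ∧
      E = cnKappa Λ E ^ 2 * cnBeta Λ E ^ 4 * (1 - cnKappa Λ E ^ 2) := by
  rw [cnKappa, cnBeta]
  set S := √(Λ ^ 2 + 4 * E) with hS
  have hSsq : S ^ 2 = Λ ^ 2 + 4 * E := sq_sqrt (by positivity)
  have hSpos : 0 < S := sqrt_pos.2 (by positivity)
  have habs : |Λ| < S := abs_lt_of_sq_lt_sq (by linarith) hSpos.le
  obtain ⟨h1, h2⟩ := abs_lt.1 habs
  have hx0 : 0 < (1 - Λ / S) / 2 := by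
    have : Λ / S < 1 := (div_lt_one hSpos).2 h2
    linarith
  have hx1 : (1 - Λ / S) / 2 < 1 := by
    have : -1 < Λ / S := by rw [lt_div_iff₀ hSpos]; linarith
    linarith
  have hκ2 : √((1 - Λ / S) / 2) ^ 2 = (1 - Λ / S) / 2 := sq_sqrt hx0.le
  have hβ2 : √S ^ 2 = S := sq_sqrt hSpos.le
  refine ⟨⟨sqrt_pos.2 hx0, ?_⟩, sqrt_pos.2 hSpos, ?_, ?_⟩
  · rw [sqrt_lt' one_pos]; simpa using hx1
  · rw [hβ2, hκ2]; field_simp; ring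
  · rw [show √S ^ 4 = (√S ^ 2) ^ 2 by ring, hβ2, hκ2]
    field_simp
    linarith

lemma exists_cn_param {Λ E : ℝ} (hE : 0 < E) :
    ∃ κ ∈ Ioo (0 : ℝ) 1, ∃ β : ℝ, 0 < β ∧ β ^ 2 * (1 - 2 * κ ^ 2) = Λ ∧
      E = κ ^ 2 * β ^ 4 * (1 - κ ^ 2) :=
  ⟨_, (cn_param_of_energy hE).1, _, (cn_param_of_energy hE).2⟩

/-- The two relations give Λ² + 4E = b⁴k⁴. With S = b²k² the first becomes 2b² = S - Λ, whence b²
and k² = S/b². -/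
lemma exists_dn_param {Λ E : ℝ} (hΛ : Λ < 0) (hE : E < 0) (hE' : -Λ ^ 2 / 4 < E) :
    ∃ k ∈ Ioo (0 : ℝ) 1, ∃ b : ℝ, 0 < b ∧ b ^ 2 * (2 - k ^ 2) = -Λ ∧
      E = -(b ^ 4 * (1 - k ^ 2)) := by
  set S := √(Λ ^ 2 + 4 * E) with hS
  have hpos : 0 < Λ ^ 2 + 4 * E := by linarith
  have hSsq : S ^ 2 = Λ ^ 2 + 4 * E := sq_sqrt hpos.le
  have hSpos : 0 < S := sqrt_pos.2 hpos
  have hlt : S < -Λ := by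
    apply lt_of_pow_lt_pow_left₀ 2 (by linarith); rw [hSsq]; linarith
  set B := (S - Λ) / 2 with hB
  have hBpos : 0 < B := by rw [hB]; linarith
  have hk2 : √(S / B) ^ 2 = S / B := sq_sqrt (by positivity)
  have hb2 : √B ^ 2 = B := sq_sqrt hBpos.le
  refine ⟨√(S / B), ⟨sqrt_pos.2 (by positivity), ?_⟩, √B, sqrt_pos.2 hBpos, ?_, ?_⟩
  · rw [sqrt_lt' one_pos, one_pow, div_lt_one hBpos, hB]; linarith
  · rw [hb2, hk2, mul_sub, mul_div_cancel₀ _ hBpos.ne', hB]; ring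
  · rw [show √B ^ 4 = (√B ^ 2) ^ 2 by ring, hb2, hk2]
    have : B ^ 2 * (1 - S / B) = B ^ 2 - B * S := by field_simp
    rw [this, hB]; linear_combination (-1 / 4) * hSsq

/-- The solution on the separatrix. -/
lemma isSol_sech (ω τ σ : ℝ) (hσ : σ ^ 2 = 1) :
    IsSol (-ω ^ 2) (fun x => σ * ω * (cosh (ω * x - τ))⁻¹)
      (fun x => -(σ * ω ^ 2 * sinh (ω * x - τ)) * ((cosh (ω * x - τ))⁻¹) ^ 2) := by
  intro x
  have ha := hasDerivAt_affine ω τ x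
  have hc : cosh (ω * x - τ) ≠ 0 := (cosh_pos _).ne'
  have h₁ := ha.cosh.fun_inv hc
  constructor
  · refine (h₁.const_mul (σ * ω)).congr_deriv ?_
    field_simp
  · refine ((((ha.sinh).const_mul (σ * ω ^ 2)).fun_neg).fun_mul (h₁.fun_pow 2)).congr_deriv ?_
    have h₂ := cosh_sq (ω * x - τ)
    simp only [Nat.cast_ofNat, Nat.add_one_sub_one, pow_one]
    field_simp
    linear_combination (-2 * σ * ω ^ 3) * h₂ + 2 * σ * ω ^ 3 * hσ

/-- Global solutions of the initial value problem exist. -/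
theorem exists_isSol (Λ a b : ℝ) : ∃ u v, IsSol Λ u v ∧ u 0 = a ∧ v 0 = b := by
  rcases lt_trichotomy (energy Λ a b) 0 with hE | hE | hE
  · have hΛ : Λ < 0 := by
      by_contra hcon
      push Not at hcon
      have : 0 ≤ energy Λ a b := by rw [energy]; positivity
      linarith
    -- The sum of squares exhibits -Λ²/4 as the least energy, attained only at the constants.
    have hsq : energy Λ a b + Λ ^ 2 / 4 = b ^ 2 + (a ^ 2 + Λ / 2) ^ 2 := by rw [energy]; ring
    rcases eq_or_lt_of_le (show -Λ ^ 2 / 4 ≤ energy Λ a b by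
      nlinarith [sq_nonneg b, sq_nonneg (a ^ 2 + Λ / 2)]) with h | h
    · have hb : b = 0 := by nlinarith [sq_nonneg b, sq_nonneg (a ^ 2 + Λ / 2)]
      have ha : a ^ 2 + Λ / 2 = 0 := by nlinarith [sq_nonneg b, sq_nonneg (a ^ 2 + Λ / 2)]
      exact ⟨_, _, IsSol.const (c := a) (by linarith), rfl, hb.symm⟩
    · obtain ⟨k, hk, β, hβ, hΛk, hEk⟩ := exists_dn_param hΛ hE h
      have hΛ' : Λ = -(β ^ 2 * (2 - k ^ 2)) := by linarith
      have hk1 : k ^ 2 < 1 := by nlinarith [hk.1, hk.2]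
      rw [hΛ'] at hEk ⊢
      obtain ⟨τ, σ, hσ, h₁, h₂⟩ := exists_dn_data hk hβ hEk
      have hσ2 : σ ^ 2 = 1 := by rcases hσ with rfl | rfl <;> norm_num
      exact ⟨_, _, isSol_dn hk1 β τ hσ2, h₁, h₂⟩
  -- At energy 0 the data lie at the origin or on the separatrix.
  · by_cases ha : a = 0
    · subst ha
      have hb : b = 0 := by rw [energy] at hE; nlinarith
      exact ⟨_, _, IsSol.zero Λ, rfl, hb.symm⟩
    · have ha2 : 0 < a ^ 2 := by positivity
      have hle : a ^ 2 ≤ -Λ := by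
        rw [energy] at hE
        by_contra hcon
        push Not at hcon
        nlinarith [mul_pos ha2 (show 0 < a ^ 2 + Λ by linarith), sq_nonneg b]
      set ω := √(-Λ) with hω
      have hω2 : ω ^ 2 = -Λ := sq_sqrt (by linarith)
      have hωpos : 0 < ω := sqrt_pos.2 (by linarith)
      obtain ⟨σ, hσ, hσa⟩ : ∃ σ : ℝ, σ ^ 2 = 1 ∧ σ * |a| = a := by
        rcases abs_cases a with ⟨h, _⟩ | ⟨h, _⟩
        · exact ⟨1, by norm_num, by rw [h]; ring⟩
        · exact ⟨-1, by norm_num, by rw [h]; ring⟩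
      have habs : 0 < |a| := abs_pos.2 ha
      -- On the separatrix u = σω/cosh and u' = -σω² sinh/cosh², so -u'/(σu²) is the hyperbolic sine
      -- of the phase.
      set s := -b / (σ * a ^ 2) with hs
      have hσ0 : σ ≠ 0 := by rintro rfl; norm_num at hσ
      have hb2 : b ^ 2 = a ^ 2 * (ω ^ 2 - a ^ 2) := by
        rw [energy] at hE; rw [hω2]; linear_combination hE
      have hsech : (cosh (arsinh s))⁻¹ = |a| / ω := by
        rw [cosh_arsinh, inv_eq_iff_eq_inv, inv_div, sqrt_eq_iff_eq_sq (by positivity)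
          (by positivity), hs, div_pow, div_pow, mul_pow, sq_abs, hσ, neg_sq, hb2]
        field_simp
        ring
      refine ⟨fun x => σ * ω * (cosh (ω * x - -arsinh s))⁻¹,
        fun x => -(σ * ω ^ 2 * sinh (ω * x - -arsinh s)) *
          ((cosh (ω * x - -arsinh s))⁻¹) ^ 2, ?_, ?_, ?_⟩
      · have := isSol_sech ω (-arsinh s) σ hσ
        rwa [show -ω ^ 2 = Λ by linarith] at this
      · simp only [mul_zero, sub_neg_eq_add, zero_add]
        rw [hsech, mul_assoc, mul_div_cancel₀ _ hωpos.ne', hσa]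
      · simp only [mul_zero, sub_neg_eq_add, zero_add]
        rw [hsech, sinh_arsinh, div_pow, sq_abs, hs]
        field_simp
  · obtain ⟨κ, hκ, β, hβ, hΛk, hEk⟩ := exists_cn_param (Λ := Λ) hE
    have hk1 : κ ^ 2 < 1 := by nlinarith [hκ.1, hκ.2]
    rw [← hΛk] at hEk ⊢
    obtain ⟨τ, h₁, h₂⟩ := exists_cn_data hκ hβ hEk
    exact ⟨_, _, isSol_cn hk1 β τ, h₁, h₂⟩


/-! ### The flow and its analyticity -/

/-- Position at time `t` of the solution with position `a` and velocity `b` at time `0`. -/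
noncomputable def flowU (Λ a b : ℝ) : ℝ → ℝ := (exists_isSol Λ a b).choose

/-- Velocity at time `t` of the solution with position `a` and velocity `b` at time `0`. -/
noncomputable def flowV (Λ a b : ℝ) : ℝ → ℝ := (exists_isSol Λ a b).choose_spec.choose

lemma isSol_flow (Λ a b : ℝ) : IsSol Λ (flowU Λ a b) (flowV Λ a b) :=
  (exists_isSol Λ a b).choose_spec.choose_spec.1

@[simp] lemma flowU_zero (Λ a b : ℝ) : flowU Λ a b 0 = a :=
  (exists_isSol Λ a b).choose_spec.choose_spec.2.1

@[simp] lemma flowV_zero (Λ a b : ℝ) : flowV Λ a b 0 = b :=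
  (exists_isSol Λ a b).choose_spec.choose_spec.2.2

lemma IsSol.eq_flow {Λ : ℝ} {u v : ℝ → ℝ} (h : IsSol Λ u v) (x t : ℝ) :
    flowU Λ (u x) (v x) t = u (x + t) ∧ flowV Λ (u x) (v x) t = v (x + t) := by
  obtain ⟨h₁, h₂⟩ := (isSol_flow Λ (u x) (v x)).unique (h.comp_add x) (x₀ := 0) (by simp) (by simp)
  rw [h₁, h₂, add_comm]; exact ⟨rfl, rfl⟩

lemma flow_add (Λ a b s t : ℝ) :
    flowU Λ (flowU Λ a b s) (flowV Λ a b s) t = flowU Λ a b (s + t) ∧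
      flowV Λ (flowU Λ a b s) (flowV Λ a b s) t = flowV Λ a b (s + t) :=
  (isSol_flow Λ a b).eq_flow s t

lemma energy_flow (Λ a b t : ℝ) : energy Λ (flowU Λ a b t) (flowV Λ a b t) = energy Λ a b := by
  have := (isSol_flow Λ a b).energy_eq t 0
  simpa using this

/-- Bound for positions in terms of the energy. -/
lemma sq_le_of_energy (Λ a b : ℝ) : a ^ 2 ≤ 1 + |Λ| + energy Λ a b ^ 2 := by
  rw [energy]
  by_contra hcon
  push Not at hcon
  set e := b ^ 2 + a ^ 4 + Λ * a ^ 2 with he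
  have h1 : 0 ≤ e ^ 2 := sq_nonneg e
  have h2 := neg_abs_le Λ
  have h0 : 1 < a ^ 2 := by linarith [abs_nonneg Λ]
  have h3 : 1 + e ^ 2 < a ^ 2 + Λ := by linarith
  -- Beyond the claimed bound the energy would be at least a²(a² + Λ), hence above 1 + e², which no
  -- real e satisfies.
  have h4 : 1 + e ^ 2 < e := by
    have : a ^ 2 * (a ^ 2 + Λ) ≤ e := by rw [he]; nlinarith [sq_nonneg b]
    nlinarith
  nlinarith [sq_nonneg (e - 1)]

lemma flowU_sq_le (Λ a b t : ℝ) : flowU Λ a b t ^ 2 ≤ 1 + |Λ| + energy Λ a b ^ 2 := by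
  have := sq_le_of_energy Λ (flowU Λ a b t) (flowV Λ a b t)
  rwa [energy_flow] at this

lemma flowV_sq_le (Λ a b t : ℝ) :
    flowV Λ a b t ^ 2 ≤ |energy Λ a b| + |Λ| * (1 + |Λ| + energy Λ a b ^ 2) := by
  have h₁ := energy_flow Λ a b t
  have h₂ := flowU_sq_le Λ a b t
  have h₃ : -(|Λ| * flowU Λ a b t ^ 2) ≤ Λ * flowU Λ a b t ^ 2 := by
    nlinarith [neg_abs_le Λ, sq_nonneg (flowU Λ a b t)]
  have h₄ := mul_le_mul_of_nonneg_left h₂ (abs_nonneg Λ)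
  have h₅ := le_abs_self (energy Λ a b)
  have h₆ : 0 ≤ flowU Λ a b t ^ 4 := by positivity
  rw [energy] at h₁
  linarith

/-! ### Analytic dependence on frequency and data, by the implicit function theorem in C([0, 1]) -/

section Analytic

open scoped ContDiff unitInterval

/-- Primitive of a continuous function on the unit interval. -/
noncomputable def primC (f : C(I, ℝ)) : C(I, ℝ) where
  toFun x := ∫ s in (0 : ℝ)..x, IccExtend zero_le_one f s
  continuous_toFun := by
    have : Continuous (IccExtend zero_le_one f) := f.continuous.Icc_extend'
    exact (intervalIntegral.continuous_primitive (fun a b => this.intervalIntegrable a b) 0).comp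
      continuous_subtype_val

/-- The primitive, as a continuous linear map. -/
noncomputable def primL : C(I, ℝ) →L[ℝ] C(I, ℝ) :=
  LinearMap.mkContinuous
    { toFun := primC
      map_add' := by
        intro f g
        ext x
        have hf : Continuous (IccExtend zero_le_one f) := f.continuous.Icc_extend'
        have hg : Continuous (IccExtend zero_le_one g) := g.continuous.Icc_extend'
        have := intervalIntegral.integral_add (hf.intervalIntegrable 0 x)
          (hg.intervalIntegrable 0 x) (μ := MeasureTheory.volume)
        exact this
      map_smul' := by
        intro c f
        ext x
        exact intervalIntegral.integral_smul c (IccExtend zero_le_one f) }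
    1 (by
      intro f
      rw [one_mul, ContinuousMap.norm_le _ (norm_nonneg f)]
      intro x
      have h := intervalIntegral.norm_integral_le_of_norm_le_const (a := 0) (b := (x : ℝ))
        (f := IccExtend zero_le_one f) (C := ‖f‖) (fun s _ => f.norm_coe_le_norm _)
      refine h.trans ?_
      rw [sub_zero, abs_of_nonneg x.2.1]
      exact mul_le_of_le_one_right (norm_nonneg f) x.2.2)

lemma primL_apply (f : C(I, ℝ)) (x : I) :
    primL f x = ∫ s in (0 : ℝ)..x, IccExtend zero_le_one f s := rfl

lemma norm_primL_le : ‖primL‖ ≤ 1 := LinearMap.mkContinuous_norm_le _ zero_le_one _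

lemma hasDerivAt_extend_primL (f : C(I, ℝ)) {x : ℝ} (hx : x ∈ Ico (0 : ℝ) 1) :
    HasDerivWithinAt (IccExtend zero_le_one (primL f)) (IccExtend zero_le_one f x) (Ici x) x := by
  have hf : Continuous (IccExtend zero_le_one f) := f.continuous.Icc_extend'
  have h := (hf.integral_hasStrictDerivAt 0 x).hasDerivAt.hasDerivWithinAt (s := Ici x)
  refine h.congr_of_eventuallyEq ?_ ?_
  · filter_upwards [Icc_mem_nhdsGE_of_mem (⟨le_rfl, hx.2⟩ : x ∈ Ico x 1)] with y hy
    have hy' : y ∈ Icc (0 : ℝ) 1 := ⟨hx.1.trans hy.1, hy.2⟩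
    rw [IccExtend_of_mem _ _ hy', primL_apply]
  · rw [IccExtend_of_mem _ _ (Ico_subset_Icc_self hx), primL_apply]

/-- The integral equation of the time-`h` problem, rescaled to the unit interval, for the
parameters `(Λ, a, b)` and the unknown velocity and position. -/
noncomputable def intEq (h : ℝ) (z : (ℝ × ℝ × ℝ) × C(I, ℝ)) : C(I, ℝ) :=
  z.2 - algebraMap ℝ C(I, ℝ) z.1.2.1 - (h * z.1.2.2) • primL 1 +
    (h ^ 2) • primL (primL ((2 : ℝ) • z.2 ^ 3 + z.1.1 • z.2))

lemma contDiff_intEq (h : ℝ) : ContDiff ℝ ω (intEq h) := by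
  unfold intEq
  have h1 : ContDiff ℝ ω (fun z : (ℝ × ℝ × ℝ) × C(I, ℝ) => algebraMap ℝ C(I, ℝ) z.1.2.1) :=
    (algebraMapCLM ℝ C(I, ℝ)).contDiff.comp (contDiff_fst.comp (contDiff_snd.comp contDiff_fst))
  have h2 : ContDiff ℝ ω (fun z : (ℝ × ℝ × ℝ) × C(I, ℝ) => z.2 ^ 3) := contDiff_snd.pow 3
  have h3 : ContDiff ℝ ω (fun z : (ℝ × ℝ × ℝ) × C(I, ℝ) =>
      primL (primL ((2 : ℝ) • z.2 ^ 3 + z.1.1 • z.2))) := by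
    refine primL.contDiff.comp (primL.contDiff.comp ?_)
    exact (h2.const_smul 2).add ((contDiff_fst.comp contDiff_fst).smul contDiff_snd)
  have h4 : ContDiff ℝ ω (fun z : (ℝ × ℝ × ℝ) × C(I, ℝ) => h * z.1.2.2) := by fun_prop
  exact ((contDiff_snd.sub h1).sub (h4.smul contDiff_const)).add (h3.const_smul _)

/-- The partial derivative in the curve is the identity plus a term of order h², so it is invertible
for short times. -/
lemma fderiv_intEq_inr (h : ℝ) (p : ℝ × ℝ × ℝ) (w : C(I, ℝ)) :
    fderiv ℝ (intEq h) (p, w) ∘L .inr ℝ (ℝ × ℝ × ℝ) C(I, ℝ) =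
      1 + (h ^ 2) • (primL ∘L primL ∘L
        ContinuousLinearMap.mul ℝ C(I, ℝ) ((6 : ℝ) • w ^ 2 + algebraMap ℝ C(I, ℝ) p.1)) := by
  have h₁ : HasFDerivAt (fun w : C(I, ℝ) => intEq h (p, w))
      (fderiv ℝ (intEq h) (p, w) ∘L .inr ℝ (ℝ × ℝ × ℝ) C(I, ℝ)) w :=
    ((contDiff_intEq h).differentiable (by simp) (p, w)).hasFDerivAt.comp w
      (hasFDerivAt_prodMk_right p w)
  refine h₁.unique ?_
  have h₂ : HasFDerivAt (fun w : C(I, ℝ) => w ^ 3) _ w := (hasFDerivAt_id (𝕜 := ℝ) w).pow 3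
  have h₃ := primL.hasFDerivAt.comp w (primL.hasFDerivAt.comp w
    ((h₂.const_smul (2 : ℝ)).add ((hasFDerivAt_id w).const_smul p.1)))
  have h₄ := (((hasFDerivAt_id w).sub_const (algebraMap ℝ C(I, ℝ) p.2.1)).sub_const
    ((h * p.2.2) • primL 1)).add (h₃.const_smul (h ^ 2))
  refine h₄.congr_fderiv ?_
  ext1 y
  simp only [add_apply, smul_apply,
    ContinuousLinearMap.comp_apply, ContinuousLinearMap.mul_apply', one_apply_eq_self,
    ContinuousLinearMap.id_apply, id]
  congr 4
  ext x
  have h3 : (3 : C(I, ℝ)) x = 3 := rfl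
  simp [h3]
  ring

/-- The solution on `[0, h]`, rescaled to the unit interval. -/
noncomputable def flowC (h Λ a b : ℝ) : C(I, ℝ) where
  toFun x := flowU Λ a b (h * x)
  continuous_toFun := by
    have := (isSol_flow Λ a b).continuous_left
    fun_prop

/-- The equation is integrated twice in rescaled time; each integration contributes one factor h. -/
lemma intEq_flowC (h Λ a b : ℝ) : intEq h ((Λ, a, b), flowC h Λ a b) = 0 := by
  have hs := isSol_flow Λ a b
  have hu := hs.continuous_left
  have hv := hs.continuous_right
  set g : C(I, ℝ) := (2 : ℝ) • flowC h Λ a b ^ 3 + Λ • flowC h Λ a b with hg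
  have hgx : ∀ s ∈ Icc (0 : ℝ) 1, IccExtend zero_le_one g s =
      2 * flowU Λ a b (h * s) ^ 3 + Λ * flowU Λ a b (h * s) := by
    intro s hs
    rw [IccExtend_of_mem _ _ hs]
    rfl
  have hsub : ∀ x ∈ Icc (0 : ℝ) 1, uIcc 0 x ⊆ Icc (0 : ℝ) 1 := by
    intro x hx
    rw [uIcc_of_le hx.1]
    exact Icc_subset_Icc_right hx.2
  have h₁ : ∀ s ∈ Icc (0 : ℝ) 1,
      h * IccExtend zero_le_one (primL g) s = b - flowV Λ a b (h * s) := by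
    intro s hs'
    rw [IccExtend_of_mem _ _ hs', primL_apply, ← intervalIntegral.integral_const_mul]
    have : ∫ r in (0 : ℝ)..s, h * IccExtend zero_le_one g r =
        ∫ r in (0 : ℝ)..s, h * (2 * flowU Λ a b (h * r) ^ 3 + Λ * flowU Λ a b (h * r)) :=
      intervalIntegral.integral_congr fun r hr => by
        simp only [hgx r (hsub s hs' hr)]
    rw [this, intervalIntegral.integral_eq_sub_of_hasDerivAt
      (f := fun r => -flowV Λ a b (h * r)) (fun r _ => ?_)
      (Continuous.intervalIntegrable (by fun_prop) _ _)]
    · simp; ring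
    · have := ((hs (h * r)).2.comp r ((hasDerivAt_id r).const_mul h)).neg
      exact this.congr_deriv (by simp; ring)
  ext x
  have h₂ : h ^ 2 * primL (primL g) x = h * b * x - (flowU Λ a b (h * x) - a) := by
    rw [primL_apply, pow_two, mul_assoc, ← intervalIntegral.integral_const_mul]
    have : ∫ r in (0 : ℝ)..x, h * IccExtend zero_le_one (primL g) r =
        ∫ r in (0 : ℝ)..x, (b - flowV Λ a b (h * r)) :=
      intervalIntegral.integral_congr fun r hr => h₁ r (hsub x x.2 hr)
    rw [this, ← intervalIntegral.integral_const_mul, intervalIntegral.integral_eq_sub_of_hasDerivAt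
      (f := fun r => h * b * r - flowU Λ a b (h * r)) (fun r _ => ?_)
      (Continuous.intervalIntegrable (by fun_prop) _ _)]
    · simp; ring
    · have := ((hasDerivAt_id r).const_mul (h * b)).sub
        ((hs (h * r)).1.comp r ((hasDerivAt_id r).const_mul h))
      exact this.congr_deriv (by simp; ring)
  have h₃ : primL 1 x = x := by
    rw [primL_apply]
    have : ∫ r in (0 : ℝ)..x, IccExtend zero_le_one (1 : C(I, ℝ)) r = ∫ r in (0 : ℝ)..x, (1 : ℝ) :=
      intervalIntegral.integral_congr fun r _ => rfl
    rw [this]; simp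
  change flowU Λ a b (h * x) - a - (h * b) * primL 1 x + h ^ 2 * primL (primL g) x = 0
  rw [h₂, h₃]; ring

/-- A solution of the integral equation is the rescaled flow. -/
lemma eq_flow_of_intEq {h Λ a b : ℝ} {w : C(I, ℝ)} (hw : intEq h ((Λ, a, b), w) = 0) :
    flowU Λ a b h = w 1 ∧
      flowV Λ a b h = b - h * primL ((2 : ℝ) • w ^ 3 + Λ • w) 1 := by
  have hs := isSol_flow Λ a b
  have hu := hs.continuous_left
  have hv := hs.continuous_right
  set g : C(I, ℝ) := (2 : ℝ) • w ^ 3 + Λ • w with hg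
  set y : C(I, ℝ) := algebraMap ℝ C(I, ℝ) b - h • primL g with hy
  have hwx : ∀ x : I, w x = a + h * b * primL 1 x - h ^ 2 * primL (primL g) x := by
    intro x
    have : w x - a - (h * b) * primL 1 x + h ^ 2 * primL (primL g) x = 0 :=
      DFunLike.congr_fun hw x
    linarith
  have hyx : ∀ x : I, y x = b - h * primL g x := fun x => rfl
  have hdy : ∀ x ∈ Ico (0 : ℝ) 1, HasDerivWithinAt (IccExtend zero_le_one y)
      (-h * IccExtend zero_le_one g x) (Ici x) x := by
    intro x hx
    have h₁ := ((hasDerivAt_extend_primL g hx).const_mul h).const_sub b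
    exact h₁.congr_deriv (by ring)
  have hdw : ∀ x ∈ Ico (0 : ℝ) 1, HasDerivWithinAt (IccExtend zero_le_one w)
      (h * IccExtend zero_le_one y x) (Ici x) x := by
    intro x hx
    have h₁ := (((hasDerivAt_extend_primL 1 hx).const_mul (h * b)).const_add a).sub
      ((hasDerivAt_extend_primL (primL g) hx).const_mul (h ^ 2))
    refine (h₁.congr_deriv ?_).congr_of_eventuallyEq (Eventually.of_forall fun t => hwx _) (hwx _)
    change h * b * 1 - h ^ 2 * primL g _ = h * (b - h * primL g _)
    ring
  have key := field_unique_right (c := h) (Λ := Λ) (a := 0) (b := 1)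
    (f := fun s => (flowU Λ a b (h * s), flowV Λ a b (h * s)))
    (g := fun s => (IccExtend zero_le_one w s, IccExtend zero_le_one y s))
    (by fun_prop) (w.continuous.Icc_extend'.prodMk y.continuous.Icc_extend').continuousOn
    (fun t _ => by
      have h₁ := (hs (h * t)).1.comp t ((hasDerivAt_id t).const_mul h)
      have h₂ := (hs (h * t)).2.comp t ((hasDerivAt_id t).const_mul h)
      refine ((h₁.prodMk h₂).congr_deriv ?_).hasDerivWithinAt
      ext <;> simp [field] <;> ring)
    (fun t ht => by
      refine ((hdw t ht).prodMk (hdy t ht)).congr_deriv ?_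
      have : IccExtend zero_le_one g t =
        2 * IccExtend zero_le_one w t ^ 3 + Λ * IccExtend zero_le_one w t := rfl
      ext
      · simp [field]
      · simp [field, this]; ring)
    (by
      have h0 : ∀ f : C(I, ℝ), IccExtend zero_le_one f 0 = f 0 := fun f => IccExtend_left _ _
      have hp : ∀ f, primL f 0 = 0 := fun f => by simp [primL_apply]
      simp only [mul_zero, flowU_zero, flowV_zero, h0, hwx, hyx, hp]
      simp)
  have h1 := key (⟨zero_le_one, le_rfl⟩ : (1 : ℝ) ∈ Icc (0 : ℝ) 1)
  simp only [mul_one, Prod.mk.injEq, IccExtend_right] at h1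
  exact h1

/-- The flow at time `t` on the space of frequencies, positions and velocities. -/
noncomputable def flowMap (t : ℝ) (z : ℝ × ℝ × ℝ) : ℝ × ℝ × ℝ :=
  (z.1, flowU z.1 z.2.1 z.2.2 t, flowV z.1 z.2.1 z.2.2 t)

/-- The smallness of h makes the partial derivative invertible by a Neumann series. The analytic
implicit function then solves the integral equation near the base point, where it must coincide with
the flow. -/
lemma contDiffAt_flowMap_of_small {h Λ a b : ℝ}
    (hh : h ^ 2 * (6 * (1 + |Λ| + energy Λ a b ^ 2) + |Λ|) < 1) :
    ContDiffAt ℝ ω (flowMap h) (Λ, a, b) := by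
  set w := flowC h Λ a b
  have hcd : ContDiffAt ℝ ω (intEq h) ((Λ, a, b), w) := (contDiff_intEq h).contDiffAt
  have hinv : (fderiv ℝ (intEq h) ((Λ, a, b), w) ∘L
      .inr ℝ (ℝ × ℝ × ℝ) C(I, ℝ)).IsInvertible := by
    rw [fderiv_intEq_inr]
    set m : C(I, ℝ) := (6 : ℝ) • w ^ 2 + algebraMap ℝ C(I, ℝ) Λ
    set A := (h ^ 2) • (primL ∘L primL ∘L ContinuousLinearMap.mul ℝ C(I, ℝ) m)
    have hm : ‖m‖ ≤ 6 * (1 + |Λ| + energy Λ a b ^ 2) + |Λ| := by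
      rw [ContinuousMap.norm_le _ (by positivity)]
      intro x
      have h₁ := flowU_sq_le Λ a b (h * x)
      have h₂ : m x = 6 * flowU Λ a b (h * x) ^ 2 + Λ := rfl
      rw [h₂]
      refine (norm_add_le _ _).trans ?_
      rw [Real.norm_eq_abs, Real.norm_eq_abs, abs_of_nonneg (by positivity)]
      linarith
    have hA : ‖A‖ < 1 := by
      refine lt_of_le_of_lt ?_ hh
      rw [norm_smul, Real.norm_eq_abs, abs_of_nonneg (sq_nonneg h)]
      refine mul_le_mul_of_nonneg_left ?_ (sq_nonneg h)
      calc _ ≤ ‖primL‖ * (‖primL‖ * ‖ContinuousLinearMap.mul ℝ C(I, ℝ) m‖) :=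
            (ContinuousLinearMap.opNorm_comp_le _ _).trans
              (mul_le_mul_of_nonneg_left (ContinuousLinearMap.opNorm_comp_le _ _) (norm_nonneg _))
        _ ≤ 1 * (1 * ‖m‖) := by
            gcongr
            · exact norm_primL_le
            · exact norm_primL_le
            · exact ContinuousLinearMap.opNorm_mul_apply_le ℝ C(I, ℝ) m
        _ ≤ _ := by rw [one_mul, one_mul]; exact hm
    have hu : IsUnit (1 + A) := by
      have := isUnit_one_sub_of_norm_lt_one (x := -A) (by rwa [norm_neg])
      rwa [sub_neg_eq_add] at this
    exact ⟨ContinuousLinearEquiv.unitsEquiv ℝ C(I, ℝ) hu.unit, rfl⟩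
  set ψ := hcd.implicitFunction (by simp) hinv
  have hψ : ContDiffAt ℝ ω ψ (Λ, a, b) := hcd.contDiffAt_implicitFunction (by simp) hinv
  -- The implicit function keeps `intEq` at its value at the base point, which is 0 there.
  have hev : ∀ᶠ z in 𝓝 (Λ, a, b), intEq h (z, ψ z) = 0 := by
    have := hcd.eventually_apply_implicitFunction (by simp) hinv
    rwa [intEq_flowC] at this
  have hE : ContDiff ℝ ω (fun f : C(I, ℝ) => f 1) := (ContinuousMap.evalCLM (M := ℝ) ℝ (1 : I)).contDiff
  have hG : ContDiffAt ℝ ω (fun z : ℝ × ℝ × ℝ => primL ((2 : ℝ) • ψ z ^ 3 + z.1 • ψ z) 1)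
      (Λ, a, b) := by
    refine hE.contDiffAt.comp _ (primL.contDiff.contDiffAt.comp _ ?_)
    exact ((hψ.pow 3).const_smul 2).add (contDiffAt_fst.smul hψ)
  have hmain : ContDiffAt ℝ ω (fun z : ℝ × ℝ × ℝ =>
      (z.1, ψ z 1, z.2.2 - h * primL ((2 : ℝ) • ψ z ^ 3 + z.1 • ψ z) 1)) (Λ, a, b) := by
    refine contDiffAt_fst.prodMk ((hE.contDiffAt.comp _ hψ).prodMk (ContDiffAt.sub ?_ ?_))
    · fun_prop
    · exact contDiffAt_const.mul hG
  refine hmain.congr_of_eventuallyEq ?_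
  filter_upwards [hev] with z hz
  obtain ⟨h₁, h₂⟩ := eq_flow_of_intEq (Λ := z.1) (a := z.2.1) (b := z.2.2) hz
  simp only [flowMap, h₁, h₂]

lemma flowMap_add (s t : ℝ) (z : ℝ × ℝ × ℝ) : flowMap (s + t) z = flowMap t (flowMap s z) := by
  obtain ⟨h₁, h₂⟩ := flow_add z.1 z.2.1 z.2.2 s t
  simp only [flowMap, h₁, h₂]

/-- The flow at a fixed time depends analytically on the frequency and the initial data. -/
theorem contDiff_flowMap (t : ℝ) : ContDiff ℝ ω (flowMap t) := by
  rw [contDiff_iff_contDiffAt]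
  rintro ⟨Λ, a, b⟩
  -- The admissible length of a step depends on the base point only through Λ and the energy. Both
  -- are constant along the orbit, so N equal steps of length t / N reach time t.
  set C := 6 * (1 + |Λ| + energy Λ a b ^ 2) + |Λ| with hC
  have hCpos : 0 < C := by positivity
  obtain ⟨N, hN⟩ := exists_nat_gt (1 + t ^ 2 * C)
  have hN0 : (1 : ℝ) < N := by nlinarith [mul_nonneg (sq_nonneg t) hCpos.le]
  have hsmall : (t / N) ^ 2 * C < 1 := by
    rw [div_pow, div_mul_eq_mul_div, div_lt_one (by positivity)]
    nlinarith
  have key : ∀ j : ℕ, ContDiffAt ℝ ω (flowMap (j * (t / N))) (Λ, a, b) := by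
    intro j
    induction j with
    | zero =>
      have : flowMap ((0 : ℕ) * (t / N)) = id := by
        funext z; simp [flowMap]
      rw [this]; exact contDiffAt_id
    | succ j ih =>
      have : flowMap ((j + 1 : ℕ) * (t / N)) = flowMap (t / N) ∘ flowMap (j * (t / N)) := by
        funext z
        rw [Function.comp_apply, ← flowMap_add]; push_cast; ring_nf
      rw [this]
      refine ContDiffAt.comp _ ?_ ih
      refine contDiffAt_flowMap_of_small ?_
      rw [energy_flow]
      exact hsmall
  have := key N
  rwa [mul_div_cancel₀ _ (by positivity)] at this

end Analytic


/-! ### The complete integral as a function of the modulus -/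

lemma continuousOn_ellipticF :
    ContinuousOn (fun p : ℝ × ℝ => ellipticF p.1 p.2) {p | p.1 ^ 2 < 1} := by
  let f : {k : ℝ // k ^ 2 < 1} → ℝ → ℝ := fun k θ => 1 / √(1 - (k : ℝ) ^ 2 * sin θ ^ 2)
  have hf : Continuous f.uncurry := by
    have : Continuous fun p : {k : ℝ // k ^ 2 < 1} × ℝ =>
      √(1 - (p.1 : ℝ) ^ 2 * sin p.2 ^ 2) := by fun_prop
    exact continuous_const.div this
      fun p => (sqrt_pos.2 (one_sub_sq_mul_sin_sq_pos p.1.2 p.2)).ne'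
  have h := intervalIntegral.continuous_parametric_primitive_of_continuous
    (μ := MeasureTheory.volume) (a₀ := 0) hf
  rw [continuousOn_iff_continuous_domRestrict]
  exact h.comp (f := fun p : {p : ℝ × ℝ | p.1 ^ 2 < 1} =>
    ((⟨p.1.1, p.2⟩ : {k : ℝ // k ^ 2 < 1}), p.1.2)) (by fun_prop)

lemma continuousOn_ellipticK : ContinuousOn ellipticK {k | k ^ 2 < 1} :=
  continuousOn_ellipticF.comp (f := fun k : ℝ => (k, π / 2)) (by fun_prop) fun _ hk => hk

lemma ellipticK_zero : ellipticK 0 = π / 2 := by simp [ellipticK, ellipticF]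

lemma sq_lt_one_of_mem_Ico {k : ℝ} (hk : k ∈ Ico (0 : ℝ) 1) : k ^ 2 < 1 := by
  nlinarith [hk.1, hk.2]

lemma ellipticK_eq_cos (k : ℝ) :
    ellipticK k = ∫ θ in (0 : ℝ)..π / 2, 1 / √(1 - k ^ 2 * cos θ ^ 2) := by
  have := intervalIntegral.integral_comp_sub_left (a := 0) (b := π / 2)
    (fun θ : ℝ => 1 / √(1 - k ^ 2 * sin θ ^ 2)) (π / 2)
  simp only [sin_pi_div_two_sub, sub_zero, sub_self] at this
  rw [ellipticK, ellipticF, this]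

lemma ellipticK_mono {k₁ k₂ : ℝ} (h₁ : 0 ≤ k₁) (h : k₁ ≤ k₂) (h₂ : k₂ < 1) :
    ellipticK k₁ ≤ ellipticK k₂ := by
  have hk₂ : k₂ ^ 2 < 1 := sq_lt_one_of_mem_Ico ⟨h₁.trans h, h₂⟩
  have hle : k₁ ^ 2 ≤ k₂ ^ 2 := pow_le_pow_left₀ h₁ h 2
  refine intervalIntegral.integral_mono_on (by positivity)
    (intervalIntegrable_elliptic (hle.trans_lt hk₂) _ _) (intervalIntegrable_elliptic hk₂ _ _) ?_
  intro θ _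
  have := one_sub_sq_mul_sin_sq_pos hk₂ θ
  gcongr

/-- With complementary modulus δ and the angle measured from π/2, the integrand is at least 1/(δ +
θ), because sin θ ≤ θ. The integral of this bound grows like log(1/δ). -/
lemma exists_lt_ellipticK (M : ℝ) : ∃ k ∈ Ioo (0 : ℝ) 1, M < ellipticK k := by
  set δ := exp (-(|M| + 1)) with hδ
  have hδ0 : 0 < δ := exp_pos _
  have hδ1 : δ < 1 := by rw [hδ, exp_lt_one_iff]; linarith [abs_nonneg M]
  have hsq : √(1 - δ ^ 2) ^ 2 = 1 - δ ^ 2 := sq_sqrt (by nlinarith)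
  have hk : √(1 - δ ^ 2) ∈ Ioo (0 : ℝ) 1 := by
    refine ⟨sqrt_pos.2 (by nlinarith), ?_⟩
    rw [sqrt_lt' one_pos]; nlinarith
  have hk1 := sq_lt_one_of_mem_Ico (Ioo_subset_Ico_self hk)
  refine ⟨_, hk, ?_⟩
  have hle : ∫ θ in (0 : ℝ)..π / 2, 1 / (δ + θ) ≤ ellipticK √(1 - δ ^ 2) := by
    rw [ellipticK_eq_cos]
    have hc : Continuous fun θ : ℝ => 1 / √(1 - √(1 - δ ^ 2) ^ 2 * cos θ ^ 2) := by
      have := (continuous_elliptic_integrand hk1).comp (continuous_const.sub continuous_id :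
        Continuous fun θ : ℝ => π / 2 - θ)
      simpa [Function.comp_def, sin_pi_div_two_sub] using this
    refine intervalIntegral.integral_mono_on (by positivity) ?_ (hc.intervalIntegrable _ _) ?_
    · refine ContinuousOn.intervalIntegrable ?_
      rw [uIcc_of_le (by positivity)]
      refine continuousOn_const.div (by fun_prop) fun θ hθ => ?_
      have := hθ.1; positivity
    · intro θ hθ
      have h1 := hθ.1
      have h2 : sin θ ≤ θ := sin_le h1
      have h3 : 0 ≤ sin θ := sin_nonneg_of_nonneg_of_le_pi h1 (by linarith [hθ.2, pi_pos])
      have h4 := sin_sq_add_cos_sq θ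
      rw [hsq]
      have h5 : 0 < 1 - (1 - δ ^ 2) * cos θ ^ 2 := by nlinarith [sq_nonneg (cos θ), sq_nonneg (sin θ)]
      apply one_div_le_one_div_of_le (sqrt_pos.2 h5)
      rw [sqrt_le_left (by positivity)]
      nlinarith [sq_nonneg (sin θ), mul_nonneg hδ0.le h1, mul_self_le_mul_self h3 h2]
  have hint : ∫ θ in (0 : ℝ)..π / 2, 1 / (δ + θ) = log ((δ + π / 2) / δ) := by
    rw [intervalIntegral.integral_comp_add_left (fun x => 1 / x) δ, add_zero,
      integral_one_div_of_pos hδ0 (by positivity)]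
  have hlog : |M| + 1 ≤ log ((δ + π / 2) / δ) := by
    have : |M| + 1 = log (1 / δ) := by rw [one_div, log_inv, hδ, log_exp, neg_neg]
    rw [this]
    apply log_le_log (by positivity)
    gcongr
    linarith [pi_gt_three]
  linarith [le_abs_self M]

/-! ### Monotonicity of frequency times squared period in the modulus -/

/-- Time in which the cnoidal solution of amplitude `√y` reaches the phase `φ`. -/
noncomputable def cnTime (Λ y φ : ℝ) : ℝ :=
  ∫ θ in (0 : ℝ)..φ, 1 / √(Λ + y * (1 + cos θ ^ 2))

lemma cnTime_pos_aux {Λ y : ℝ} (hy : 0 < y) (h : 0 < Λ + y) (θ : ℝ) :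
    0 < Λ + y * (1 + cos θ ^ 2) := by nlinarith [mul_nonneg hy.le (sq_nonneg (cos θ))]

lemma continuous_cnTime_integrand {Λ y : ℝ} (hy : 0 < y) (h : 0 < Λ + y) :
    Continuous fun θ : ℝ => 1 / √(Λ + y * (1 + cos θ ^ 2)) :=
  continuous_const.div (by fun_prop) fun θ => (sqrt_pos.2 (cnTime_pos_aux hy h θ)).ne'

/-- In terms of the frequency and the squared amplitude κ²β², the integrand visibly decreases in
both parameters, which it does not do in terms of κ and β. -/
lemma ellipticF_div_eq_cnTime (κ : ℝ) {β : ℝ} (hβ : 0 < β) (φ : ℝ) :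
    ellipticF κ φ / β = cnTime (β ^ 2 * (1 - 2 * κ ^ 2)) (κ ^ 2 * β ^ 2) φ := by
  rw [ellipticF, cnTime, ← intervalIntegral.integral_div]
  refine intervalIntegral.integral_congr fun θ _ => ?_
  have : β ^ 2 * (1 - 2 * κ ^ 2) + κ ^ 2 * β ^ 2 * (1 + cos θ ^ 2) =
      β ^ 2 * (1 - κ ^ 2 * sin θ ^ 2) := by rw [cos_sq']; ring
  simp only [this]
  rw [sqrt_mul (sq_nonneg β), sqrt_sq hβ.le, div_div, mul_comm]

lemma cnTime_lt {Λ₁ Λ₂ y₁ y₂ φ : ℝ} (hΛ : Λ₁ ≤ Λ₂) (hy : y₁ < y₂) (hy₁ : 0 < y₁)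
    (h₁ : 0 < Λ₁ + y₁) (hφ : 0 < φ) : cnTime Λ₂ y₂ φ < cnTime Λ₁ y₁ φ := by
  have hy₂ := hy₁.trans hy
  have h₂ : 0 < Λ₂ + y₂ := by linarith
  have key : ∀ θ : ℝ, 1 / √(Λ₂ + y₂ * (1 + cos θ ^ 2)) < 1 / √(Λ₁ + y₁ * (1 + cos θ ^ 2)) := by
    intro θ
    have := cnTime_pos_aux hy₁ h₁ θ
    apply one_div_lt_one_div_of_lt (sqrt_pos.2 this)
    apply sqrt_lt_sqrt this.le
    nlinarith [mul_pos (sub_pos.2 hy) (show 0 < 1 + cos θ ^ 2 by positivity)]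
  exact intervalIntegral.integral_lt_integral_of_continuousOn_of_le_of_exists_lt hφ
    (continuous_cnTime_integrand hy₂ h₂).continuousOn
    (continuous_cnTime_integrand hy₁ h₁).continuousOn (fun θ _ => (key θ).le)
    ⟨0, ⟨le_rfl, hφ.le⟩, key 0⟩

/-- `ΛT²/16` as a function of the modulus of a cnoidal solution of period `T`. -/
noncomputable def cnFreq (κ : ℝ) : ℝ := ellipticK κ ^ 2 * (1 - 2 * κ ^ 2)

/-- `-ΛT²/4` as a function of the modulus of a dnoidal solution of period `T`. -/
noncomputable def dnFreq (k : ℝ) : ℝ := ellipticK k ^ 2 * (2 - k ^ 2)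

lemma cnFreq_zero : cnFreq 0 = π ^ 2 / 4 := by rw [cnFreq, ellipticK_zero]; ring

lemma dnFreq_zero : dnFreq 0 = π ^ 2 / 2 := by rw [dnFreq, ellipticK_zero]; ring

lemma continuousOn_ellipticK_Ico : ContinuousOn ellipticK (Ico 0 1) :=
  continuousOn_ellipticK.mono fun _ hk => sq_lt_one_of_mem_Ico hk

/-- With β = K(κ) the quarter period is 1 for every κ, the frequency is `cnFreq κ` and the squared
amplitude κ²K(κ)². The latter increases strictly with κ; if the frequency did not decrease, `cnTime`
would drop below 1. -/
lemma strictAntiOn_cnFreq : StrictAntiOn cnFreq (Ico 0 1) := by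
  intro κ₁ h₁ κ₂ h₂ hlt
  have hk₁ := sq_lt_one_of_mem_Ico h₁
  have hk₂ := sq_lt_one_of_mem_Ico h₂
  have hK₁ := ellipticK_pos hk₁
  have hK₂ := ellipticK_pos hk₂
  have e₁ := ellipticF_div_eq_cnTime κ₁ hK₁ (π / 2)
  have e₂ := ellipticF_div_eq_cnTime κ₂ hK₂ (π / 2)
  rw [← ellipticK, div_self hK₁.ne'] at e₁
  rw [← ellipticK, div_self hK₂.ne'] at e₂
  -- At κ₁ = 0 the amplitude vanishes and `cnTime_lt` does not apply. The integrand is compared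
  -- directly with 2/π, whose integral is 1.
  rcases eq_or_lt_of_le h₁.1 with h0 | h0
  · subst h0
    have hpos : 0 < κ₂ ^ 2 * ellipticK κ₂ ^ 2 := by positivity
    by_contra hcon
    push Not at hcon
    rw [cnFreq_zero, cnFreq] at hcon
    have hπ := pi_pos
    have : cnTime (ellipticK κ₂ ^ 2 * (1 - 2 * κ₂ ^ 2)) (κ₂ ^ 2 * ellipticK κ₂ ^ 2) (π / 2) <
        ∫ θ in (0 : ℝ)..π / 2, 2 / π := by
      have h2 : 0 < ellipticK κ₂ ^ 2 * (1 - 2 * κ₂ ^ 2) + κ₂ ^ 2 * ellipticK κ₂ ^ 2 := by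
        nlinarith [sq_pos_of_pos hπ]
      have key : ∀ θ : ℝ, 1 / √(ellipticK κ₂ ^ 2 * (1 - 2 * κ₂ ^ 2) +
          κ₂ ^ 2 * ellipticK κ₂ ^ 2 * (1 + cos θ ^ 2)) < 2 / π := by
        intro θ
        rw [show 2 / π = 1 / (π / 2) by field_simp]
        apply one_div_lt_one_div_of_lt (by positivity)
        apply lt_sqrt_of_sq_lt
        nlinarith [mul_nonneg hpos.le (sq_nonneg (cos θ))]
      exact intervalIntegral.integral_lt_integral_of_continuousOn_of_le_of_exists_lt
        (by positivity) (continuous_cnTime_integrand hpos h2).continuousOn continuousOn_const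
        (fun θ _ => (key θ).le) ⟨0, ⟨le_rfl, by positivity⟩, key 0⟩
    rw [← e₂] at this
    simp at this
  · by_contra hcon
    push Not at hcon
    have := cnTime_lt (φ := π / 2) hcon (y₁ := κ₁ ^ 2 * ellipticK κ₁ ^ 2)
      (y₂ := κ₂ ^ 2 * ellipticK κ₂ ^ 2) (by
        rw [← mul_pow, ← mul_pow]
        have := ellipticK_mono h₁.1 hlt.le h₂.2
        exact pow_lt_pow_left₀ (mul_lt_mul hlt this hK₁ h₂.1) (by positivity) two_ne_zero)
      (by positivity)
      (by rw [cnFreq]; nlinarith [mul_pos (sq_pos_of_pos hK₁) (sub_pos.2 hk₁)]) (by positivity)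
    rw [cnFreq, cnFreq, ← e₁, ← e₂] at this
    exact lt_irrefl _ this

/-- Here x = k², s = sin²θ, c = cos²θ. The integrand of √(2 - k²) K(k) is not pointwise monotone in
k, but the sum over θ and π/2 - θ is: since (1 - xs) + (1 - xc) = 2 - x, its square is q + 2√q for a
single ratio q. -/
lemma dn_pair_sq {x s c : ℝ} (hsc : s + c = 1) (hs : 0 < 1 - x * s) (hc : 0 < 1 - x * c) :
    (√(2 - x) * (1 / √(1 - x * s) + 1 / √(1 - x * c))) ^ 2 =
      (2 - x) ^ 2 / ((1 - x * s) * (1 - x * c)) +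
        2 * √((2 - x) ^ 2 / ((1 - x * s) * (1 - x * c))) := by
  have hx : 0 < 2 - x := by nlinarith
  rw [sqrt_div (sq_nonneg _), sqrt_sq hx.le, sqrt_mul hs.le, mul_pow, sq_sqrt hx.le, add_sq,
    div_pow, div_pow, sq_sqrt hs.le, sq_sqrt hc.le]
  have h1 := sqrt_pos.2 hs
  have h2 := sqrt_pos.2 hc
  field_simp
  have h3 : 1 - x * c + (1 - x * s) = 2 - x := by linear_combination (-x) * hsc
  linear_combination (√(1 - x * s) * √(1 - x * c)) * h3

/-- Cross-multiplication leaves (1 - 4sc)(x₂ - x₁)(x₁ + x₂ - x₁x₂), and 4sc ≤ 1 because s + c = 1.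
-/
lemma dn_ratio_le {x₁ x₂ s c : ℝ} (hsc : s + c = 1) (h0 : 0 ≤ x₁) (h : x₁ < x₂) (h1 : x₂ < 1)
    (hs : 0 ≤ s) (hc : 0 ≤ c) :
    (2 - x₁) ^ 2 / ((1 - x₁ * s) * (1 - x₁ * c)) ≤
      (2 - x₂) ^ 2 / ((1 - x₂ * s) * (1 - x₂ * c)) ∧
    (s * c = 0 → (2 - x₁) ^ 2 / ((1 - x₁ * s) * (1 - x₁ * c)) <
      (2 - x₂) ^ 2 / ((1 - x₂ * s) * (1 - x₂ * c))) := by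
  have p1 : 0 < (1 - x₁ * s) * (1 - x₁ * c) := mul_pos (by nlinarith) (by nlinarith)
  have p2 : 0 < (1 - x₂ * s) * (1 - x₂ * c) := mul_pos (by nlinarith) (by nlinarith)
  have e : (2 - x₂) ^ 2 * ((1 - x₁ * s) * (1 - x₁ * c)) -
      (2 - x₁) ^ 2 * ((1 - x₂ * s) * (1 - x₂ * c)) =
      (1 - 4 * (s * c)) * ((x₂ - x₁) * (x₁ + x₂ - x₁ * x₂)) := by
    have : c = 1 - s := by linarith
    subst this; ring
  have q : 0 < (x₂ - x₁) * (x₁ + x₂ - x₁ * x₂) := mul_pos (by linarith) (by nlinarith)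
  have r : 0 ≤ 1 - 4 * (s * c) := by nlinarith [sq_nonneg (s - c)]
  constructor
  · rw [div_le_div_iff₀ p1 p2]
    nlinarith [mul_nonneg r q.le]
  · intro h0
    rw [div_lt_div_iff₀ p1 p2]
    rw [h0] at e
    linarith

/-- Integration of the paired integrand. The pointwise inequality degenerates where s = c;
strictness at θ = 0, where sc = 0, is enough by continuity. -/
lemma strictMonoOn_dnFreq : StrictMonoOn dnFreq (Ico 0 1) := by
  intro k₁ h₁ k₂ h₂ hlt
  have hk₁ := sq_lt_one_of_mem_Ico h₁
  have hk₂ := sq_lt_one_of_mem_Ico h₂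
  have hx : k₁ ^ 2 < k₂ ^ 2 := pow_lt_pow_left₀ hlt h₁.1 two_ne_zero
  have pos : ∀ {k : ℝ}, k ^ 2 < 1 → ∀ θ, 0 < 1 - k ^ 2 * cos θ ^ 2 := by
    intro k hk θ
    have := one_sub_sq_mul_sin_sq_pos hk (π / 2 - θ)
    rwa [sin_pi_div_two_sub] at this
  have hcs : ∀ {k : ℝ}, k ^ 2 < 1 → Continuous fun θ : ℝ => 1 / √(1 - k ^ 2 * cos θ ^ 2) :=
    fun hk => continuous_const.div (by fun_prop) fun θ => (sqrt_pos.2 (pos hk θ)).ne'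
  have rep : ∀ {k : ℝ}, k ^ 2 < 1 → √(2 - k ^ 2) * (2 * ellipticK k) =
      ∫ θ in (0 : ℝ)..π / 2, √(2 - k ^ 2) *
        (1 / √(1 - k ^ 2 * sin θ ^ 2) + 1 / √(1 - k ^ 2 * cos θ ^ 2)) := by
    intro k hk
    rw [intervalIntegral.integral_const_mul, intervalIntegral.integral_add
      (intervalIntegrable_elliptic hk _ _) ((hcs hk).intervalIntegrable _ _), ← ellipticK_eq_cos]
    rw [two_mul]; rfl
  have nonneg : ∀ (k θ : ℝ), 0 ≤ √(2 - k ^ 2) *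
        (1 / √(1 - k ^ 2 * sin θ ^ 2) + 1 / √(1 - k ^ 2 * cos θ ^ 2)) := by
    intro k θ; positivity
  have hcont : ∀ {k : ℝ}, k ^ 2 < 1 → Continuous fun θ : ℝ => √(2 - k ^ 2) *
        (1 / √(1 - k ^ 2 * sin θ ^ 2) + 1 / √(1 - k ^ 2 * cos θ ^ 2)) := fun hk =>
    continuous_const.mul ((continuous_elliptic_integrand hk).add (hcs hk))
  have main : √(2 - k₁ ^ 2) * (2 * ellipticK k₁) < √(2 - k₂ ^ 2) * (2 * ellipticK k₂) := by
    rw [rep hk₁, rep hk₂]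
    refine intervalIntegral.integral_lt_integral_of_continuousOn_of_le_of_exists_lt (by positivity)
      (hcont hk₁).continuousOn (hcont hk₂).continuousOn (fun θ _ => ?_)
      ⟨0, ⟨le_rfl, by positivity⟩, ?_⟩
    · have hq := (dn_ratio_le (sin_sq_add_cos_sq θ) (sq_nonneg k₁) hx hk₂ (sq_nonneg _)
        (sq_nonneg _)).1
      refine pow_le_pow_iff_left₀ (nonneg _ _) (nonneg _ _) two_ne_zero |>.1 ?_
      rw [dn_pair_sq (sin_sq_add_cos_sq θ) (one_sub_sq_mul_sin_sq_pos hk₁ θ) (pos hk₁ θ),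
        dn_pair_sq (sin_sq_add_cos_sq θ) (one_sub_sq_mul_sin_sq_pos hk₂ θ) (pos hk₂ θ)]
      linarith [sqrt_le_sqrt hq]
    · have hq := (dn_ratio_le (sin_sq_add_cos_sq 0) (sq_nonneg k₁) hx hk₂ (sq_nonneg _)
        (sq_nonneg _)).2 (by simp)
      refine pow_lt_pow_iff_left₀ (nonneg _ _) (nonneg _ _) two_ne_zero |>.1 ?_
      rw [dn_pair_sq (sin_sq_add_cos_sq 0) (one_sub_sq_mul_sin_sq_pos hk₁ 0) (pos hk₁ 0),
        dn_pair_sq (sin_sq_add_cos_sq 0) (one_sub_sq_mul_sin_sq_pos hk₂ 0) (pos hk₂ 0)]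
      linarith [sqrt_le_sqrt hq.le]
  have hsq : ∀ {k : ℝ}, k ^ 2 < 1 → (√(2 - k ^ 2) * (2 * ellipticK k)) ^ 2 = 4 * dnFreq k := by
    intro k hk
    rw [mul_pow, sq_sqrt (by linarith), dnFreq]; ring
  have := pow_lt_pow_left₀ main (by have := ellipticK_pos hk₁; positivity) two_ne_zero
  rw [hsq hk₁, hsq hk₂] at this
  linarith

lemma continuousOn_cnFreq : ContinuousOn cnFreq (Ico 0 1) :=
  (continuousOn_ellipticK_Ico.pow 2).mul (by fun_prop)

lemma continuousOn_dnFreq : ContinuousOn dnFreq (Ico 0 1) :=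
  (continuousOn_ellipticK_Ico.pow 2).mul (by fun_prop)

lemma exists_lt_dnFreq (M : ℝ) : ∃ k ∈ Ico (0 : ℝ) 1, M < dnFreq k := by
  obtain ⟨k, hk, hM⟩ := exists_lt_ellipticK (|M| + 1)
  have hk1 := sq_lt_one_of_mem_Ico (Ioo_subset_Ico_self hk)
  refine ⟨k, Ioo_subset_Ico_self hk, ?_⟩
  rw [dnFreq]
  nlinarith [le_abs_self M, abs_nonneg M, sq_nonneg (ellipticK k)]

lemma exists_cnFreq_lt (M : ℝ) : ∃ k ∈ Ico (0 : ℝ) 1, cnFreq k < M := by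
  -- The summand K(9/10) forces k₀ > 9/10, so that 1 - 2k₀² < -1/2 while K(k₀) is large.
  obtain ⟨k₀, hk₀, hM⟩ := exists_lt_ellipticK (2 * (|M| + 1) + ellipticK (9 / 10))
  have hpos := ellipticK_pos (k := 9 / 10) (by norm_num)
  have hk : 9 / 10 < k₀ := by
    by_contra hcon
    push Not at hcon
    have := ellipticK_mono hk₀.1.le hcon (by norm_num)
    linarith [abs_nonneg M]
  refine ⟨k₀, Ioo_subset_Ico_self hk₀, ?_⟩
  rw [cnFreq]
  have h2 : 1 - 2 * k₀ ^ 2 < -(1 / 2) := by nlinarith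
  have h3 : 2 * (|M| + 1) < ellipticK k₀ := by linarith
  have h4 : 2 * (|M| + 1) < ellipticK k₀ ^ 2 := by nlinarith [abs_nonneg M]
  nlinarith [neg_abs_le M, abs_nonneg M]

/-- An unbounded continuous strictly increasing function on `[0, 1)` has a continuous inverse. -/
lemma exists_continuousOn_inverse {f : ℝ → ℝ} (hf : StrictMonoOn f (Ico 0 1))
    (hc : ContinuousOn f (Ico 0 1)) (hu : ∀ M, ∃ k ∈ Ico (0 : ℝ) 1, M < f k) :
    ∃ g : ℝ → ℝ, ContinuousOn g (Ici (f 0)) ∧ (∀ s ∈ Ici (f 0), g s ∈ Ico (0 : ℝ) 1 ∧ f (g s) = s) ∧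
      ∀ k ∈ Ico (0 : ℝ) 1, g (f k) = k := by
  have h0 : (0 : ℝ) ∈ Ico (0 : ℝ) 1 := ⟨le_rfl, one_pos⟩
  have himg : f '' Ico 0 1 = Ici (f 0) := by
    ext s
    constructor
    · rintro ⟨k, hk, rfl⟩
      exact hf.monotoneOn h0 hk hk.1
    · intro hs
      obtain ⟨k, hk, hM⟩ := hu s
      have := intermediate_value_Icc hk.1 (hc.mono (Icc_subset_Ico_right hk.2))
      obtain ⟨y, hy, rfl⟩ := this ⟨hs, hM.le⟩
      exact ⟨y, ⟨hy.1, hy.2.trans_lt hk.2⟩, rfl⟩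
  -- An order isomorphism of intervals is a homeomorphism, so the inverse is continuous; clamping
  -- its argument from below by f 0 makes it a function on the line.
  let e : Ico (0 : ℝ) 1 ≃o Ici (f 0) :=
    (hf.orderIso f (Ico 0 1)).trans (OrderIso.setCongr _ _ himg)
  have hee : ∀ k, (e k : ℝ) = f k := fun k => rfl
  have hmem : ∀ s : ℝ, max s (f 0) ∈ Ici (f 0) := fun s => mem_Ici.2 (le_max_right _ _)
  refine ⟨fun s => e.symm ⟨max s (f 0), hmem s⟩, ?_, ?_, ?_⟩
  · refine Continuous.continuousOn ?_
    exact continuous_subtype_val.comp (e.symm.continuous.comp (by fun_prop))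
  · intro s hs
    refine ⟨(e.symm _).2, ?_⟩
    rw [← hee, OrderIso.apply_symm_apply]
    exact max_eq_left hs
  · intro k hk
    have : (⟨max (f k) (f 0), hmem (f k)⟩ : Ici (f 0)) = e ⟨k, hk⟩ :=
      Subtype.ext (max_eq_left (hf.monotoneOn h0 hk hk.1))
    simp only [this, OrderIso.symm_apply_apply]

lemma exists_cnMod : ∃ g : ℝ → ℝ, ContinuousOn g (Iic (π ^ 2 / 4)) ∧
    (∀ s ∈ Iic (π ^ 2 / 4), g s ∈ Ico (0 : ℝ) 1 ∧ cnFreq (g s) = s) ∧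
    ∀ k ∈ Ico (0 : ℝ) 1, g (cnFreq k) = k := by
  obtain ⟨g, h₁, h₂, h₃⟩ := exists_continuousOn_inverse (f := fun k => -cnFreq k)
    strictAntiOn_cnFreq.neg continuousOn_cnFreq.neg (fun M => by
      obtain ⟨k, hk, h⟩ := exists_cnFreq_lt (-M)
      exact ⟨k, hk, by linarith⟩)
  rw [cnFreq_zero] at h₁ h₂
  refine ⟨fun s => g (-s), h₁.comp (by fun_prop) fun s hs => mem_Ici.2 (neg_le_neg hs),
    fun s hs => ?_, h₃⟩
  obtain ⟨h₄, h₅⟩ := h₂ (-s) (mem_Ici.2 (neg_le_neg hs))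
  exact ⟨h₄, neg_injective h₅⟩

/-- Modulus of a cnoidal solution of period `T` in terms of `ΛT²/16`. -/
noncomputable def cnMod : ℝ → ℝ := exists_cnMod.choose

lemma continuousOn_cnMod : ContinuousOn cnMod (Iic (π ^ 2 / 4)) := exists_cnMod.choose_spec.1

lemma cnMod_mem {s : ℝ} (hs : s ≤ π ^ 2 / 4) : cnMod s ∈ Ico (0 : ℝ) 1 :=
  (exists_cnMod.choose_spec.2.1 s hs).1

lemma cnFreq_cnMod {s : ℝ} (hs : s ≤ π ^ 2 / 4) : cnFreq (cnMod s) = s :=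
  (exists_cnMod.choose_spec.2.1 s hs).2

lemma cnMod_cnFreq {k : ℝ} (hk : k ∈ Ico (0 : ℝ) 1) : cnMod (cnFreq k) = k :=
  exists_cnMod.choose_spec.2.2 k hk

lemma exists_dnMod : ∃ g : ℝ → ℝ, ContinuousOn g (Ici (π ^ 2 / 2)) ∧
    (∀ s ∈ Ici (π ^ 2 / 2), g s ∈ Ico (0 : ℝ) 1 ∧ dnFreq (g s) = s) ∧
    ∀ k ∈ Ico (0 : ℝ) 1, g (dnFreq k) = k := by
  rw [← dnFreq_zero]
  exact exists_continuousOn_inverse strictMonoOn_dnFreq continuousOn_dnFreq exists_lt_dnFreq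

/-- Modulus of a dnoidal solution of period `T` in terms of `-ΛT²/4`. -/
noncomputable def dnMod : ℝ → ℝ := exists_dnMod.choose

lemma continuousOn_dnMod : ContinuousOn dnMod (Ici (π ^ 2 / 2)) := exists_dnMod.choose_spec.1

lemma dnMod_mem {s : ℝ} (hs : π ^ 2 / 2 ≤ s) : dnMod s ∈ Ico (0 : ℝ) 1 :=
  (exists_dnMod.choose_spec.2.1 s hs).1

lemma dnFreq_dnMod {s : ℝ} (hs : π ^ 2 / 2 ≤ s) : dnFreq (dnMod s) = s :=
  (exists_dnMod.choose_spec.2.1 s hs).2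

lemma dnMod_dnFreq {k : ℝ} (hk : k ∈ Ico (0 : ℝ) 1) : dnMod (dnFreq k) = k :=
  exists_dnMod.choose_spec.2.2 k hk


/-! ### Cnoidal and dnoidal solutions: periods and energies -/

/-- Energy of the cnoidal solutions of period `T`. -/
noncomputable def cnEnergy (T Λ : ℝ) : ℝ :=
  cnMod (Λ * T ^ 2 / 16) ^ 2 * (4 * ellipticK (cnMod (Λ * T ^ 2 / 16)) / T) ^ 4 *
    (1 - cnMod (Λ * T ^ 2 / 16) ^ 2)

/-- Energy of the dnoidal solutions of period `T`. -/
noncomputable def dnEnergy (T Λ : ℝ) : ℝ :=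
  -((2 * ellipticK (dnMod (-Λ * T ^ 2 / 4)) / T) ^ 4 * (1 - dnMod (-Λ * T ^ 2 / 4) ^ 2))

/-- The parameter β cancels from ΛT²/16, so frequency and period determine the modulus, and with it
the energy. -/
lemma cn_param_of_period {Λ T κ β : ℝ} (hκ : κ ∈ Ioo (0 : ℝ) 1) (hβ : 0 < β)
    (hΛ : β ^ 2 * (1 - 2 * κ ^ 2) = Λ) (hT : T = 4 * ellipticK κ / β) :
    0 < T ∧ Λ * T ^ 2 / 16 = cnFreq κ ∧ Λ * T ^ 2 / 16 < π ^ 2 / 4 ∧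
      cnMod (Λ * T ^ 2 / 16) = κ ∧ cnEnergy T Λ = κ ^ 2 * β ^ 4 * (1 - κ ^ 2) := by
  have hK := ellipticK_pos (sq_lt_one_of_mem_Ico (Ioo_subset_Ico_self hκ))
  have hs : Λ * T ^ 2 / 16 = cnFreq κ := by
    rw [cnFreq, hT, ← hΛ]; field_simp; ring
  have hm : cnMod (Λ * T ^ 2 / 16) = κ := by rw [hs, cnMod_cnFreq (Ioo_subset_Ico_self hκ)]
  refine ⟨by rw [hT]; positivity, hs, ?_, hm, ?_⟩
  · rw [hs, ← cnFreq_zero]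
    exact strictAntiOn_cnFreq ⟨le_rfl, one_pos⟩ (Ioo_subset_Ico_self hκ) hκ.1
  · rw [cnEnergy, hm, show 4 * ellipticK κ / T = β by rw [hT]; field_simp]

lemma cn_param_of_lt {Λ T : ℝ} (hT : 0 < T) (h : Λ * T ^ 2 / 16 < π ^ 2 / 4) :
    ∃ κ ∈ Ioo (0 : ℝ) 1, ∃ β : ℝ, 0 < β ∧ β ^ 2 * (1 - 2 * κ ^ 2) = Λ ∧
      T = 4 * ellipticK κ / β := by
  have hm := cnMod_mem h.le
  have hf := cnFreq_cnMod h.le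
  set κ := cnMod (Λ * T ^ 2 / 16)
  have hK := ellipticK_pos (sq_lt_one_of_mem_Ico hm)
  refine ⟨κ, ⟨lt_of_le_of_ne hm.1 ?_, hm.2⟩, 4 * ellipticK κ / T, by positivity, ?_, by field_simp⟩
  · intro h0
    rw [← h0, cnFreq_zero] at hf
    exact h.ne hf.symm
  · rw [cnFreq] at hf
    have : Λ = 16 * (ellipticK κ ^ 2 * (1 - 2 * κ ^ 2)) / T ^ 2 := by
      rw [hf]; field_simp
    rw [this]; field_simp; ring

lemma dn_param_of_period {Λ T k b : ℝ} (hk : k ∈ Ioo (0 : ℝ) 1) (hb : 0 < b)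
    (hΛ : b ^ 2 * (2 - k ^ 2) = -Λ) (hT : T = 2 * ellipticK k / b) :
    0 < T ∧ -Λ * T ^ 2 / 4 = dnFreq k ∧ π ^ 2 / 2 < -Λ * T ^ 2 / 4 ∧
      dnMod (-Λ * T ^ 2 / 4) = k ∧ dnEnergy T Λ = -(b ^ 4 * (1 - k ^ 2)) := by
  have hK := ellipticK_pos (sq_lt_one_of_mem_Ico (Ioo_subset_Ico_self hk))
  have hs : -Λ * T ^ 2 / 4 = dnFreq k := by
    rw [dnFreq, hT, ← hΛ]; field_simp; ring
  have hm : dnMod (-Λ * T ^ 2 / 4) = k := by rw [hs, dnMod_dnFreq (Ioo_subset_Ico_self hk)]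
  refine ⟨by rw [hT]; positivity, hs, ?_, hm, ?_⟩
  · rw [hs, ← dnFreq_zero]
    exact strictMonoOn_dnFreq ⟨le_rfl, one_pos⟩ (Ioo_subset_Ico_self hk) hk.1
  · rw [dnEnergy, hm, show 2 * ellipticK k / T = b by rw [hT]; field_simp]

lemma dn_param_of_lt {Λ T : ℝ} (hT : 0 < T) (h : π ^ 2 / 2 < -Λ * T ^ 2 / 4) :
    ∃ k ∈ Ioo (0 : ℝ) 1, ∃ b : ℝ, 0 < b ∧ b ^ 2 * (2 - k ^ 2) = -Λ ∧
      T = 2 * ellipticK k / b := by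
  have hm := dnMod_mem h.le
  have hf := dnFreq_dnMod h.le
  set k := dnMod (-Λ * T ^ 2 / 4)
  have hK := ellipticK_pos (sq_lt_one_of_mem_Ico hm)
  refine ⟨k, ⟨lt_of_le_of_ne hm.1 ?_, hm.2⟩, 2 * ellipticK k / T, by positivity, ?_, by field_simp⟩
  · intro h0
    rw [← h0, dnFreq_zero] at hf
    exact h.ne hf
  · rw [dnFreq] at hf
    have : -Λ = 4 * (ellipticK k ^ 2 * (2 - k ^ 2)) / T ^ 2 := by
      rw [hf]; field_simp
    rw [this]; field_simp; ring

lemma IsCnoidal.exists_isSol {Λ T : ℝ} {ψ : ℝ → ℝ} (h : IsCnoidal Λ T ψ) :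
    ∃ v, IsSol Λ ψ v ∧ 0 < T ∧ Λ * T ^ 2 / 16 < π ^ 2 / 4 ∧
      energy Λ (ψ 0) (v 0) = cnEnergy T Λ := by
  obtain ⟨κ, hκ, β, hβ, hΛ, hT, τ, hψ⟩ := h
  have hk1 := sq_lt_one_of_mem_Ico (Ioo_subset_Ico_self hκ)
  obtain ⟨h₁, _, h₂, _, h₃⟩ := cn_param_of_period hκ hβ hΛ hT
  have hψ' : ψ = fun x => κ * β * jacobiCn (β * x - τ) κ := funext hψ
  refine ⟨cnVel κ β τ, ?_, h₁, h₂, ?_⟩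
  · rw [← hΛ, hψ']; exact isSol_cn hk1 β τ
  · rw [h₃, hψ', ← hΛ]; exact energy_cn hk1 β τ 0

lemma IsDnoidal.exists_isSol {Λ T : ℝ} {ψ : ℝ → ℝ} (h : IsDnoidal Λ T ψ) :
    ∃ v, IsSol Λ ψ v ∧ 0 < T ∧ π ^ 2 / 2 < -Λ * T ^ 2 / 4 ∧
      energy Λ (ψ 0) (v 0) = dnEnergy T Λ := by
  obtain ⟨k, hk, b, hb, hΛ, hT, τ, σ, hσ, hψ⟩ := h
  have hk1 := sq_lt_one_of_mem_Ico (Ioo_subset_Ico_self hk)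
  obtain ⟨h₁, _, h₂, _, h₃⟩ := dn_param_of_period hk hb hΛ hT
  have hψ' : ψ = fun x => σ * b * jacobiDn (b * x - τ) k := funext hψ
  have hσ2 : σ ^ 2 = 1 := by rcases hσ with rfl | rfl <;> norm_num
  have hΛ' : Λ = -(b ^ 2 * (2 - k ^ 2)) := by linarith
  refine ⟨dnVel k b σ τ, ?_, h₁, h₂, ?_⟩
  · rw [hΛ', hψ']; exact isSol_dn hk1 b τ hσ2
  · rw [h₃, hψ', hΛ']; exact energy_dn hk1 b τ 0 hσ2

/-- A level of positive energy is a single orbit, so the energy alone identifies the solution up to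
translation. -/
lemma IsSol.isCnoidal {Λ T : ℝ} {u v : ℝ → ℝ} (h : IsSol Λ u v) (hT : 0 < T)
    (hlt : Λ * T ^ 2 / 16 < π ^ 2 / 4) {x : ℝ} (hE : energy Λ (u x) (v x) = cnEnergy T Λ) :
    IsCnoidal Λ T u := by
  obtain ⟨κ, hκ, β, hβ, hΛ, hTβ⟩ := cn_param_of_lt hT hlt
  obtain ⟨_, _, _, _, h₃⟩ := cn_param_of_period hκ hβ hΛ hTβ
  have hk1 := sq_lt_one_of_mem_Ico (Ioo_subset_Ico_self hκ)
  rw [h.energy_eq x 0, h₃, ← hΛ] at hE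
  obtain ⟨τ, hu, hv⟩ := exists_cn_data hκ hβ hE
  have hs := isSol_cn hk1 β τ
  rw [hΛ] at hs
  have := (h.unique hs (x₀ := 0) hu.symm hv.symm).1
  exact ⟨κ, hκ, β, hβ, hΛ, hTβ, τ, fun x => by rw [this]⟩

lemma IsSol.isDnoidal {Λ T : ℝ} {u v : ℝ → ℝ} (h : IsSol Λ u v) (hT : 0 < T)
    (hlt : π ^ 2 / 2 < -Λ * T ^ 2 / 4) {x : ℝ} (hE : energy Λ (u x) (v x) = dnEnergy T Λ) :
    IsDnoidal Λ T u := by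
  obtain ⟨k, hk, b, hb, hΛ, hTb⟩ := dn_param_of_lt hT hlt
  obtain ⟨_, _, _, _, h₃⟩ := dn_param_of_period hk hb hΛ hTb
  have hk1 := sq_lt_one_of_mem_Ico (Ioo_subset_Ico_self hk)
  have hΛ' : -(b ^ 2 * (2 - k ^ 2)) = Λ := by linarith
  rw [h.energy_eq x 0, h₃, ← hΛ'] at hE
  obtain ⟨τ, σ, hσ, hu, hv⟩ := exists_dn_data hk hb hE
  have hσ2 : σ ^ 2 = 1 := by rcases hσ with rfl | rfl <;> norm_num
  have hs := isSol_dn hk1 b τ hσ2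
  rw [hΛ'] at hs
  have := (h.unique hs (x₀ := 0) hu.symm hv.symm).1
  exact ⟨k, hk, b, hb, hΛ, hTb, τ, σ, hσ, fun x => by rw [this]⟩

lemma IsCnoidal.periodic {Λ T : ℝ} {ψ : ℝ → ℝ} (h : IsCnoidal Λ T ψ) :
    Function.Periodic ψ T := by
  obtain ⟨κ, hκ, β, hβ, hΛ, hT, τ, hψ⟩ := h
  have hk1 := sq_lt_one_of_mem_Ico (Ioo_subset_Ico_self hκ)
  intro x
  have e : β * (x + T) - τ = β * x - τ + ((2 : ℤ) : ℝ) * (2 * ellipticK κ) := by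
    rw [hT]; push_cast; field_simp; ring
  rw [hψ, hψ, jacobiCn, e, jacobiAm_add hk1, jacobiCn]
  push_cast
  rw [cos_add_two_pi]

/-- Starting from a maximum, cn returns to 1 only when the amplitude is a multiple of 2π. -/
lemma IsCnoidal.eq_mul_of_periodic {Λ T t : ℝ} {ψ : ℝ → ℝ} (h : IsCnoidal Λ T ψ) (ht : 0 < t)
    (hp : Function.Periodic ψ t) : ∃ m : ℤ, 0 < m ∧ t = m * T := by
  obtain ⟨κ, hκ, β, hβ, hΛ, hT, τ, hψ⟩ := h
  have hk1 := sq_lt_one_of_mem_Ico (Ioo_subset_Ico_self hκ)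
  have hK := ellipticK_pos hk1
  have hm0 : jacobiAm 0 κ = 0 := by
    have := jacobiAm_ellipticF hk1 0
    rwa [ellipticF_zero] at this
  have h1 := hp (τ / β)
  rw [hψ, hψ, show β * (τ / β + t) - τ = β * t by field_simp; ring,
    show β * (τ / β) - τ = 0 by field_simp; ring, jacobiCn, jacobiCn, hm0, cos_zero] at h1
  have h2 : cos (jacobiAm (β * t) κ) = 1 :=
    mul_left_cancel₀ (mul_pos hκ.1 hβ).ne' h1
  obtain ⟨m, hm⟩ := (cos_eq_one_iff _).1 h2
  have h3 := ellipticF_jacobiAm hk1 (β * t)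
  rw [← hm, show (m : ℝ) * (2 * π) = ((2 * m : ℤ) : ℝ) * π by push_cast; ring,
    ellipticF_int_mul_pi hk1] at h3
  have h4 : t = m * T := by
    rw [hT]; field_simp; push_cast at h3; linarith
  refine ⟨m, ?_, h4⟩
  have hTpos : 0 < T := by rw [hT]; positivity
  have : (0 : ℝ) < m := by
    by_contra hcon
    push Not at hcon
    nlinarith
  exact_mod_cast this

lemma IsDnoidal.periodic {Λ T : ℝ} {ψ : ℝ → ℝ} (h : IsDnoidal Λ T ψ) :
    Function.Periodic ψ T := by
  obtain ⟨k, hk, b, hb, hΛ, hT, τ, σ, hσ, hψ⟩ := h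
  have hk1 := sq_lt_one_of_mem_Ico (Ioo_subset_Ico_self hk)
  intro x
  have e : b * (x + T) - τ = b * x - τ + ((1 : ℤ) : ℝ) * (2 * ellipticK k) := by
    rw [hT]; push_cast; field_simp; ring
  rw [hψ, hψ, jacobiDn, e, jacobiAm_add hk1, jacobiDn]
  push_cast
  rw [one_mul, sin_add_pi, neg_sq]

/-- Starting from an extremum of largest modulus, dn returns to 1 only where sin am = 0, that is at
multiples of π. -/
lemma IsDnoidal.eq_mul_of_periodic {Λ T t : ℝ} {ψ : ℝ → ℝ} (h : IsDnoidal Λ T ψ) (ht : 0 < t)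
    (hp : Function.Periodic ψ t) : ∃ m : ℤ, 0 < m ∧ t = m * T := by
  obtain ⟨k, hk, b, hb, hΛ, hT, τ, σ, hσ, hψ⟩ := h
  have hk1 := sq_lt_one_of_mem_Ico (Ioo_subset_Ico_self hk)
  have hK := ellipticK_pos hk1
  have hm0 : jacobiAm 0 k = 0 := by
    have := jacobiAm_ellipticF hk1 0
    rwa [ellipticF_zero] at this
  have h1 := hp (τ / b)
  have hσ0 : σ ≠ 0 := by rcases hσ with rfl | rfl <;> norm_num
  rw [hψ, hψ, show b * (τ / b + t) - τ = b * t by field_simp; ring,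
    show b * (τ / b) - τ = 0 by field_simp; ring] at h1
  have h2 := mul_left_cancel₀ (mul_ne_zero hσ0 hb.ne') h1
  have h2' := congrArg (· ^ 2) h2
  simp only [jacobiDn_sq hk1, hm0, sin_zero] at h2'
  have hs : sin (jacobiAm (b * t) k) = 0 := by
    have : k ^ 2 * sin (jacobiAm (b * t) k) ^ 2 = 0 := by linarith
    have hk0 : k ^ 2 ≠ 0 := (pow_pos hk.1 2).ne'
    simpa [hk0, hk.1.ne'] using this
  obtain ⟨m, hm⟩ := sin_eq_zero_iff.1 hs
  have h3 := ellipticF_jacobiAm hk1 (b * t)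
  rw [← hm, ellipticF_int_mul_pi hk1] at h3
  have h4 : t = m * T := by
    rw [hT]; field_simp; linarith
  refine ⟨m, ?_, h4⟩
  have hTpos : 0 < T := by rw [hT]; positivity
  have : (0 : ℝ) < m := by
    by_contra hcon
    push Not at hcon
    nlinarith
  exact_mod_cast this

lemma isLeast_of_periodic {T : ℝ} {ψ : ℝ → ℝ} (hT : 0 < T) (hp : Function.Periodic ψ T)
    (h : ∀ t, 0 < t → Function.Periodic ψ t → ∃ m : ℤ, 0 < m ∧ t = m * T) :
    IsLeast {t : ℝ | 0 < t ∧ Function.Periodic ψ t} T := by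
  refine ⟨⟨hT, hp⟩, fun t ht => ?_⟩
  obtain ⟨m, hm, rfl⟩ := h t ht.1 ht.2
  have : (1 : ℝ) ≤ m := by exact_mod_cast hm
  nlinarith

/-- Periods of the cnoidal solutions. -/
lemma exists_isCnoidal_iff {Λ T : ℝ} :
    (∃ ψ, IsCnoidal Λ T ψ) ↔ 0 < T ∧ Λ * T ^ 2 / 16 < π ^ 2 / 4 := by
  constructor
  · rintro ⟨ψ, h⟩
    obtain ⟨v, _, h₁, h₂, _⟩ := h.exists_isSol
    exact ⟨h₁, h₂⟩
  · rintro ⟨h₁, h₂⟩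
    obtain ⟨κ, hκ, β, hβ, hΛ, hT⟩ := cn_param_of_lt h₁ h₂
    exact ⟨fun x => κ * β * jacobiCn (β * x - 0) κ, κ, hκ, β, hβ, hΛ, hT, 0, fun _ => rfl⟩

/-- Periods of the dnoidal solutions. -/
lemma exists_isDnoidal_iff {Λ T : ℝ} :
    (∃ ψ, IsDnoidal Λ T ψ) ↔ 0 < T ∧ π ^ 2 / 2 < -Λ * T ^ 2 / 4 := by
  constructor
  · rintro ⟨ψ, h⟩
    obtain ⟨v, _, h₁, h₂, _⟩ := h.exists_isSol
    exact ⟨h₁, h₂⟩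
  · rintro ⟨h₁, h₂⟩
    obtain ⟨k, hk, b, hb, hΛ, hT⟩ := dn_param_of_lt h₁ h₂
    exact ⟨fun x => 1 * b * jacobiDn (b * x - 0) k, k, hk, b, hb, hΛ, hT, 0, 1, Or.inl rfl,
      fun _ => rfl⟩

lemma setOf_isCnoidal_of_pos {Λ : ℝ} (hΛ : 0 < Λ) :
    {T : ℝ | ∃ ψ, IsCnoidal Λ T ψ} = Ioo 0 (TcnMax Λ) := by
  ext T
  simp only [mem_ofPred_eq, exists_isCnoidal_iff, mem_Ioo, TcnMax]
  refine and_congr_right fun hT => ?_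
  have hs := sqrt_pos.2 hΛ
  rw [lt_div_iff₀ hs, ← pow_lt_pow_iff_left₀ (a := T * √Λ) (by positivity) (by positivity)
    two_ne_zero, mul_pow, sq_sqrt hΛ.le]
  constructor <;> intro h <;> nlinarith

lemma setOf_isCnoidal_of_nonpos {Λ : ℝ} (hΛ : Λ ≤ 0) :
    {T : ℝ | ∃ ψ, IsCnoidal Λ T ψ} = Ioi 0 := by
  ext T
  simp only [mem_ofPred_eq, exists_isCnoidal_iff, mem_Ioi]
  refine and_iff_left_of_imp fun hT => ?_
  have h1 : Λ * T ^ 2 ≤ 0 := mul_nonpos_of_nonpos_of_nonneg hΛ (sq_nonneg T)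
  have h2 : 0 < π ^ 2 := by positivity
  linarith

lemma setOf_isDnoidal {Λ : ℝ} (hΛ : Λ < 0) :
    {T : ℝ | ∃ ψ, IsDnoidal Λ T ψ} = Ioi (TdnMin Λ) := by
  ext T
  simp only [mem_ofPred_eq, exists_isDnoidal_iff, mem_Ioi, TdnMin]
  have hs : 0 < √(-Λ) := sqrt_pos.2 (by linarith)
  have hsq : √(-Λ) ^ 2 = -Λ := sq_sqrt (by linarith)
  have h2 : √(2 : ℝ) ^ 2 = 2 := sq_sqrt (by norm_num)
  have key : 0 < T → (π ^ 2 / 2 < -Λ * T ^ 2 / 4 ↔ π * √2 / √(-Λ) < T) := by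
    intro hT
    rw [div_lt_iff₀ hs, ← pow_lt_pow_iff_left₀ (a := π * √2) (by positivity) (by positivity)
      two_ne_zero, mul_pow, mul_pow, hsq, h2]
    constructor <;> intro h <;> nlinarith
  constructor
  · rintro ⟨hT, h⟩
    exact (key hT).1 h
  · intro h
    have hT : 0 < T := lt_trans (by positivity) h
    exact ⟨hT, (key hT).2 h⟩

/-! ### Dependence of the energies on frequency and period -/

lemma continuousOn_cnEnergy (T : ℝ) :
    ContinuousOn (cnEnergy T) {Λ | Λ * T ^ 2 / 16 ≤ π ^ 2 / 4} := by
  have h₁ : ContinuousOn (fun Λ => cnMod (Λ * T ^ 2 / 16)) {Λ | Λ * T ^ 2 / 16 ≤ π ^ 2 / 4} :=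
    continuousOn_cnMod.comp (f := fun Λ => Λ * T ^ 2 / 16) (by fun_prop) fun _ h => h
  have h₂ : ContinuousOn (fun Λ => ellipticK (cnMod (Λ * T ^ 2 / 16)))
      {Λ | Λ * T ^ 2 / 16 ≤ π ^ 2 / 4} :=
    continuousOn_ellipticK_Ico.comp h₁ fun _ h => cnMod_mem h
  exact ((h₁.pow 2).mul (((h₂.const_mul 4).div_const T).pow 4)).mul
    (continuousOn_const.sub (h₁.pow 2))

lemma continuousOn_dnEnergy (T : ℝ) :
    ContinuousOn (dnEnergy T) {Λ | π ^ 2 / 2 ≤ -Λ * T ^ 2 / 4} := by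
  have h₁ : ContinuousOn (fun Λ => dnMod (-Λ * T ^ 2 / 4)) {Λ | π ^ 2 / 2 ≤ -Λ * T ^ 2 / 4} :=
    continuousOn_dnMod.comp (f := fun Λ => -Λ * T ^ 2 / 4) (by fun_prop) fun _ h => h
  have h₂ : ContinuousOn (fun Λ => ellipticK (dnMod (-Λ * T ^ 2 / 4)))
      {Λ | π ^ 2 / 2 ≤ -Λ * T ^ 2 / 4} :=
    continuousOn_ellipticK_Ico.comp h₁ fun _ h => dnMod_mem h
  exact ((((h₂.const_mul 2).div_const T).pow 4).mul
    (continuousOn_const.sub (h₁.pow 2))).neg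

/-- At the threshold the modulus is 0: this is the limit of small oscillations about the zero
solution. -/
lemma cnEnergy_threshold {T Λ : ℝ} (h : Λ * T ^ 2 / 16 = π ^ 2 / 4) : cnEnergy T Λ = 0 := by
  have : cnMod (Λ * T ^ 2 / 16) = 0 := by
    rw [h, ← cnFreq_zero, cnMod_cnFreq ⟨le_rfl, one_pos⟩]
  rw [cnEnergy, this]; ring

/-- The corresponding limit of small oscillations about the nonzero constants. -/
lemma dnEnergy_threshold {T Λ : ℝ} (hT : 0 < T) (h : -Λ * T ^ 2 / 4 = π ^ 2 / 2) :
    dnEnergy T Λ = -Λ ^ 2 / 4 := by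
  have h₁ : dnMod (-Λ * T ^ 2 / 4) = 0 := by
    rw [h, ← dnFreq_zero, dnMod_dnFreq ⟨le_rfl, one_pos⟩]
  have h₂ : Λ = -2 * (π / T) ^ 2 := by
    field_simp; linarith
  rw [dnEnergy, h₁, ellipticK_zero, h₂]; field_simp; ring

lemma cnEnergy_pos {T Λ : ℝ} (hT : 0 < T) (h : Λ * T ^ 2 / 16 < π ^ 2 / 4) : 0 < cnEnergy T Λ := by
  obtain ⟨κ, hκ, β, hβ, hΛ, hTβ⟩ := cn_param_of_lt hT h
  obtain ⟨_, _, _, _, h₃⟩ := cn_param_of_period hκ hβ hΛ hTβ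
  have hk1 := sq_lt_one_of_mem_Ico (Ioo_subset_Ico_self hκ)
  rw [h₃]
  exact mul_pos (mul_pos (pow_pos hκ.1 2) (by positivity)) (by linarith)

lemma dnEnergy_neg {T Λ : ℝ} (hT : 0 < T) (h : π ^ 2 / 2 < -Λ * T ^ 2 / 4) :
    dnEnergy T Λ < 0 ∧ -Λ ^ 2 / 4 < dnEnergy T Λ := by
  obtain ⟨k, hk, b, hb, hΛ, hTb⟩ := dn_param_of_lt hT h
  obtain ⟨_, _, _, _, h₃⟩ := dn_param_of_period hk hb hΛ hTb
  have hk1 := sq_lt_one_of_mem_Ico (Ioo_subset_Ico_self hk)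
  rw [h₃, show Λ ^ 2 = (b ^ 2 * (2 - k ^ 2)) ^ 2 by rw [hΛ]; ring]
  constructor
  · have : 0 < b ^ 4 * (1 - k ^ 2) := mul_pos (by positivity) (by linarith)
    linarith
  · have : 0 < b ^ 4 * k ^ 4 := mul_pos (by positivity) (pow_pos hk.1 4)
    nlinarith

/-- At a fixed frequency, cnoidal solutions of longer period have lower energy. -/
lemma cnEnergy_lt {T₁ T₂ Λ : ℝ} (hT₁ : 0 < T₁) (hT : T₁ < T₂)
    (h : Λ * T₂ ^ 2 / 16 < π ^ 2 / 4) : cnEnergy T₂ Λ < cnEnergy T₁ Λ := by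
  have hT₂ := hT₁.trans hT
  have h' : Λ * T₁ ^ 2 / 16 < π ^ 2 / 4 := by
    have hπ : 0 < π ^ 2 := by positivity
    have hsq : T₁ ^ 2 < T₂ ^ 2 := pow_lt_pow_left₀ hT hT₁.le two_ne_zero
    rcases le_or_gt Λ 0 with h0 | h0
    · have : Λ * T₁ ^ 2 ≤ 0 := mul_nonpos_of_nonpos_of_nonneg h0 (sq_nonneg _)
      linarith
    · nlinarith
  obtain ⟨κ₁, hκ₁, β₁, hβ₁, hΛ₁, hTβ₁⟩ := cn_param_of_lt hT₁ h'
  obtain ⟨κ₂, hκ₂, β₂, hβ₂, hΛ₂, hTβ₂⟩ := cn_param_of_lt hT₂ h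
  obtain ⟨_, _, _, _, e₁⟩ := cn_param_of_period hκ₁ hβ₁ hΛ₁ hTβ₁
  obtain ⟨_, _, _, _, e₂⟩ := cn_param_of_period hκ₂ hβ₂ hΛ₂ hTβ₂
  have t₁ := ellipticF_div_eq_cnTime κ₁ hβ₁ (π / 2)
  have t₂ := ellipticF_div_eq_cnTime κ₂ hβ₂ (π / 2)
  have hk₁ := sq_lt_one_of_mem_Ico (Ioo_subset_Ico_self hκ₁)
  rw [hΛ₁] at t₁
  rw [hΛ₂] at t₂
  have s₁ : T₁ = 4 * cnTime Λ (κ₁ ^ 2 * β₁ ^ 2) (π / 2) := by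
    rw [← t₁, ← ellipticK, hTβ₁]; ring
  have s₂ : T₂ = 4 * cnTime Λ (κ₂ ^ 2 * β₂ ^ 2) (π / 2) := by
    rw [← t₂, ← ellipticK, hTβ₂]; ring
  have hy₁ : 0 < κ₁ ^ 2 * β₁ ^ 2 := mul_pos (pow_pos hκ₁.1 2) (by positivity)
  have hy₂ : 0 < κ₂ ^ 2 * β₂ ^ 2 := mul_pos (pow_pos hκ₂.1 2) (by positivity)
  have hp₁ : 0 < Λ + κ₁ ^ 2 * β₁ ^ 2 := by
    rw [← hΛ₁]; nlinarith [mul_pos (sq_pos_of_pos hβ₁) (sub_pos.2 hk₁)]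
  -- At equal frequency the time map decreases in the squared amplitude y, so the longer period has
  -- the smaller y. The energy is y² + Λy, which increases with y because Λ + y > 0.
  have hlt : κ₂ ^ 2 * β₂ ^ 2 < κ₁ ^ 2 * β₁ ^ 2 := by
    rcases lt_trichotomy (κ₂ ^ 2 * β₂ ^ 2) (κ₁ ^ 2 * β₁ ^ 2) with h0 | h0 | h0
    · exact h0
    · rw [h0] at s₂; linarith
    · have := cnTime_lt (φ := π / 2) le_rfl h0 hy₁ hp₁ (by positivity)
      linarith
  have f₁ : cnEnergy T₁ Λ = (κ₁ ^ 2 * β₁ ^ 2) ^ 2 + Λ * (κ₁ ^ 2 * β₁ ^ 2) := by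
    rw [e₁, ← hΛ₁]; ring
  have f₂ : cnEnergy T₂ Λ = (κ₂ ^ 2 * β₂ ^ 2) ^ 2 + Λ * (κ₂ ^ 2 * β₂ ^ 2) := by
    rw [e₂, ← hΛ₂]; ring
  rw [f₁, f₂]
  nlinarith

/-- At a fixed frequency, dnoidal solutions of longer period have higher energy. -/
lemma dnEnergy_lt {T₁ T₂ Λ : ℝ} (hT₁ : 0 < T₁) (hT : T₁ < T₂)
    (h : π ^ 2 / 2 < -Λ * T₁ ^ 2 / 4) : dnEnergy T₁ Λ < dnEnergy T₂ Λ := by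
  have hT₂ := hT₁.trans hT
  have hsq : T₁ ^ 2 < T₂ ^ 2 := pow_lt_pow_left₀ hT hT₁.le two_ne_zero
  have hΛ : 0 < -Λ := by
    by_contra hcon
    push Not at hcon
    nlinarith [sq_nonneg T₁, sq_pos_of_pos pi_pos]
  have hs : -Λ * T₁ ^ 2 / 4 < -Λ * T₂ ^ 2 / 4 := by nlinarith
  obtain ⟨k₁, hk₁, b₁, hb₁, hΛ₁, hTb₁⟩ := dn_param_of_lt hT₁ h
  obtain ⟨k₂, hk₂, b₂, hb₂, hΛ₂, hTb₂⟩ := dn_param_of_lt hT₂ (h.trans hs)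
  obtain ⟨_, s₁, _, _, e₁⟩ := dn_param_of_period hk₁ hb₁ hΛ₁ hTb₁
  obtain ⟨_, s₂, _, _, e₂⟩ := dn_param_of_period hk₂ hb₂ hΛ₂ hTb₂
  rw [s₁, s₂, strictMonoOn_dnFreq.lt_iff_lt (Ioo_subset_Ico_self hk₁) (Ioo_subset_Ico_self hk₂)]
    at hs
  have hk₁' := sq_lt_one_of_mem_Ico (Ioo_subset_Ico_self hk₁)
  have hk₂' := sq_lt_one_of_mem_Ico (Ioo_subset_Ico_self hk₂)
  have hx : k₁ ^ 2 < k₂ ^ 2 := pow_lt_pow_left₀ hs hk₁.1.le two_ne_zero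
  -- Eliminating b leaves the energy as Λ² times a function of the modulus alone.
  have f₁ : dnEnergy T₁ Λ = -(Λ ^ 2 * ((1 - k₁ ^ 2) / (2 - k₁ ^ 2) ^ 2)) := by
    rw [e₁, show Λ ^ 2 = (b₁ ^ 2 * (2 - k₁ ^ 2)) ^ 2 by rw [hΛ₁]; ring]
    have : 2 - k₁ ^ 2 ≠ 0 := by linarith
    field_simp
  have f₂ : dnEnergy T₂ Λ = -(Λ ^ 2 * ((1 - k₂ ^ 2) / (2 - k₂ ^ 2) ^ 2)) := by
    rw [e₂, show Λ ^ 2 = (b₂ ^ 2 * (2 - k₂ ^ 2)) ^ 2 by rw [hΛ₂]; ring]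
    have : 2 - k₂ ^ 2 ≠ 0 := by linarith
    field_simp
  rw [f₁, f₂, neg_lt_neg_iff]
  refine mul_lt_mul_of_pos_left ?_ (by nlinarith)
  set x₁ := k₁ ^ 2
  set x₂ := k₂ ^ 2
  rw [div_lt_div_iff₀ (by nlinarith) (by nlinarith)]
  have hx₁ : 0 < x₁ := pow_pos hk₁.1 2
  have e : (1 - x₁) * (2 - x₂) ^ 2 - (1 - x₂) * (2 - x₁) ^ 2 =
      (x₂ - x₁) * (x₁ * (1 - x₂) + x₂) := by ring
  have : 0 < (x₂ - x₁) * (x₁ * (1 - x₂) + x₂) := mul_pos (by linarith) (by nlinarith)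
  linarith


/-! ### Labels and energies -/

/-- The energy of the solutions with a given label, on an edge that `n` periods fill if the
period is `r / n`. -/
noncomputable def Label.energy (r Λ : ℝ) : Label → ℝ
  | .lam => -Λ ^ 2 / 4
  | .int n => if n = 0 then 0 else if 0 < n then cnEnergy (r / n) Λ else dnEnergy (r / -n) Λ

/-- The frequencies at which a label occurs. -/
def Label.Valid (r Λ : ℝ) : Label → Prop
  | .lam => Λ < 0
  | .int n => (0 < n → Λ < (n : ℝ) ^ 2 * (2 * π / r) ^ 2) ∧
      (n < 0 → Λ < -((n : ℝ) ^ 2 * (2 * π / r) ^ 2 / 2))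

/-- The period is r / n, and (2π/r)² is the basic frequency of the edge: 1 on a loop (r = 2π) and
`LamStar L` on the central edge (r = 4L). -/
lemma threshold_cn {r n Λ : ℝ} (hr : 0 < r) (hn : 0 < n) :
    (Λ * (r / n) ^ 2 / 16 < π ^ 2 / 4 ↔ Λ < n ^ 2 * (2 * π / r) ^ 2) ∧
    (Λ * (r / n) ^ 2 / 16 = π ^ 2 / 4 ↔ Λ = n ^ 2 * (2 * π / r) ^ 2) := by
  have e : n ^ 2 * (2 * π / r) ^ 2 = 4 * π ^ 2 / (r / n) ^ 2 := by field_simp; norm_num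
  have hc : 0 < (r / n) ^ 2 := by positivity
  rw [e, lt_div_iff₀ hc, eq_div_iff hc.ne']
  constructor <;> constructor <;> intro h <;> linarith

lemma threshold_dn {r n Λ : ℝ} (hr : 0 < r) (hn : 0 < n) :
    (π ^ 2 / 2 < -Λ * (r / n) ^ 2 / 4 ↔ Λ < -(n ^ 2 * (2 * π / r) ^ 2 / 2)) ∧
    (-Λ * (r / n) ^ 2 / 4 = π ^ 2 / 2 ↔ Λ = -(n ^ 2 * (2 * π / r) ^ 2 / 2)) := by
  have e : -(n ^ 2 * (2 * π / r) ^ 2 / 2) = -(2 * π ^ 2) / (r / n) ^ 2 := by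
    field_simp
  have hc : 0 < (r / n) ^ 2 := by positivity
  rw [e, lt_div_iff₀ hc, eq_div_iff hc.ne']
  constructor <;> constructor <;> intro h <;> linarith

namespace Label

variable {r Λ : ℝ}

@[simp] lemma energy_lam : Label.lam.energy r Λ = -Λ ^ 2 / 4 := rfl

@[simp] lemma energy_zero : (Label.int 0).energy r Λ = 0 := by simp [energy]

lemma energy_pos_eq {n : ℤ} (hn : 0 < n) : (Label.int n).energy r Λ = cnEnergy (r / n) Λ := by
  simp [energy, hn.ne', hn]

lemma energy_neg_eq {n : ℤ} (hn : n < 0) : (Label.int n).energy r Λ = dnEnergy (r / -n) Λ := by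
  simp [energy, hn.ne, hn.le]

lemma energy_int_pos (hr : 0 < r) {n : ℤ} (hn : 0 < n) (h : (Label.int n).Valid r Λ) :
    0 < (Label.int n).energy r Λ := by
  have hn' : (0 : ℝ) < n := by exact_mod_cast hn
  rw [energy_pos_eq hn]
  exact cnEnergy_pos (by positivity) ((threshold_cn hr hn').1.2 (h.1 hn))

lemma energy_int_neg (hr : 0 < r) {n : ℤ} (hn : n < 0) (h : (Label.int n).Valid r Λ) :
    (Label.int n).energy r Λ < 0 ∧ -Λ ^ 2 / 4 < (Label.int n).energy r Λ := by
  have hn' : (0 : ℝ) < -n := by have : (n : ℝ) < 0 := by exact_mod_cast hn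
                                linarith
  rw [energy_neg_eq hn]
  refine dnEnergy_neg (by positivity) ((threshold_dn hr hn').1.2 ?_)
  rw [neg_sq]; exact h.2 hn

lemma lam_neg_of_valid (hr : 0 < r) {n : ℤ} (hn : n < 0) (h : (Label.int n).Valid r Λ) : Λ < 0 := by
  have h1 := h.2 hn
  have h2 : 0 ≤ (n : ℝ) ^ 2 * (2 * π / r) ^ 2 / 2 := by positivity
  linarith

lemma energy_ge (hr : 0 < r) {l : Label} (h : l.Valid r Λ) : -Λ ^ 2 / 4 ≤ l.energy r Λ := by
  rcases l with n | _
  · rcases lt_trichotomy n 0 with hn | hn | hn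
    · exact (energy_int_neg hr hn h).2.le
    · subst hn; rw [energy_zero]; linarith [sq_nonneg Λ]
    · linarith [energy_int_pos hr hn h, sq_nonneg Λ]
  · exact le_rfl

/-- Energies of cnoidal labels increase with the number of periods. -/
lemma energy_cn_le_iff {s : ℝ} {n m : ℤ} (hr : 0 < r) (hs : 0 < s) (hn : 0 < n) (hm : 0 < m)
    (hvn : (Label.int n).Valid r Λ) (hvm : (Label.int m).Valid s Λ) :
    (Label.int m).energy s Λ ≤ (Label.int n).energy r Λ ↔ r / (n : ℝ) ≤ s / m := by
  have hn' : (0 : ℝ) < n := by exact_mod_cast hn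
  have hm' : (0 : ℝ) < m := by exact_mod_cast hm
  rw [energy_pos_eq hn, energy_pos_eq hm]
  constructor
  · intro h
    by_contra hcon
    push Not at hcon
    exact absurd (cnEnergy_lt (by positivity) hcon ((threshold_cn hr hn').1.2 (hvn.1 hn)))
      (not_lt.2 h)
  · intro h
    rcases h.lt_or_eq with h | h
    · exact (cnEnergy_lt (by positivity) h ((threshold_cn hs hm').1.2 (hvm.1 hm))).le
    · rw [h]

/-- Energies of dnoidal labels decrease with the number of periods. -/
lemma energy_dn_le_iff {s : ℝ} {n m : ℤ} (hr : 0 < r) (hs : 0 < s) (hn : n < 0) (hm : m < 0)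
    (hvn : (Label.int n).Valid r Λ) (hvm : (Label.int m).Valid s Λ) :
    (Label.int m).energy s Λ ≤ (Label.int n).energy r Λ ↔ s / (-m : ℝ) ≤ r / -n := by
  have hn' : (0 : ℝ) < -n := by have : (n : ℝ) < 0 := by exact_mod_cast hn
                                linarith
  have hm' : (0 : ℝ) < -m := by have : (m : ℝ) < 0 := by exact_mod_cast hm
                                linarith
  have vn := (threshold_dn (Λ := Λ) hr hn').1.2 (by rw [neg_sq]; exact hvn.2 hn)
  have vm := (threshold_dn (Λ := Λ) hs hm').1.2 (by rw [neg_sq]; exact hvm.2 hm)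
  rw [energy_neg_eq hn, energy_neg_eq hm]
  constructor
  · intro h
    by_contra hcon
    push Not at hcon
    exact absurd (dnEnergy_lt (by positivity) hcon vn) (not_lt.2 h)
  · intro h
    rcases h.lt_or_eq with h | h
    · exact (dnEnergy_lt (by positivity) h vm).le
    · rw [h]

/-- A label is determined by the energy. -/
lemma eq_of_energy_eq (hr : 0 < r) {l l' : Label} (h : l.Valid r Λ) (h' : l'.Valid r Λ)
    (he : l.energy r Λ = l'.energy r Λ) : l = l' := by
  rcases l with n | _ <;> rcases l' with m | _
  · rcases lt_trichotomy n 0 with hn | hn | hn <;> rcases lt_trichotomy m 0 with hm | hm | hm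
    · have hn' : (n : ℝ) < 0 := by exact_mod_cast hn
      have hm' : (m : ℝ) < 0 := by exact_mod_cast hm
      have h₁ := (energy_dn_le_iff hr hr hn hm h h').1 he.ge
      have h₂ := (energy_dn_le_iff hr hr hm hn h' h).1 he.le
      rw [div_le_div_iff_of_pos_left hr (by linarith) (by linarith)] at h₁ h₂
      congr 1
      exact_mod_cast (by linarith : (n : ℝ) = m)
    · subst hm; have := energy_int_neg hr hn h; rw [he, energy_zero] at this; linarith
    · have := energy_int_neg hr hn h; have := energy_int_pos hr hm h'; linarith
    · subst hn; have := energy_int_neg hr hm h'; rw [← he, energy_zero] at this; linarith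
    · rw [hn, hm]
    · subst hn; have := energy_int_pos hr hm h'; rw [← he, energy_zero] at this; linarith
    · have := energy_int_neg hr hm h'; have := energy_int_pos hr hn h; linarith
    · subst hm; have := energy_int_pos hr hn h; rw [he, energy_zero] at this; linarith
    · have hn' : (0 : ℝ) < n := by exact_mod_cast hn
      have hm' : (0 : ℝ) < m := by exact_mod_cast hm
      have h₁ := (energy_cn_le_iff hr hr hn hm h h').1 he.ge
      have h₂ := (energy_cn_le_iff hr hr hm hn h' h).1 he.le
      rw [div_le_div_iff_of_pos_left hr hn' hm'] at h₁
      rw [div_le_div_iff_of_pos_left hr hm' hn'] at h₂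
      congr 1
      exact_mod_cast le_antisymm h₂ h₁
  · exfalso
    rw [energy_lam] at he
    have hΛ : Λ < 0 := h'
    rcases lt_trichotomy n 0 with hn | hn | hn
    · have := energy_int_neg hr hn h; linarith
    · subst hn; rw [energy_zero] at he; nlinarith
    · have := energy_int_pos hr hn h; nlinarith
  · exfalso
    rw [energy_lam] at he
    have hΛ : Λ < 0 := h
    rcases lt_trichotomy m 0 with hn | hn | hn
    · have := energy_int_neg hr hn h'; linarith
    · subst hn; rw [energy_zero] at he; nlinarith
    · have := energy_int_pos hr hn h'; nlinarith
  · rfl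

end Label

/-! ### Passage between labels of an edge and energies of orbits -/

section EdgeLabel

variable {Λ ℓ w r : ℝ} {φ u v : ℝ → ℝ}

lemma eq_zero_of_energy_zero {a b : ℝ} (h : energy Λ a b = 0) (ha : a = 0) : b = 0 := by
  rw [energy, ha] at h; nlinarith

lemma sq_eq_of_energy_min {a b : ℝ} (h : energy Λ a b = -Λ ^ 2 / 4) : 2 * a ^ 2 = -Λ ∧ b = 0 := by
  have e : b ^ 2 + (a ^ 2 + Λ / 2) ^ 2 = 0 := by rw [energy] at h; linear_combination h
  have h1 : b ^ 2 = 0 := by nlinarith [sq_nonneg b, sq_nonneg (a ^ 2 + Λ / 2)]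
  have h2 : (a ^ 2 + Λ / 2) ^ 2 = 0 := by nlinarith [sq_nonneg b, sq_nonneg (a ^ 2 + Λ / 2)]
  have h3 : a ^ 2 + Λ / 2 = 0 := by simpa using h2
  exact ⟨by linarith, by simpa using h1⟩

lemma sq_sqrt_half (hΛ : Λ < 0) : 2 * √(-Λ / 2) ^ 2 = -Λ := by
  rw [sq_sqrt (by linarith)]; ring

/-- Everything that is later used about a label: frequency range, energy and periodicity of the
extension to the line. The clause on `int 0` is needed because energy 0 also belongs to the
separatrix. -/
lemma EdgeHasLabel.elim {l : Label} (h : EdgeHasLabel Λ ℓ w φ l) (hℓ : 0 < ℓ) (hw : 0 < w)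
    (hr : 2 * ℓ = w * r) (hs : IsSol Λ u v) (he : EqOn φ u (Icc (-ℓ) ℓ)) :
    l.Valid r Λ ∧ (∀ x, energy Λ (u x) (v x) = l.energy r Λ) ∧
      (l = .int 0 → ∀ x, u x = 0) ∧ Function.Periodic u r ∧ Function.Periodic v r := by
  have hr0 : 0 < r := by
    by_contra hcon
    push Not at hcon
    nlinarith
  have hconst : ∀ c : ℝ, 2 * c ^ 2 = -Λ ∨ c = 0 → EqOn φ (fun _ => c) (Icc (-ℓ) ℓ) →
      u = (fun _ => c) ∧ v = fun _ => 0 := by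
    intro c hc hφ
    rcases hc with hc | rfl
    · exact hs.eq_of_eqOn hℓ (IsSol.const hc) (he.symm.trans hφ)
    · exact hs.eq_of_eqOn hℓ (IsSol.zero Λ) (he.symm.trans hφ)
  rcases l with n | _
  · rcases h with ⟨hn, hφ⟩ | ⟨hn, T, ψ, hcn, hφ, hT⟩ | ⟨hn, T, ψ, hdn, hφ, hT⟩
    · subst hn
      obtain ⟨rfl, rfl⟩ := hconst 0 (Or.inr rfl) hφ
      refine ⟨⟨fun h => absurd h (lt_irrefl _), fun h => absurd h (lt_irrefl _)⟩, fun x => ?_,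
        fun _ _ => rfl, fun _ => rfl, fun _ => rfl⟩
      simp [_root_.energy]
    · have hn' : (0 : ℝ) < n := by exact_mod_cast hn
      obtain ⟨v', hψ, hT0, hlt, hE⟩ := hcn.exists_isSol
      obtain ⟨rfl, rfl⟩ := hs.eq_of_eqOn hℓ hψ (he.symm.trans hφ)
      have hrT : r = n * T := by
        apply mul_left_cancel₀ hw.ne'; linarith
      have hTr : T = r / n := by rw [hrT]; field_simp
      have hp := hcn.periodic.int_mul n
      rw [← hrT] at hp
      refine ⟨⟨fun _ => (threshold_cn hr0 hn').1.1 (hTr ▸ hlt), fun h => absurd h (not_lt.2 hn.le)⟩,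
        fun x => ?_, fun h => ?_, hp, ?_⟩
      · rw [hs.energy_eq x 0, hE, Label.energy_pos_eq hn, hTr]
      · injection h with h; omega
      · intro x
        have h₁ := congrFun hs.deriv_left
        rw [← h₁, ← h₁, ← deriv_comp_add_const]
        exact congrArg (fun f => deriv f x) (funext hp)
    · have hn' : (0 : ℝ) < -n := by
        have : (n : ℝ) < 0 := by exact_mod_cast hn
        linarith
      obtain ⟨v', hψ, hT0, hlt, hE⟩ := hdn.exists_isSol
      obtain ⟨rfl, rfl⟩ := hs.eq_of_eqOn hℓ hψ (he.symm.trans hφ)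
      rw [abs_of_neg (by linarith)] at hT
      have hrT : r = -n * T := by
        apply mul_left_cancel₀ hw.ne'; linarith
      have hTr : T = r / -n := by rw [hrT, mul_div_cancel_left₀ _ hn'.ne']
      have hp := hdn.periodic.int_mul (-n)
      push_cast at hp
      rw [← hrT] at hp
      refine ⟨⟨fun h => absurd h (not_lt.2 hn.le), fun _ => ?_⟩, fun x => ?_, fun h => ?_, hp, ?_⟩
      · have := (threshold_dn (Λ := Λ) hr0 hn').1.1 (hTr ▸ hlt)
        rwa [neg_sq] at this
      · rw [hs.energy_eq x 0, hE, Label.energy_neg_eq hn, hTr]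
      · injection h with h; omega
      · intro x
        have h₁ := congrFun hs.deriv_left
        rw [← h₁, ← h₁, ← deriv_comp_add_const]
        exact congrArg (fun f => deriv f x) (funext hp)
  · obtain ⟨hΛ, hφ⟩ := h
    have key : ∃ c : ℝ, 2 * c ^ 2 = -Λ ∧ u = (fun _ => c) ∧ v = fun _ => 0 := by
      rcases hφ with hφ | hφ
      · exact ⟨_, sq_sqrt_half hΛ, hconst _ (Or.inl (sq_sqrt_half hΛ)) hφ⟩
      · have : 2 * (-√(-Λ / 2)) ^ 2 = -Λ := by rw [neg_sq, sq_sqrt_half hΛ]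
        exact ⟨_, this, hconst _ (Or.inl this) hφ⟩
    obtain ⟨c, hc, rfl, rfl⟩ := key
    refine ⟨hΛ, fun x => ?_, fun h => by injection h, fun _ => rfl, fun _ => rfl⟩
    rw [Label.energy_lam, _root_.energy]
    linear_combination (c ^ 2 / 2 + Λ / 4) * hc

/-- The converse of `EdgeHasLabel.elim`. At energy 0 a single zero excludes the separatrix, on which
solutions have none. -/
lemma IsSol.edgeHasLabel {l : Label} (hs : IsSol Λ u v) (hℓ : 0 < ℓ) (hw : 0 < w)
    (hr : 2 * ℓ = w * r) (he : EqOn φ u (Icc (-ℓ) ℓ)) (hv : l.Valid r Λ) {x : ℝ}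
    (hE : energy Λ (u x) (v x) = l.energy r Λ) (h0 : l = .int 0 → u x = 0) :
    EdgeHasLabel Λ ℓ w φ l := by
  have hr0 : 0 < r := by
    by_contra hcon
    push Not at hcon
    nlinarith
  rcases l with n | _
  · rcases lt_trichotomy n 0 with hn | hn | hn
    · have hn' : (0 : ℝ) < -n := by
        have : (n : ℝ) < 0 := by exact_mod_cast hn
        linarith
      refine Or.inr (Or.inr ⟨hn, r / -n, u, ?_, he, ?_⟩)
      · rw [Label.energy_neg_eq hn] at hE
        refine hs.isDnoidal (by positivity) ((threshold_dn hr0 hn').1.2 ?_) hE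
        rw [neg_sq]; exact hv.2 hn
      · rw [abs_of_neg (by linarith), hr, mul_left_comm, mul_div_cancel₀ _ hn'.ne']
    · subst hn
      refine Or.inl ⟨rfl, ?_⟩
      rw [Label.energy_zero] at hE
      have hu := h0 rfl
      rw [(hs.unique (IsSol.zero Λ) hu (eq_zero_of_energy_zero hE hu)).1] at he
      exact he
    · have hn' : (0 : ℝ) < n := by exact_mod_cast hn
      refine Or.inr (Or.inl ⟨hn, r / n, u, ?_, he, ?_⟩)
      · rw [Label.energy_pos_eq hn] at hE
        exact hs.isCnoidal (by positivity) ((threshold_cn hr0 hn').1.2 (hv.1 hn)) hE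
      · rw [hr]; field_simp
  · have hΛ : Λ < 0 := hv
    refine ⟨hΛ, ?_⟩
    obtain ⟨hu, hv0⟩ := sq_eq_of_energy_min hE
    have : u x ^ 2 = √(-Λ / 2) ^ 2 := by linarith [sq_sqrt_half hΛ]
    rcases sq_eq_sq_iff_eq_or_eq_neg.1 this with h | h
    · left
      rwa [(hs.unique (IsSol.const (sq_sqrt_half hΛ)) h hv0).1] at he
    · right
      have hc : 2 * (-√(-Λ / 2)) ^ 2 = -Λ := by rw [neg_sq, sq_sqrt_half hΛ]
      rwa [(hs.unique (IsSol.const hc) h hv0).1] at he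

/-- Every periodic solution has a label. -/
lemma IsSol.exists_label (hs : IsSol Λ u v) (hℓ : 0 < ℓ) (hw : 0 < w)
    (hr : 2 * ℓ = w * r) (he : EqOn φ u (Icc (-ℓ) ℓ)) (hp : Function.Periodic u r) :
    ∃ l, EdgeHasLabel Λ ℓ w φ l := by
  have hr0 : 0 < r := by
    by_contra hcon
    push Not at hcon
    nlinarith
  have hsq : energy Λ (u 0) (v 0) + Λ ^ 2 / 4 = v 0 ^ 2 + (u 0 ^ 2 + Λ / 2) ^ 2 := by
    rw [energy]; ring
  rcases lt_trichotomy (energy Λ (u 0) (v 0)) 0 with hE | hE | hE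
  · have hΛ : Λ < 0 := by
      by_contra hcon
      push Not at hcon
      have : 0 ≤ energy Λ (u 0) (v 0) := by rw [energy]; positivity
      linarith
    rcases eq_or_lt_of_le (show -Λ ^ 2 / 4 ≤ energy Λ (u 0) (v 0) by
      nlinarith [sq_nonneg (v 0), sq_nonneg (u 0 ^ 2 + Λ / 2)]) with h | h
    · exact ⟨.lam, hs.edgeHasLabel hℓ hw hr he hΛ h.symm (fun h => by injection h)⟩
    · obtain ⟨k, hk, b, hb, hΛk, hEk⟩ := exists_dn_param hΛ hE h
      obtain ⟨hT, _, hlt, _, hEn⟩ := dn_param_of_period hk hb hΛk rfl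
      have hdn := hs.isDnoidal hT hlt (x := 0) (hEk.trans hEn.symm)
      obtain ⟨m, hm, hrm⟩ := hdn.eq_mul_of_periodic hr0 hp
      have hm' : (0 : ℝ) < m := by exact_mod_cast hm
      refine ⟨.int (-m), Or.inr (Or.inr ⟨by omega, _, u, hdn, he, ?_⟩)⟩
      push_cast
      rw [abs_neg, abs_of_pos hm', hr, hrm]; ring
  · by_cases h0 : u 0 = 0
    · refine ⟨.int 0, hs.edgeHasLabel hℓ hw hr he ?_ (x := 0) (by rw [hE, Label.energy_zero])
        (fun _ => h0)⟩
      exact ⟨fun h => absurd h (lt_irrefl _), fun h => absurd h (lt_irrefl _)⟩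
    · exfalso
      have hne : ∀ x, u x ≠ 0 := by
        intro x hx
        have h1 : energy Λ (u x) (v x) = 0 := by rw [hs.energy_eq x 0, hE]
        have h2 := (hs.unique (IsSol.zero Λ) hx (eq_zero_of_energy_zero h1 hx)).1
        rw [h2] at h0
        exact h0 rfl
      -- A nonzero solution on the separatrix is not periodic: at energy 0 the derivative of v/u is
      -- -u², so v/u decreases strictly.
      have hd : ∀ x, HasDerivAt (fun x => v x / u x) (-u x ^ 2) x := by
        intro x
        refine ((hs x).2.div (hs x).1 (hne x)).congr_deriv ?_
        have h1 : energy Λ (u x) (v x) = 0 := by rw [hs.energy_eq x 0, hE]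
        rw [energy] at h1
        rw [div_eq_iff (pow_ne_zero 2 (hne x))]
        linear_combination -h1
      have hanti : StrictAnti fun x => v x / u x := by
        refine strictAnti_of_deriv_neg fun x => ?_
        rw [(hd x).deriv]
        have := sq_pos_of_ne_zero (hne x)
        linarith
      have hvp : v (0 + r) = v 0 := by
        have h₁ := congrFun hs.deriv_left
        rw [← h₁, ← h₁, ← deriv_comp_add_const]
        exact congrArg (fun f => deriv f 0) (funext hp)
      have h1 := hanti hr0
      have h2 := hp 0
      simp only [zero_add] at h2 hvp
      simp only [h2, hvp, lt_irrefl] at h1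
  · obtain ⟨κ, hκ, β, hβ, hΛk, hEk⟩ := exists_cn_param (Λ := Λ) hE
    obtain ⟨hT, _, hlt, _, hEn⟩ := cn_param_of_period hκ hβ hΛk rfl
    have hcn := hs.isCnoidal hT hlt (x := 0) (hEk.trans hEn.symm)
    obtain ⟨m, hm, hrm⟩ := hcn.eq_mul_of_periodic hr0 hp
    refine ⟨.int m, Or.inr (Or.inl ⟨hm, _, u, hcn, he, ?_⟩)⟩
    rw [hr, hrm]; ring

end EdgeLabel


/-! ### Standing waves in terms of solutions on the line -/

/-- Solutions on the line whose restrictions to the edges make up `Φ`. -/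
structure Extends (L Λ : ℝ) (Φ : GraphFun) (u₁ v₁ u₂ v₂ u₃ v₃ : ℝ → ℝ) : Prop where
  sol₁ : IsSol Λ u₁ v₁
  sol₂ : IsSol Λ u₂ v₂
  sol₃ : IsSol Λ u₃ v₃
  eqOn₁ : EqOn Φ.e₁ u₁ (Icc (-π) π)
  eqOn₂ : EqOn Φ.e₂ u₂ (Icc (-L) L)
  eqOn₃ : EqOn Φ.e₃ u₃ (Icc (-π) π)

lemma left_mem_Icc' {ℓ : ℝ} (hℓ : 0 < ℓ) : -ℓ ∈ Icc (-ℓ) ℓ := ⟨le_rfl, by linarith⟩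

lemma right_mem_Icc' {ℓ : ℝ} (hℓ : 0 < ℓ) : ℓ ∈ Icc (-ℓ) ℓ := ⟨by linarith, le_rfl⟩

section Waves

variable {L Λ : ℝ} {Φ : GraphFun} {u₁ v₁ u₂ v₂ u₃ v₃ φ u v : ℝ → ℝ}

lemma IsStandingWave.exists_extends (hL : 0 < L) (h : IsStandingWave L Λ Φ) :
    ∃ u₁ v₁ u₂ v₂ u₃ v₃, Extends L Λ Φ u₁ v₁ u₂ v₂ u₃ v₃ := by
  obtain ⟨u₁, v₁, h₁, e₁⟩ := h.eq₁.exists_isSol pi_pos (exists_isSol Λ)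
  obtain ⟨u₂, v₂, h₂, e₂⟩ := h.eq₂.exists_isSol hL (exists_isSol Λ)
  obtain ⟨u₃, v₃, h₃, e₃⟩ := h.eq₃.exists_isSol pi_pos (exists_isSol Λ)
  exact ⟨u₁, v₁, u₂, v₂, u₃, v₃, h₁, h₂, h₃, e₁, e₂, e₃⟩

/-- The vertex conditions, for solutions on the line. -/
def VertexConditions (L : ℝ) (u₁ v₁ u₂ v₂ u₃ v₃ : ℝ → ℝ) : Prop :=
  u₁ (-π) = u₁ π ∧ u₁ π = u₂ (-L) ∧ u₃ (-π) = u₃ π ∧ u₃ π = u₂ L ∧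
    v₁ (-π) - v₁ π + v₂ (-L) = 0 ∧ -v₂ L + v₃ (-π) - v₃ π = 0

lemma Extends.isStandingWave_iff (hL : 0 < L) (h : Extends L Λ Φ u₁ v₁ u₂ v₂ u₃ v₃) :
    IsStandingWave L Λ Φ ↔ VertexConditions L u₁ v₁ u₂ v₂ u₃ v₃ := by
  have hl := left_mem_Icc' pi_pos
  have hr := right_mem_Icc' pi_pos
  have hl' := left_mem_Icc' hL
  have hr' := right_mem_Icc' hL
  have d₁ := fun {x} => edgeDeriv_eq_of_eqOn pi_pos h.sol₁ h.eqOn₁ (x := x)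
  have d₂ := fun {x} => edgeDeriv_eq_of_eqOn hL h.sol₂ h.eqOn₂ (x := x)
  have d₃ := fun {x} => edgeDeriv_eq_of_eqOn pi_pos h.sol₃ h.eqOn₃ (x := x)
  constructor
  · intro hw
    obtain ⟨_, _, _, c₁, c₂, f₁, f₂⟩ := hw
    rw [h.eqOn₁ hl, h.eqOn₁ hr, h.eqOn₂ hl'] at c₁
    rw [h.eqOn₃ hl, h.eqOn₃ hr, h.eqOn₂ hr'] at c₂
    rw [d₁ hl, d₁ hr, d₂ hl'] at f₁
    rw [d₃ hl, d₃ hr, d₂ hr'] at f₂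
    exact ⟨c₁.1, c₁.2, c₂.1, c₂.2, f₁, f₂⟩
  · rintro ⟨c₁, c₁', c₂, c₂', f₁, f₂⟩
    refine ⟨h.sol₁.solvesOnEdge h.eqOn₁, h.sol₂.solvesOnEdge h.eqOn₂, h.sol₃.solvesOnEdge h.eqOn₃,
      ?_, ?_, ?_, ?_⟩
    · rw [h.eqOn₁ hl, h.eqOn₁ hr, h.eqOn₂ hl']; exact ⟨c₁, c₁'⟩
    · rw [h.eqOn₃ hl, h.eqOn₃ hr, h.eqOn₂ hr']; exact ⟨c₂, c₂'⟩
    · rw [d₁ hl, d₁ hr, d₂ hl']; exact f₁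
    · rw [d₃ hl, d₃ hr, d₂ hr']; exact f₂

lemma completeLoop_iff (h : IsSol Λ u v) (he : EqOn φ u (Icc (-π) π)) :
    CompleteLoop φ ↔ v π = v (-π) := by
  rw [CompleteLoop, edgeDeriv_eq_of_eqOn pi_pos h he (right_mem_Icc' pi_pos),
    edgeDeriv_eq_of_eqOn pi_pos h he (left_mem_Icc' pi_pos)]

lemma incompleteLoop_iff (h : IsSol Λ u v) (he : EqOn φ u (Icc (-π) π)) :
    IncompleteLoop φ ↔ v π = -v (-π) := by
  rw [IncompleteLoop, edgeDeriv_eq_of_eqOn pi_pos h he (right_mem_Icc' pi_pos),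
    edgeDeriv_eq_of_eqOn pi_pos h he (left_mem_Icc' pi_pos)]

/-- Equal positions at the two ends force equal squared velocities, by conservation of energy. -/
lemma completeLoop_or_incompleteLoop (h : IsSol Λ u v) (he : EqOn φ u (Icc (-π) π))
    (hu : u (-π) = u π) : CompleteLoop φ ∨ IncompleteLoop φ := by
  rw [completeLoop_iff h he, incompleteLoop_iff h he, ← sq_eq_sq_iff_eq_or_eq_neg]
  have := h.energy_eq π (-π)
  rw [energy, energy, hu] at this
  linarith

/-- Every standing wave lies in one of the three families. -/
theorem IsStandingWave.mem_families (hL : 0 < L) (h : IsStandingWave L Λ Φ) :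
    Φ ∈ TwoIncomplete L Λ ∪ TwoComplete L Λ ∪ OneOfEach L Λ := by
  obtain ⟨u₁, v₁, u₂, v₂, u₃, v₃, hE⟩ := h.exists_extends hL
  obtain ⟨c₁, _, c₃, _, _, _⟩ := (hE.isStandingWave_iff hL).1 h
  have h₁ := completeLoop_or_incompleteLoop hE.sol₁ hE.eqOn₁ c₁
  have h₃ := completeLoop_or_incompleteLoop hE.sol₃ hE.eqOn₃ c₃
  rcases h₁ with h₁ | h₁ <;> rcases h₃ with h₃ | h₃
  · exact Or.inl (Or.inr ⟨h, h₁, h₃⟩)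
  · exact Or.inr ⟨h, Or.inr ⟨h₁, h₃⟩⟩
  · exact Or.inr ⟨h, Or.inl ⟨h₁, h₃⟩⟩
  · exact Or.inl (Or.inl ⟨h, h₁, h₃⟩)

/-- The reflections in -L and L compose to the translation by 4L. -/
lemma IsSol.periodic_of_neumann (h : IsSol Λ u v) (h₁ : v (-L) = 0) (h₂ : v L = 0) :
    Function.Periodic u (4 * L) := by
  intro x
  have e₁ := (h.eq_reflect h₂ (2 * -L - x)).1
  have e₂ := (h.eq_reflect h₁ x).1
  rw [show 2 * L - (2 * -L - x) = x + 4 * L by ring] at e₁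
  rw [e₁, e₂]

lemma IsSol.neumann_of_periodic (h : IsSol Λ u v) (h₁ : v (-L) = 0)
    (hp : Function.Periodic v (4 * L)) : v L = 0 := by
  have e₁ := (h.eq_reflect h₁ L).2
  have e₂ := hp (2 * -L - L)
  rw [show 2 * -L - L + 4 * L = L by ring] at e₂
  linarith

/-- The standing waves with two complete loops are those that have a type, and the type is
unique. -/
theorem mem_twoComplete_iff (hL : 0 < L) :
    Φ ∈ TwoComplete L Λ ↔ ∃! t : Triple, HasType L Λ Φ t := by
  have hr₁ : 2 * π = 1 * (2 * π) := by ring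
  have hr₂ : 2 * L = 1 / 2 * (4 * L) := by ring
  constructor
  · rintro ⟨hw, k₁, k₃⟩
    obtain ⟨u₁, v₁, u₂, v₂, u₃, v₃, hE⟩ := hw.exists_extends hL
    obtain ⟨c₁, c₁', c₃, c₃', f₁, f₃⟩ := (hE.isStandingWave_iff hL).1 hw
    rw [completeLoop_iff hE.sol₁ hE.eqOn₁] at k₁
    rw [completeLoop_iff hE.sol₃ hE.eqOn₃] at k₃
    have eπ : -π + 2 * π = π := by ring
    have p₁ := (hE.sol₁.periodic_of_eq (x := -π) (T := 2 * π) (by rw [eπ, c₁])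
      (by rw [eπ, k₁])).1
    have p₃ := (hE.sol₃.periodic_of_eq (x := -π) (T := 2 * π) (by rw [eπ, c₃])
      (by rw [eπ, k₃])).1
    -- The two ends of a complete loop cancel in the flux, which leaves the Neumann conditions on
    -- the central edge.
    have p₂ := hE.sol₂.periodic_of_neumann (L := L) (by linarith) (by linarith)
    obtain ⟨n₁, h₁⟩ := hE.sol₁.exists_label pi_pos one_pos hr₁ hE.eqOn₁ p₁
    obtain ⟨m, h₂⟩ := hE.sol₂.exists_label hL one_half_pos hr₂ hE.eqOn₂ p₂
    obtain ⟨n₃, h₃⟩ := hE.sol₃.exists_label pi_pos one_pos hr₁ hE.eqOn₃ p₃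
    refine ⟨⟨n₁, m, n₃⟩, ⟨hw, h₁, h₂, h₃⟩, ?_⟩
    rintro ⟨n₁', m', n₃'⟩ ⟨_, h₁', h₂', h₃'⟩
    have a₁ := h₁.elim pi_pos one_pos hr₁ hE.sol₁ hE.eqOn₁
    have a₁' := h₁'.elim pi_pos one_pos hr₁ hE.sol₁ hE.eqOn₁
    have a₂ := h₂.elim hL one_half_pos hr₂ hE.sol₂ hE.eqOn₂
    have a₂' := h₂'.elim hL one_half_pos hr₂ hE.sol₂ hE.eqOn₂
    have a₃ := h₃.elim pi_pos one_pos hr₁ hE.sol₃ hE.eqOn₃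
    have a₃' := h₃'.elim pi_pos one_pos hr₁ hE.sol₃ hE.eqOn₃
    have e₁ : n₁' = n₁ := Label.eq_of_energy_eq (by positivity) a₁'.1 a₁.1
      ((a₁'.2.1 0).symm.trans (a₁.2.1 0))
    have e₂ : m' = m := Label.eq_of_energy_eq (by positivity) a₂'.1 a₂.1
      ((a₂'.2.1 0).symm.trans (a₂.2.1 0))
    have e₃ : n₃' = n₃ := Label.eq_of_energy_eq (by positivity) a₃'.1 a₃.1
      ((a₃'.2.1 0).symm.trans (a₃.2.1 0))
    rw [e₁, e₂, e₃]
  · rintro ⟨⟨n₁, m, n₃⟩, ⟨hw, h₁, h₂, h₃⟩, -⟩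
    obtain ⟨u₁, v₁, u₂, v₂, u₃, v₃, hE⟩ := hw.exists_extends hL
    have eπ : -π + 2 * π = π := by ring
    refine ⟨hw, ?_, ?_⟩
    · have := (h₁.elim pi_pos one_pos hr₁ hE.sol₁ hE.eqOn₁).2.2.2.2 (-π)
      rw [completeLoop_iff hE.sol₁ hE.eqOn₁]
      rwa [eπ] at this
    · have := (h₃.elim pi_pos one_pos hr₁ hE.sol₃ hE.eqOn₃).2.2.2.2 (-π)
      rw [completeLoop_iff hE.sol₃ hE.eqOn₃]
      rwa [eπ] at this

end Waves

/-! ### Construction of standing waves from their data at a vertex -/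

/-- The function on the graph that is made up of solutions which have the value `a` and the
velocity `b₁` at the end of the first loop, velocity `0` at both ends of the central edge, and
velocity `b₃` at the end of the second loop. -/
noncomputable def waveOf (L Λ a b₁ b₃ : ℝ) : GraphFun where
  e₁ x := flowU Λ a b₁ (x - π)
  e₂ x := flowU Λ a 0 (x + L)
  e₃ x := flowU Λ (flowU Λ a 0 (2 * L)) b₃ (x - π)

/-- The conditions under which `waveOf L Λ a b₁ b₃` is a standing wave of type `t`. -/
structure TypeData (L Λ : ℝ) (t : Triple) (a b₁ b₃ : ℝ) : Prop where
  valid₁ : t.n₁.Valid (2 * π) Λ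
  valid₂ : t.m.Valid (4 * L) Λ
  valid₃ : t.n₃.Valid (2 * π) Λ
  energy₁ : b₁ ^ 2 + t.m.energy (4 * L) Λ = t.n₁.energy (2 * π) Λ
  energy₂ : energy Λ a 0 = t.m.energy (4 * L) Λ
  energy₃ : b₃ ^ 2 + t.m.energy (4 * L) Λ = t.n₃.energy (2 * π) Λ
  zero : t.n₁ = .int 0 ∨ t.m = .int 0 ∨ t.n₃ = .int 0 → a = 0

lemma energy_eq_sq_add (Λ a b : ℝ) : energy Λ a b = b ^ 2 + energy Λ a 0 := by
  rw [energy, energy]; ring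

section TypeDataLemmas

variable {L Λ a b₁ b₃ : ℝ} {t : Triple} {Φ : GraphFun}

lemma extends_waveOf (L Λ a b₁ b₃ : ℝ) :
    Extends L Λ (waveOf L Λ a b₁ b₃) (fun x => flowU Λ a b₁ (x + -π))
      (fun x => flowV Λ a b₁ (x + -π)) (fun x => flowU Λ a 0 (x + L)) (fun x => flowV Λ a 0 (x + L))
      (fun x => flowU Λ (flowU Λ a 0 (2 * L)) b₃ (x + -π))
      (fun x => flowV Λ (flowU Λ a 0 (2 * L)) b₃ (x + -π)) :=
  ⟨(isSol_flow _ _ _).comp_add _, (isSol_flow _ _ _).comp_add _, (isSol_flow _ _ _).comp_add _,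
    fun _ _ => rfl, fun _ _ => rfl, fun _ _ => rfl⟩

lemma flow_zero_zero (Λ t : ℝ) : flowU Λ 0 0 t = 0 ∧ flowV Λ 0 0 t = 0 :=
  (IsSol.zero Λ).eq_flow 0 t

/-- The label of the central edge gives period 4L, and rest at -L then implies rest at L. So the
position at either vertex, taken at rest, has the energy of the centre, and adding b₁² or b₃²
produces the energy required by the loop label. -/
lemma TypeData.hasType (hL : 0 < L) (h : TypeData L Λ t a b₁ b₃) :
    HasType L Λ (waveOf L Λ a b₁ b₃) t ∧ flowV Λ a 0 (2 * L) = 0 := by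
  have hr₁ : 2 * π = 1 * (2 * π) := by ring
  have hr₂ : 2 * L = 1 / 2 * (4 * L) := by ring
  have hE := extends_waveOf L Λ a b₁ b₃
  have l₂ : EdgeHasLabel Λ L (1 / 2) (waveOf L Λ a b₁ b₃).e₂ t.m := by
    refine hE.sol₂.edgeHasLabel hL one_half_pos hr₂ hE.eqOn₂ h.valid₂ (x := -L) ?_ ?_
    · simpa using h.energy₂
    · intro h0; simpa using h.zero (Or.inr (Or.inl h0))
  have a₂ := l₂.elim hL one_half_pos hr₂ hE.sol₂ hE.eqOn₂
  have n₂ : flowV Λ a 0 (2 * L) = 0 := by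
    have := hE.sol₂.neumann_of_periodic (L := L) (by simp) a₂.2.2.2.2
    simpa [two_mul] using this
  have ec : energy Λ (flowU Λ a 0 (2 * L)) 0 = t.m.energy (4 * L) Λ := by
    rw [← h.energy₂, ← energy_flow Λ a 0 (2 * L), n₂]
  have l₁ : EdgeHasLabel Λ π 1 (waveOf L Λ a b₁ b₃).e₁ t.n₁ := by
    refine hE.sol₁.edgeHasLabel pi_pos one_pos hr₁ hE.eqOn₁ h.valid₁ (x := π) ?_ ?_
    · simp only [add_neg_cancel, flowU_zero, flowV_zero]
      rw [energy_eq_sq_add, h.energy₂, h.energy₁]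
    · intro h0; simpa using h.zero (Or.inl h0)
  have l₃ : EdgeHasLabel Λ π 1 (waveOf L Λ a b₁ b₃).e₃ t.n₃ := by
    refine hE.sol₃.edgeHasLabel pi_pos one_pos hr₁ hE.eqOn₃ h.valid₃ (x := π) ?_ ?_
    · simp only [add_neg_cancel, flowU_zero, flowV_zero]
      rw [energy_eq_sq_add, ec, h.energy₃]
    · intro h0
      rw [h.zero (Or.inr (Or.inr h0))]
      simp [(flow_zero_zero _ _).1]
  have a₁ := l₁.elim pi_pos one_pos hr₁ hE.sol₁ hE.eqOn₁
  have a₃ := l₃.elim pi_pos one_pos hr₁ hE.sol₃ hE.eqOn₃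
  have eπ : -π + 2 * π = π := by ring
  have p₁ := a₁.2.2.2.1 (-π)
  have q₁ := a₁.2.2.2.2 (-π)
  have p₃ := a₃.2.2.2.1 (-π)
  have q₃ := a₃.2.2.2.2 (-π)
  simp only [eπ] at p₁ q₁ p₃ q₃
  refine ⟨⟨(hE.isStandingWave_iff hL).2 ⟨p₁.symm, by simp, p₃.symm, by simp [two_mul], ?_, ?_⟩,
    l₁, l₂, l₃⟩, n₂⟩
  · beta_reduce; rw [q₁]; simp
  · beta_reduce; rw [q₃, show L + L = 2 * L by ring, n₂]; simp

lemma HasType.exists_typeData (hL : 0 < L) (h : HasType L Λ Φ t) :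
    ∃ a b₁ b₃, TypeData L Λ t a b₁ b₃ ∧ EqOn Φ.e₁ (waveOf L Λ a b₁ b₃).e₁ (Icc (-π) π) ∧
      EqOn Φ.e₂ (waveOf L Λ a b₁ b₃).e₂ (Icc (-L) L) ∧
      EqOn Φ.e₃ (waveOf L Λ a b₁ b₃).e₃ (Icc (-π) π) := by
  have hr₁ : 2 * π = 1 * (2 * π) := by ring
  have hr₂ : 2 * L = 1 / 2 * (4 * L) := by ring
  obtain ⟨hw, l₁, l₂, l₃⟩ := h
  obtain ⟨u₁, v₁, u₂, v₂, u₃, v₃, hE⟩ := hw.exists_extends hL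
  obtain ⟨c₁, c₁', c₃, c₃', f₁, f₃⟩ := (hE.isStandingWave_iff hL).1 hw
  have a₁ := l₁.elim pi_pos one_pos hr₁ hE.sol₁ hE.eqOn₁
  have a₂ := l₂.elim hL one_half_pos hr₂ hE.sol₂ hE.eqOn₂
  have a₃ := l₃.elim pi_pos one_pos hr₁ hE.sol₃ hE.eqOn₃
  have eπ : -π + 2 * π = π := by ring
  have q₁ := a₁.2.2.2.2 (-π)
  have q₃ := a₃.2.2.2.2 (-π)
  rw [eπ] at q₁ q₃
  have n₂ : v₂ (-L) = 0 := by linarith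
  have n₂' : v₂ L = 0 := by linarith
  have g₂ := fun x => hE.sol₂.eq_flow (-L) x
  rw [n₂] at g₂
  have g₁ := fun x => hE.sol₁.eq_flow π x
  rw [c₁'] at g₁
  have g₃ := fun x => hE.sol₃.eq_flow π x
  have hc : flowU Λ (u₂ (-L)) 0 (2 * L) = u₂ L := by
    rw [(g₂ _).1]; ring_nf
  rw [c₃', ← hc] at g₃
  have e₂ := a₂.2.1 (-L)
  have e₂' := a₂.2.1 L
  rw [n₂] at e₂
  rw [n₂'] at e₂'
  refine ⟨u₂ (-L), v₁ π, v₃ π, ⟨a₁.1, a₂.1, a₃.1, ?_, e₂, ?_, ?_⟩, ?_, ?_, ?_⟩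
  · rw [← e₂, ← energy_eq_sq_add, ← c₁', a₁.2.1]
  · rw [← e₂', ← energy_eq_sq_add, ← c₃', a₃.2.1]
  · rintro (h0 | h0 | h0)
    · rw [← c₁', a₁.2.2.1 h0]
    · exact a₂.2.2.1 h0 _
    -- A zero second loop makes the centre vanish at L, where it is also at rest, hence everywhere.
    · have h1 : u₂ L = 0 := by rw [← c₃', a₃.2.2.1 h0]
      exact congrFun (hE.sol₂.unique (IsSol.zero Λ) h1 n₂').1 (-L)
  · intro x hx
    simp only [hE.eqOn₁ hx, waveOf, (g₁ _).1]
    congr 1; ring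
  · intro x hx
    simp only [hE.eqOn₂ hx, waveOf, (g₂ _).1]
    congr 1; ring
  · intro x hx
    simp only [hE.eqOn₃ hx, waveOf, (g₃ _).1]
    congr 1; ring

end TypeDataLemmas

/-! ### Thresholds -/

lemma Label.valid_loop_int {n : ℤ} {Λ : ℝ} : (Label.int n).Valid (2 * π) Λ ↔
    (0 < n → Λ < (n : ℝ) ^ 2) ∧ (n < 0 → Λ < -((n : ℝ) ^ 2 / 2)) := by
  rw [Label.Valid, div_self (by positivity)]; simp

lemma two_pi_div_four_mul (L : ℝ) : (2 * π / (4 * L)) ^ 2 = LamStar L := by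
  rw [LamStar, show 4 * L = 2 * (2 * L) by ring, mul_div_mul_left _ _ two_ne_zero]

lemma Label.valid_centre_int {n : ℤ} {L Λ : ℝ} : (Label.int n).Valid (4 * L) Λ ↔
    (0 < n → Λ < (n : ℝ) ^ 2 * LamStar L) ∧ (n < 0 → Λ < -((n : ℝ) ^ 2 * LamStar L / 2)) := by
  rw [Label.Valid, two_pi_div_four_mul]

theorem HasType.thresholds {L Λ : ℝ} {Φ : GraphFun} {t : Triple} (hL : 0 < L)
    (h : HasType L Λ Φ t) (n : ℤ) :
    (t.n₁ = .int n ∨ t.n₃ = .int n →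
      (0 < n → Λ < (n : ℝ) ^ 2) ∧ (n < 0 → Λ < -((n : ℝ) ^ 2 / 2))) ∧
    (t.m = .int n →
      (0 < n → Λ < (n : ℝ) ^ 2 * LamStar L) ∧
      (n < 0 → Λ < -((n : ℝ) ^ 2 * LamStar L / 2))) := by
  obtain ⟨a, b₁, b₃, hd, -⟩ := h.exists_typeData hL
  refine ⟨?_, fun hm => Label.valid_centre_int.1 (hm ▸ hd.valid₂)⟩
  rintro (h₁ | h₃)
  · exact Label.valid_loop_int.1 (h₁ ▸ hd.valid₁)
  · exact Label.valid_loop_int.1 (h₃ ▸ hd.valid₃)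


/-! ### Continuity of families of standing waves in `H¹` -/

lemma deriv_eqOn_Ioo {f g : ℝ → ℝ} {ℓ : ℝ} (h : EqOn f g (Icc (-ℓ) ℓ)) :
    EqOn (deriv f) (deriv g) (Ioo (-ℓ) ℓ) := fun x hx =>
  Filter.EventuallyEq.deriv_eq (by filter_upwards [Icc_mem_nhds hx.1 hx.2] with y hy using h hy)

lemma integral_edge_congr {f f' g g' : ℝ → ℝ} {ℓ : ℝ} (hℓ : 0 < ℓ) (hf : EqOn f f' (Icc (-ℓ) ℓ))
    (hg : EqOn g g' (Icc (-ℓ) ℓ)) :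
    ∫ x in (-ℓ)..ℓ, ((f x - g x) ^ 2 + (deriv f x - deriv g x) ^ 2) =
      ∫ x in (-ℓ)..ℓ, ((f' x - g' x) ^ 2 + (deriv f' x - deriv g' x) ^ 2) := by
  refine intervalIntegral.integral_congr_Ioo_of_le (by linarith) fun x hx => ?_
  have hx' := Ioo_subset_Icc_self hx
  simp only [hf hx', hg hx', deriv_eqOn_Ioo hf hx, deriv_eqOn_Ioo hg hx]

/-- Two functions on the graph that agree on the edges. -/
def EdgewiseEq (L : ℝ) (Φ Ψ : GraphFun) : Prop :=
  EqOn Φ.e₁ Ψ.e₁ (Icc (-π) π) ∧ EqOn Φ.e₂ Ψ.e₂ (Icc (-L) L) ∧ EqOn Φ.e₃ Ψ.e₃ (Icc (-π) π)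

lemma h1DistSq_congr {L : ℝ} (hL : 0 < L) {Φ Φ' Ψ Ψ' : GraphFun} (h : EdgewiseEq L Φ Φ')
    (h' : EdgewiseEq L Ψ Ψ') : h1DistSq L Φ Ψ = h1DistSq L Φ' Ψ' := by
  rw [h1DistSq, h1DistSq, integral_edge_congr pi_pos h.1 h'.1, integral_edge_congr hL h.2.1 h'.2.1,
    integral_edge_congr pi_pos h.2.2 h'.2.2]

lemma H1ContinuousOn.congr {L : ℝ} (hL : 0 < L) {S : Set ℝ} {Φ Ψ : ℝ → GraphFun}
    (h : H1ContinuousOn L S Φ) (he : ∀ Λ ∈ S, EdgewiseEq L (Ψ Λ) (Φ Λ)) :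
    H1ContinuousOn L S Ψ := by
  intro Λ₁ h₁
  refine (h Λ₁ h₁).congr' ?_
  filter_upwards [self_mem_nhdsWithin] with Λ hΛ
  exact (h1DistSq_congr hL (he Λ hΛ) (he Λ₁ h₁)).symm

/-- A bound for the squares of position and velocity along the flow. -/
noncomputable def flowBound (z : ℝ × ℝ × ℝ) : ℝ :=
  1 + |z.1| + energy z.1 z.2.1 z.2.2 ^ 2 + (|energy z.1 z.2.1 z.2.2| +
    |z.1| * (1 + |z.1| + energy z.1 z.2.1 z.2.2 ^ 2))

lemma continuous_flowBound : Continuous flowBound := by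
  unfold flowBound energy; fun_prop

lemma flow_sq_le (z : ℝ × ℝ × ℝ) (x : ℝ) :
    flowU z.1 z.2.1 z.2.2 x ^ 2 + flowV z.1 z.2.1 z.2.2 x ^ 2 ≤ flowBound z :=
  add_le_add (flowU_sq_le _ _ _ _) (flowV_sq_le _ _ _ _)

/-- Dominated convergence: pointwise convergence is continuity of the flow in frequency and data,
and the energy bound `flowBound` dominates uniformly in time. -/
lemma tendsto_integral_flow {ι : Type*} {l : Filter ι} [l.IsCountablyGenerated]
    {z : ι → ℝ × ℝ × ℝ} {z₀ : ℝ × ℝ × ℝ} (hz : Tendsto z l (𝓝 z₀)) (c α β : ℝ) :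
    Tendsto (fun i => ∫ x in α..β,
      ((flowU (z i).1 (z i).2.1 (z i).2.2 (x + c) - flowU z₀.1 z₀.2.1 z₀.2.2 (x + c)) ^ 2 +
        (flowV (z i).1 (z i).2.1 (z i).2.2 (x + c) - flowV z₀.1 z₀.2.1 z₀.2.2 (x + c)) ^ 2))
      l (𝓝 0) := by
  have h0 : (0 : ℝ) = ∫ x in α..β, (0 : ℝ) := by simp
  rw [h0]
  refine intervalIntegral.tendsto_integral_filter_of_dominated_convergence
    (fun _ => 2 * (flowBound z₀ + 1) + 2 * flowBound z₀) ?_ ?_ (by simp) ?_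
  · refine Eventually.of_forall fun i => Continuous.aestronglyMeasurable ?_
    have h₁ := isSol_flow (z i).1 (z i).2.1 (z i).2.2
    have h₂ := isSol_flow z₀.1 z₀.2.1 z₀.2.2
    have := h₁.continuous_left
    have := h₁.continuous_right
    have := h₂.continuous_left
    have := h₂.continuous_right
    fun_prop
  · have hB : ∀ᶠ i in l, flowBound (z i) < flowBound z₀ + 1 :=
      ((continuous_flowBound.tendsto z₀).comp hz).eventually (gt_mem_nhds (by linarith))
    filter_upwards [hB] with i hi
    refine Eventually.of_forall fun x _ => ?_
    rw [norm_of_nonneg (by positivity)]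
    have h₁ := flow_sq_le (z i) (x + c)
    have h₂ := flow_sq_le z₀ (x + c)
    nlinarith [sq_nonneg (flowU (z i).1 (z i).2.1 (z i).2.2 (x + c) +
      flowU z₀.1 z₀.2.1 z₀.2.2 (x + c)), sq_nonneg (flowV (z i).1 (z i).2.1 (z i).2.2 (x + c) +
      flowV z₀.1 z₀.2.1 z₀.2.2 (x + c))]
  · refine Eventually.of_forall fun x _ => ?_
    have hF := (((contDiff_flowMap (x + c)).continuous.tendsto z₀).comp hz)
    have hU := (continuous_fst.comp continuous_snd).continuousAt.tendsto.comp hF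
    have hV := (continuous_snd.comp continuous_snd).continuousAt.tendsto.comp hF
    have := ((hU.sub_const (flowU z₀.1 z₀.2.1 z₀.2.2 (x + c))).pow 2).add
      ((hV.sub_const (flowV z₀.1 z₀.2.1 z₀.2.2 (x + c))).pow 2)
    simpa [flowMap] using this

lemma deriv_flowU_comp_add (Λ a b c : ℝ) :
    deriv (fun x => flowU Λ a b (x + c)) = fun x => flowV Λ a b (x + c) :=
  ((isSol_flow Λ a b).comp_add c).deriv_left

/-- Continuous data give rise to a continuous family. -/
lemma h1ContinuousOn_waveOf {L : ℝ} {S : Set ℝ} {a b₁ b₃ : ℝ → ℝ} (ha : ContinuousOn a S)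
    (hb₁ : ContinuousOn b₁ S) (hb₃ : ContinuousOn b₃ S) :
    H1ContinuousOn L S fun Λ => waveOf L Λ (a Λ) (b₁ Λ) (b₃ Λ) := by
  intro Λ₁ h₁
  have hid : Tendsto (fun Λ : ℝ => Λ) (𝓝[S] Λ₁) (𝓝 Λ₁) := tendsto_id.mono_left nhdsWithin_le_nhds
  have z₂ := hid.prodMk_nhds ((ha Λ₁ h₁).prodMk_nhds (tendsto_const_nhds (x := (0 : ℝ))))
  have z₁ := hid.prodMk_nhds ((ha Λ₁ h₁).prodMk_nhds (hb₁ Λ₁ h₁))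
  have hc := (continuous_fst.comp continuous_snd).continuousAt.tendsto.comp
    (((contDiff_flowMap (2 * L)).continuous.tendsto _).comp z₂)
  have z₃ := hid.prodMk_nhds (hc.prodMk_nhds (hb₃ Λ₁ h₁))
  have := ((tendsto_integral_flow z₁ (-π) (-π) π).add (tendsto_integral_flow z₂ L (-L) L)).add
    (tendsto_integral_flow z₃ (-π) (-π) π)
  simp only [add_zero] at this
  refine this.congr fun Λ => ?_
  simp only [h1DistSq, waveOf, sub_eq_add_neg _ π, deriv_flowU_comp_add]
  rfl


/-! ### Energies of labels as functions of the frequency -/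

namespace Label

variable {r Λ Λ' : ℝ}

/-- The frequency below which a label other than `int 0` occurs. -/
noncomputable def threshold (r : ℝ) : Label → ℝ
  | .lam => 0
  | .int n => if 0 < n then (n : ℝ) ^ 2 * (2 * π / r) ^ 2 else -((n : ℝ) ^ 2 * (2 * π / r) ^ 2 / 2)

lemma valid_zero : (Label.int 0).Valid r Λ :=
  ⟨fun h => absurd h (lt_irrefl _), fun h => absurd h (lt_irrefl _)⟩

lemma threshold_pos {n : ℤ} (hn : 0 < n) :
    (Label.int n).threshold r = (n : ℝ) ^ 2 * (2 * π / r) ^ 2 := by simp [threshold, hn]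

lemma threshold_neg {n : ℤ} (hn : n < 0) :
    (Label.int n).threshold r = -((n : ℝ) ^ 2 * (2 * π / r) ^ 2 / 2) := by
  simp [threshold, hn.le]

lemma valid_iff {l : Label} : l.Valid r Λ ↔ l = .int 0 ∨ Λ < l.threshold r := by
  rcases l with n | _
  · rcases lt_trichotomy n 0 with hn | rfl | hn
    · simp [Valid, threshold_neg hn, hn, hn.le, hn.ne]
    · simp [valid_zero]
    · simp [Valid, threshold_pos hn, hn, hn.le, hn.ne']
  · simp [Valid, threshold]

lemma Valid.mono {l : Label} (h : l.Valid r Λ) (hΛ : Λ' ≤ Λ) : l.Valid r Λ' := by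
  rw [valid_iff] at *
  exact h.imp_right fun h => hΛ.trans_lt h

lemma Valid.exists_gt {l : Label} (h : l.Valid r Λ) : ∃ ε > 0, ∀ Λ' < Λ + ε, l.Valid r Λ' := by
  rw [valid_iff] at h
  rcases h with rfl | h
  · exact ⟨1, one_pos, fun _ _ => valid_zero⟩
  · exact ⟨l.threshold r - Λ, by linarith, fun Λ' h' => valid_iff.2 (Or.inr (by linarith))⟩

/-- The threshold itself is included although the label is not valid there: this is the frequency at
which a new branch meets the old one. -/
lemma continuousOn_energy (hr : 0 < r) (l : Label) :
    ContinuousOn (l.energy r) {Λ | l = .int 0 ∨ Λ ≤ l.threshold r} := by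
  rcases l with n | _
  · rcases lt_trichotomy n 0 with hn | rfl | hn
    · have hn' : (0 : ℝ) < -n := by
        have : (n : ℝ) < 0 := by exact_mod_cast hn
        linarith
      have h₁ : (Label.int n).energy r = dnEnergy (r / -n) := funext fun _ => energy_neg_eq hn
      rw [h₁]
      refine (continuousOn_dnEnergy _).mono ?_
      rintro Λ (h | h)
      · injection h with h; omega
      · rw [threshold_neg hn] at h
        rcases h.lt_or_eq with h | h
        · exact ((threshold_dn hr hn').1.2 (by rwa [neg_sq])).le
        · exact ((threshold_dn hr hn').2.2 (by rwa [neg_sq])).ge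
    · have : (Label.int 0).energy r = fun _ => 0 := funext fun _ => energy_zero
      rw [this]; fun_prop
    · have hn' : (0 : ℝ) < n := by exact_mod_cast hn
      have h₁ : (Label.int n).energy r = cnEnergy (r / n) := funext fun _ => energy_pos_eq hn
      rw [h₁]
      refine (continuousOn_cnEnergy _).mono ?_
      rintro Λ (h | h)
      · injection h with h; omega
      · rw [threshold_pos hn] at h
        rcases h.lt_or_eq with h | h
        · exact ((threshold_cn hr hn').1.2 h).le
        · exact ((threshold_cn hr hn').2.2 h).le
  · have : Label.lam.energy r = fun Λ => -Λ ^ 2 / 4 := funext fun _ => energy_lam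
    rw [this]; fun_prop

lemma Valid.mem {l : Label} (h : l.Valid r Λ) : l = .int 0 ∨ Λ ≤ l.threshold r :=
  (valid_iff.1 h).imp_right le_of_lt

/-- The label `l` emerges from the label `k` as the frequency decreases through `Λ`, or is `k`. -/
def Emerges (r Λ : ℝ) (l k : Label) : Prop :=
  l = k ∧ l.Valid r Λ ∨ l ≠ .int 0 ∧ Λ = l.threshold r ∧ l.energy r Λ = k.energy r Λ

namespace Emerges

variable {l k : Label}

lemma energy_eq (h : Emerges r Λ l k) : l.energy r Λ = k.energy r Λ := by
  rcases h with ⟨rfl, _⟩ | ⟨_, _, h⟩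
  · rfl
  · exact h

lemma valid_of_lt (h : Emerges r Λ l k) (hΛ : Λ' < Λ) : l.Valid r Λ' := by
  rcases h with ⟨_, h⟩ | ⟨_, h, _⟩
  · exact h.mono hΛ.le
  · exact valid_iff.2 (Or.inr (h ▸ hΛ))

lemma continuousOn (h : Emerges r Λ l k) (hr : 0 < r) : ContinuousOn (l.energy r) (Iic Λ) := by
  refine (continuousOn_energy hr l).mono fun Λ' hΛ' => ?_
  rcases h with ⟨_, h⟩ | ⟨_, h, _⟩
  · exact (h.mono hΛ').mem
  · exact Or.inr (h ▸ hΛ')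

lemma refl (h : l.Valid r Λ) : Emerges r Λ l l := Or.inl ⟨rfl, h⟩

lemma of_pos (hr : 0 < r) {n : ℤ} (hn : 0 < n) (hΛ : Λ = (n : ℝ) ^ 2 * (2 * π / r) ^ 2) :
    Emerges r Λ (.int n) (.int 0) := by
  refine Or.inr ⟨fun h => by injection h with h; omega, by rw [threshold_pos hn, hΛ], ?_⟩
  rw [energy_pos_eq hn, energy_zero]
  exact cnEnergy_threshold ((threshold_cn hr (by exact_mod_cast hn)).2.2 hΛ)

lemma of_neg (hr : 0 < r) {n : ℤ} (hn : 0 < n) (hΛ : Λ = -((n : ℝ) ^ 2 * (2 * π / r) ^ 2 / 2)) :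
    Emerges r Λ (.int (-n)) .lam := by
  have hn' : (0 : ℝ) < n := by exact_mod_cast hn
  refine Or.inr ⟨fun h => by injection h with h; omega, ?_, ?_⟩
  · rw [threshold_neg (by omega), hΛ]; push_cast; ring
  · rw [energy_neg_eq (by omega), energy_lam]
    push_cast
    rw [neg_neg]
    exact dnEnergy_threshold (by positivity) ((threshold_dn hr hn').2.2 hΛ)

lemma lam_zero : Emerges r 0 .lam (.int 0) :=
  Or.inr ⟨fun h => by injection h, rfl, by simp⟩

end Emerges

end Label

/-! ### Types of standing waves -/

/-- The frequencies at which a type occurs. -/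
structure Triple.Admissible (L Λ : ℝ) (t : Triple) : Prop where
  valid₁ : t.n₁.Valid (2 * π) Λ
  valid₂ : t.m.Valid (4 * L) Λ
  valid₃ : t.n₃.Valid (2 * π) Λ
  le₁ : t.m.energy (4 * L) Λ ≤ t.n₁.energy (2 * π) Λ
  le₃ : t.m.energy (4 * L) Λ ≤ t.n₃.energy (2 * π) Λ
  zero : t.n₁ = .int 0 ∨ t.n₃ = .int 0 → t.m = .int 0

open Classical in
/-- The greatest value on an edge with the given label. -/
noncomputable def Label.topValue (r Λ : ℝ) (l : Label) : ℝ :=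
  if l = .int 0 then 0 else √((-Λ + √(Λ ^ 2 + 4 * l.energy r Λ)) / 2)

section Types

variable {L Λ Λ₀ : ℝ} {t s : Triple} {Φ Φ₀ : GraphFun}

/-- The square of the greatest value is the larger root y of y² + Λy = E. -/
lemma energy_topValue {r : ℝ} (hr : 0 < r) {l : Label} (h : l.Valid r Λ) :
    energy Λ (l.topValue r Λ) 0 = l.energy r Λ := by
  by_cases h0 : l = .int 0
  · subst h0; simp [Label.topValue, energy]
  · have hE := l.energy_ge hr h
    have hD : 0 ≤ Λ ^ 2 + 4 * l.energy r Λ := by linarith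
    have hS := sq_sqrt hD
    have hS0 := sqrt_nonneg (Λ ^ 2 + 4 * l.energy r Λ)
    set S := √(Λ ^ 2 + 4 * l.energy r Λ)
    have hy : 0 ≤ (-Λ + S) / 2 := by
      by_cases hΛ : Λ ≤ 0
      · linarith
      · have hp : 0 ≤ l.energy r Λ := by
          push Not at hΛ
          rcases l with n | _
          · rcases lt_trichotomy n 0 with hn | hn | hn
            · exact absurd (Label.lam_neg_of_valid hr hn h) (not_lt.2 hΛ.le)
            · exact absurd (congrArg _ hn) h0
            · exact (Label.energy_int_pos hr hn h).le
          · exact absurd h (not_lt.2 hΛ.le)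
        nlinarith
    rw [Label.topValue, if_neg h0, energy]
    have := sq_sqrt hy
    set q := √((-Λ + S) / 2)
    have e4 : q ^ 4 = (q ^ 2) ^ 2 := by ring
    rw [e4, this]
    linear_combination hS / 4

/-- Energy differences prescribe the squared velocities at the vertices. All three signs are left
free so that a branch can be matched to a given wave. -/
lemma Triple.Admissible.typeData (hL : 0 < L) (h : t.Admissible L Λ) {σ σ₁ σ₃ : ℝ}
    (hσ : σ ^ 2 = 1) (hσ₁ : σ₁ ^ 2 = 1) (hσ₃ : σ₃ ^ 2 = 1) :
    TypeData L Λ t (σ * t.m.topValue (4 * L) Λ)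
      (σ₁ * √(t.n₁.energy (2 * π) Λ - t.m.energy (4 * L) Λ))
      (σ₃ * √(t.n₃.energy (2 * π) Λ - t.m.energy (4 * L) Λ)) := by
  refine ⟨h.valid₁, h.valid₂, h.valid₃, ?_, ?_, ?_, ?_⟩
  · rw [mul_pow, hσ₁, sq_sqrt (by linarith [h.le₁])]; ring
  · rw [← energy_topValue (by positivity) h.valid₂, energy, energy]
    have : σ ^ 4 = 1 := by rw [show σ ^ 4 = (σ ^ 2) ^ 2 by ring, hσ]; norm_num
    simp only [mul_pow, hσ, this, one_mul]
  · rw [mul_pow, hσ₃, sq_sqrt (by linarith [h.le₃])]; ring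
  · intro h0
    have hm : t.m = .int 0 := by
      rcases h0 with h0 | h0 | h0
      · exact h.zero (Or.inl h0)
      · exact h0
      · exact h.zero (Or.inr h0)
    rw [hm]; simp [Label.topValue]

lemma Triple.Admissible.exists_hasType (hL : 0 < L) (h : t.Admissible L Λ) :
    ∃ Φ, HasType L Λ Φ t :=
  ⟨_, ((h.typeData hL (one_pow 2) (one_pow 2) (one_pow 2)).hasType hL).1⟩

lemma TypeData.admissible {a b₁ b₃ : ℝ} (hL : 0 < L) (h : TypeData L Λ t a b₁ b₃) :
    t.Admissible L Λ := by
  refine ⟨h.valid₁, h.valid₂, h.valid₃, by linarith [h.energy₁, sq_nonneg b₁],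
    by linarith [h.energy₃, sq_nonneg b₃], fun h0 => ?_⟩
  have ha : a = 0 := h.zero (h0.imp_right Or.inr)
  refine Label.eq_of_energy_eq (by positivity) h.valid₂ Label.valid_zero ?_
  rw [← h.energy₂, ha, Label.energy_zero, energy]; ring

lemma exists_sign_mul {x y : ℝ} (h : x ^ 2 = y ^ 2) : ∃ σ : ℝ, σ ^ 2 = 1 ∧ x = σ * y := by
  rcases sq_eq_sq_iff_eq_or_eq_neg.1 h with h | h
  · exact ⟨1, by norm_num, by linarith⟩
  · exact ⟨-1, by norm_num, by linarith⟩

lemma exists_sign_mul_sqrt {x y : ℝ} (h : x ^ 2 = y) : ∃ σ : ℝ, σ ^ 2 = 1 ∧ x = σ * √y := by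
  refine exists_sign_mul ?_
  rw [sq_sqrt (h ▸ sq_nonneg x), h]

/-- A branch of standing waves of type `t` through a given one of type `s`. -/
lemma HasType.exists_branch (hL : 0 < L) (h : HasType L Λ₀ Φ₀ s) {S : Set ℝ} (h₀ : Λ₀ ∈ S)
    (hc₁ : ContinuousOn (t.n₁.energy (2 * π)) S) (hc₂ : ContinuousOn (t.m.energy (4 * L)) S)
    (hc₃ : ContinuousOn (t.n₃.energy (2 * π)) S)
    (he₁ : t.n₁.energy (2 * π) Λ₀ = s.n₁.energy (2 * π) Λ₀)
    (he₂ : t.m.energy (4 * L) Λ₀ = s.m.energy (4 * L) Λ₀)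
    (he₃ : t.n₃.energy (2 * π) Λ₀ = s.n₃.energy (2 * π) Λ₀)
    (hm : s.m = .int 0 ∧ (t.m = .int 0 ∨ 0 ≤ Λ₀) ∨ s.m = .lam ∧ t.m ≠ .int 0)
    (hadm : ∀ Λ ∈ S, Λ ≠ Λ₀ → t.Admissible L Λ) :
    ∃ Φ : ℝ → GraphFun, Φ Λ₀ = Φ₀ ∧ H1ContinuousOn L S Φ ∧
      ∀ Λ ∈ S, Λ ≠ Λ₀ → HasType L Λ (Φ Λ) t := by
  obtain ⟨a, b₁, b₃, hd, hΦ⟩ := h.exists_typeData hL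
  -- The signs of the given wave are read off at Λ₀ and kept along the branch.
  obtain ⟨σ₁, hσ₁, hb₁⟩ := exists_sign_mul_sqrt (x := b₁)
    (y := t.n₁.energy (2 * π) Λ₀ - t.m.energy (4 * L) Λ₀) (by rw [he₁, he₂, ← hd.energy₁]; ring)
  obtain ⟨σ₃, hσ₃, hb₃⟩ := exists_sign_mul_sqrt (x := b₃)
    (y := t.n₃.energy (2 * π) Λ₀ - t.m.energy (4 * L) Λ₀) (by rw [he₃, he₂, ← hd.energy₃]; ring)
  -- The amplitude must match at Λ₀. Beside a zero centre in s, either the centre of t is zero too,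
  -- or its energy is 0 with Λ₀ ≥ 0 and its greatest value is √((-Λ₀ + |Λ₀|)/2) = 0. Otherwise the
  -- energy is minimal and the greatest value is that of the constant.
  obtain ⟨σ, hσ, ha⟩ : ∃ σ : ℝ, σ ^ 2 = 1 ∧ a = σ * t.m.topValue (4 * L) Λ₀ := by
    rcases hm with ⟨hs, ht | ht⟩ | ⟨hs, ht⟩
    · refine ⟨1, one_pow 2, ?_⟩
      rw [hd.zero (Or.inr (Or.inl hs)), ht]; simp [Label.topValue]
    · refine ⟨1, one_pow 2, ?_⟩
      rw [hd.zero (Or.inr (Or.inl hs)), Label.topValue, he₂, hs]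
      simp [sqrt_sq ht]
    · have h₂ := hd.energy₂
      rw [hs, Label.energy_lam] at h₂
      have h₃ := (sq_eq_of_energy_min h₂).1
      rw [Label.topValue, if_neg ht, he₂, hs, Label.energy_lam,
        show Λ₀ ^ 2 + 4 * (-Λ₀ ^ 2 / 4) = 0 by ring, sqrt_zero, add_zero]
      exact exists_sign_mul_sqrt (by linarith)
  have hcσ : ContinuousOn (fun Λ => σ * t.m.topValue (4 * L) Λ) S := by
    unfold Label.topValue
    split_ifs
    · fun_prop
    · fun_prop
  -- The value at Λ₀ is replaced by Φ₀, since `waveOf` agrees with it only on the edges.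
  refine ⟨fun Λ => if Λ = Λ₀ then Φ₀ else waveOf L Λ (σ * t.m.topValue (4 * L) Λ)
      (σ₁ * √(t.n₁.energy (2 * π) Λ - t.m.energy (4 * L) Λ))
      (σ₃ * √(t.n₃.energy (2 * π) Λ - t.m.energy (4 * L) Λ)), if_pos rfl, ?_, ?_⟩
  · refine (h1ContinuousOn_waveOf hcσ (((hc₁.sub hc₂).sqrt).const_smul σ₁)
      (((hc₃.sub hc₂).sqrt).const_smul σ₃)).congr hL fun Λ hΛ => ?_
    simp only [smul_eq_mul, Pi.smul_apply, Pi.sub_apply]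
    split_ifs with h
    · subst h
      rw [← ha, ← hb₁, ← hb₃]
      exact hΦ
    · exact ⟨fun _ _ => rfl, fun _ _ => rfl, fun _ _ => rfl⟩
  · intro Λ hΛ hne
    simp only [if_neg hne]
    exact (((hadm Λ hΛ hne).typeData hL hσ hσ₁ hσ₃).hasType hL).1

/-- The types from which others bifurcate: those that are constant on the central edge. -/
def Triple.Base (t : Triple) : Prop :=
  t.m = .int 0 ∧ (∃ n : ℤ, 0 ≤ n ∧ t.n₁ = .int n) ∧ (∃ n : ℤ, 0 ≤ n ∧ t.n₃ = .int n) ∨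
    t.m = .lam ∧ t.n₁ ≠ .int 0 ∧ t.n₃ ≠ .int 0

lemma Label.energy_int_nonneg {r : ℝ} (hr : 0 < r) {n : ℤ} (hn : 0 ≤ n)
    (h : (Label.int n).Valid r Λ) : 0 ≤ (Label.int n).energy r Λ := by
  rcases hn.eq_or_lt with rfl | hn
  · simp
  · exact (energy_int_pos hr hn h).le

/-- A constant centre has the least energy available: 0 beside labels n ≥ 0, and -Λ²/4 in general.
-/
lemma Triple.Base.admissible (h : t.Base) (h₁ : t.n₁.Valid (2 * π) Λ)
    (h₂ : t.m.Valid (4 * L) Λ) (h₃ : t.n₃.Valid (2 * π) Λ) : t.Admissible L Λ := by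
  rcases h with ⟨hm, ⟨n, hn, e₁⟩, ⟨k, hk, e₃⟩⟩ | ⟨hm, e₁, e₃⟩
  · refine ⟨h₁, h₂, h₃, ?_, ?_, fun _ => hm⟩
    · rw [hm, Label.energy_zero, e₁]
      exact Label.energy_int_nonneg (by positivity) hn (e₁ ▸ h₁)
    · rw [hm, Label.energy_zero, e₃]
      exact Label.energy_int_nonneg (by positivity) hk (e₃ ▸ h₃)
  · refine ⟨h₁, h₂, h₃, ?_, ?_, fun h => by simp_all⟩
    · rw [hm]; exact Label.energy_ge (by positivity) h₁
    · rw [hm]; exact Label.energy_ge (by positivity) h₃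

/-- Bifurcation of types from the behaviour of the labels. -/
theorem bifurcatesFrom_of_emerges (hL : 0 < L) (h₁ : Label.Emerges (2 * π) Λ₀ t.n₁ s.n₁)
    (h₂ : Label.Emerges (4 * L) Λ₀ t.m s.m) (h₃ : Label.Emerges (2 * π) Λ₀ t.n₃ s.n₃)
    (hnew : ¬ (t.n₁.Valid (2 * π) Λ₀ ∧ t.m.Valid (4 * L) Λ₀ ∧ t.n₃.Valid (2 * π) Λ₀))
    (hs : s.Base) (hv₁ : s.n₁.Valid (2 * π) Λ₀)
    (hv₂ : s.m.Valid (4 * L) Λ₀) (hv₃ : s.n₃.Valid (2 * π) Λ₀)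
    (hm : s.m = .int 0 ∧ (t.m = .int 0 ∨ 0 ≤ Λ₀) ∨ s.m = .lam ∧ t.m ≠ .int 0)
    (ht : ∀ Λ < Λ₀, t.Admissible L Λ) : BifurcatesFrom L Λ₀ t s := by
  have hπ : (0 : ℝ) < 2 * π := by positivity
  have hL4 : 0 < 4 * L := by positivity
  refine ⟨fun Λ hΛ Φ h => ?_, (hs.admissible hv₁ hv₂ hv₃).exists_hasType hL, fun Φ₀ h => ⟨?_, ?_⟩⟩
  · obtain ⟨a, b₁, b₃, hd, -⟩ := h.exists_typeData hL
    -- Validity of a label is inherited by smaller frequencies, so absence at Λ₀ gives absence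
    -- above.
    exact hnew ⟨hd.valid₁.mono hΛ, hd.valid₂.mono hΛ, hd.valid₃.mono hΛ⟩
  · obtain ⟨ε₁, hε₁, w₁⟩ := hv₁.exists_gt
    obtain ⟨ε₂, hε₂, w₂⟩ := hv₂.exists_gt
    obtain ⟨ε₃, hε₃, w₃⟩ := hv₃.exists_gt
    set ε := min ε₁ (min ε₂ ε₃)
    have hε : 0 < ε := lt_min hε₁ (lt_min hε₂ hε₃)
    have k₁ : ε ≤ ε₁ := min_le_left _ _
    have k₂ : ε ≤ ε₂ := (min_le_right _ _).trans (min_le_left _ _)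
    have k₃ : ε ≤ ε₃ := (min_le_right _ _).trans (min_le_right _ _)
    have w : ∀ Λ ∈ Ioo (Λ₀ - ε) (Λ₀ + ε), s.n₁.Valid (2 * π) Λ ∧ s.m.Valid (4 * L) Λ ∧
        s.n₃.Valid (2 * π) Λ := fun Λ hΛ =>
      ⟨w₁ Λ (by linarith [hΛ.2]), w₂ Λ (by linarith [hΛ.2]), w₃ Λ (by linarith [hΛ.2])⟩
    have hm' : s.m = .int 0 ∧ (s.m = .int 0 ∨ 0 ≤ Λ₀) ∨ s.m = .lam ∧ s.m ≠ .int 0 := by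
      rcases hs with ⟨h, _⟩ | ⟨h, _⟩
      · exact Or.inl ⟨h, Or.inl h⟩
      · exact Or.inr ⟨h, by simp [h]⟩
    obtain ⟨Ψ, e, hc, hΨ⟩ := h.exists_branch (t := s) (S := Ioo (Λ₀ - ε) (Λ₀ + ε)) hL
      ⟨by linarith, by linarith⟩
      ((Label.continuousOn_energy hπ _).mono fun Λ hΛ => (w Λ hΛ).1.mem)
      ((Label.continuousOn_energy hL4 _).mono fun Λ hΛ => (w Λ hΛ).2.1.mem)
      ((Label.continuousOn_energy hπ _).mono fun Λ hΛ => (w Λ hΛ).2.2.mem) rfl rfl rfl hm'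
      (fun Λ hΛ _ => hs.admissible (w Λ hΛ).1 (w Λ hΛ).2.1 (w Λ hΛ).2.2)
    refine ⟨ε, hε, Ψ, e, hc, fun Λ hΛ => ?_⟩
    by_cases hne : Λ = Λ₀
    · rw [hne, e]; exact h
    · exact hΨ Λ hΛ hne
  · obtain ⟨Ψ, e, hc, hΨ⟩ := h.exists_branch (t := t) (S := Iic Λ₀) hL (mem_Iic.2 le_rfl)
      (h₁.continuousOn hπ) (h₂.continuousOn hL4) (h₃.continuousOn hπ) h₁.energy_eq h₂.energy_eq
      h₃.energy_eq hm (fun Λ hΛ hne => ht Λ (lt_of_le_of_ne hΛ hne))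
    exact ⟨Ψ, e, hc, fun Λ hΛ => hΨ Λ hΛ.le hΛ.ne⟩

end Types


/-! ### The list of bifurcations -/

section Table

variable {L Λ Λ₀ : ℝ} {t s : Triple} {Φ : GraphFun}

/-- Longer periods have lower energy, so this compares the loop period 2π/n with the central period
4L/m. -/
lemma Label.centre_cn_le_iff (hL : 0 < L) {n m : ℤ} (hn : 0 < n) (hm : 0 < m)
    (hvn : (Label.int n).Valid (2 * π) Λ) (hvm : (Label.int m).Valid (4 * L) Λ) :
    (Label.int m).energy (4 * L) Λ ≤ (Label.int n).energy (2 * π) Λ ↔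
      (m : ℝ) ≤ 2 * L * n / π := by
  have hn' : (0 : ℝ) < n := by exact_mod_cast hn
  have hm' : (0 : ℝ) < m := by exact_mod_cast hm
  rw [Label.energy_cn_le_iff (by positivity) (by positivity) hn hm hvn hvm,
    div_le_div_iff₀ hn' hm', le_div_iff₀ pi_pos]
  constructor <;> intro h <;> linarith

/-- For dn the order of the energies is reversed, so the condition compares the thresholds of the
two labels. -/
lemma Label.centre_dn_le_iff (hL : 0 < L) {n m : ℤ} (hn : n < 0) (hm : 0 < m)
    (hvn : (Label.int n).Valid (2 * π) Λ) (hvm : (Label.int (-m)).Valid (4 * L) Λ) :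
    (Label.int (-m)).energy (4 * L) Λ ≤ (Label.int n).energy (2 * π) Λ ↔
      (n : ℝ) ^ 2 ≤ (m : ℝ) ^ 2 * LamStar L := by
  have hn' : (0 : ℝ) < -n := by
    have : (n : ℝ) < 0 := by exact_mod_cast hn
    linarith
  have hm' : (0 : ℝ) < m := by exact_mod_cast hm
  rw [Label.energy_dn_le_iff (by positivity) (by positivity) hn (by omega) hvn hvm]
  push_cast
  rw [neg_neg, div_le_div_iff₀ hm' hn', LamStar, ← mul_pow, ← neg_sq (n : ℝ),
    pow_le_pow_iff_left₀ hn'.le (by positivity) two_ne_zero, ← mul_div_assoc,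
    le_div_iff₀ (by positivity)]
  constructor <;> intro h <;> linarith

lemma loop_threshold (x : ℝ) : x ^ 2 * (2 * π / (2 * π)) ^ 2 = x ^ 2 := by
  rw [div_self (by positivity)]; ring

lemma lamStar_pos (hL : 0 < L) : 0 < LamStar L := by unfold LamStar; positivity

lemma Label.Valid.loop_pos {n : ℤ} (hn : 0 < n) (h : Λ < (n : ℝ) ^ 2) :
    (Label.int n).Valid (2 * π) Λ :=
  Label.valid_loop_int.2 ⟨fun _ => h, fun h => absurd h (not_lt.2 hn.le)⟩

lemma Label.Valid.loop_neg {n : ℤ} (hn : n < 0) (h : Λ < -((n : ℝ) ^ 2 / 2)) :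
    (Label.int n).Valid (2 * π) Λ :=
  Label.valid_loop_int.2 ⟨fun h => absurd h (not_lt.2 hn.le), fun _ => h⟩

lemma Label.not_valid_loop_pos {n : ℤ} (hn : 0 < n) : ¬ (Label.int n).Valid (2 * π) ((n : ℝ) ^ 2) :=
  fun h => lt_irrefl _ ((Label.valid_loop_int.1 h).1 hn)

lemma Label.not_valid_loop_neg {n : ℤ} (hn : 0 < n) :
    ¬ (Label.int (-n)).Valid (2 * π) (-((n : ℝ) ^ 2 / 2)) := fun h => by
  have := (Label.valid_loop_int.1 h).2 (by omega)
  push_cast at this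
  rw [neg_sq] at this
  exact lt_irrefl _ this

lemma Label.Emerges.loop_pos {n : ℤ} (hn : 0 < n) :
    Label.Emerges (2 * π) ((n : ℝ) ^ 2) (.int n) (.int 0) :=
  .of_pos (by positivity) hn (loop_threshold _).symm

lemma Label.Emerges.loop_neg {n : ℤ} (hn : 0 < n) :
    Label.Emerges (2 * π) (-((n : ℝ) ^ 2 / 2)) (.int (-n)) .lam :=
  .of_neg (by positivity) hn (by rw [loop_threshold])

lemma Label.Emerges.zero_left {r : ℝ} : Label.Emerges r Λ (.int 0) (.int 0) := .refl valid_zero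

lemma sq_lt_sq_int {n k : ℤ} (hn : 0 < n) (h : n < k) : (n : ℝ) ^ 2 < (k : ℝ) ^ 2 := by
  have h₁ : (0 : ℝ) < n := by exact_mod_cast hn
  have h₂ : (n : ℝ) < k := by exact_mod_cast h
  nlinarith

/-- The condition for `n` to be the label of a loop beside a central edge with label `-m`. -/
def LoopCondition (L : ℝ) (m n : ℤ) : Prop :=
  0 < n ∨ (n < 0 ∧ -((m : ℝ) ^ 2 * LamStar L / 2) < -((n : ℝ) ^ 2 / 2))

lemma LoopCondition.valid {m n : ℤ} (hL : 0 < L) (h : LoopCondition L m n)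
    (hΛ : Λ ≤ -((m : ℝ) ^ 2 * LamStar L / 2)) : (Label.int n).Valid (2 * π) Λ := by
  have := lamStar_pos hL
  have h0 : 0 ≤ (m : ℝ) ^ 2 * LamStar L / 2 := by positivity
  rcases h with hn | ⟨hn, h⟩
  · have hn' : (0 : ℝ) < n := by exact_mod_cast hn
    exact .loop_pos hn (by nlinarith)
  · exact .loop_neg hn (by linarith)

lemma LoopCondition.ne {m n : ℤ} (h : LoopCondition L m n) : Label.int n ≠ .int 0 := by
  intro h0
  injection h0 with h0
  rcases h with h | h <;> omega

lemma valid_centre_neg {m : ℤ} (hm : 0 < m) (hΛ : Λ < -((m : ℝ) ^ 2 * LamStar L / 2)) :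
    (Label.int (-m)).Valid (4 * L) Λ := by
  refine Label.valid_centre_int.2 ⟨fun h => by omega, fun _ => ?_⟩
  push_cast; rwa [neg_sq]

lemma LoopCondition.energy_le {m n : ℤ} (hL : 0 < L) (hm : 0 < m) (h : LoopCondition L m n)
    (hΛ : Λ < -((m : ℝ) ^ 2 * LamStar L / 2)) :
    (Label.int (-m)).energy (4 * L) Λ ≤ (Label.int n).energy (2 * π) Λ := by
  have v₁ := h.valid hL hΛ.le
  have v₂ := valid_centre_neg hm hΛ
  rcases h with hn | ⟨hn, h⟩
  · exact ((Label.energy_int_neg (by positivity) (by omega) v₂).1.trans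
      (Label.energy_int_pos (by positivity) hn v₁)).le
  · exact (Label.centre_dn_le_iff hL hn hm v₁ v₂).2 (by linarith)

lemma admissible_dnCentre {n₁ m n₃ : ℤ} (hL : 0 < L) (hm : 0 < m) (h₁ : LoopCondition L m n₁)
    (h₃ : LoopCondition L m n₃) (hΛ : Λ < -((m : ℝ) ^ 2 * LamStar L / 2)) :
    Triple.Admissible L Λ ⟨.int n₁, .int (-m), .int n₃⟩ :=
  ⟨h₁.valid hL hΛ.le, valid_centre_neg hm hΛ, h₃.valid hL hΛ.le, h₁.energy_le hL hm hΛ,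
    h₃.energy_le hL hm hΛ, by rintro (h | h); exacts [absurd h h₁.ne, absurd h h₃.ne]⟩

lemma valid_lam {r : ℝ} (h : Λ < 0) : Label.lam.Valid r Λ := h

lemma lam_ne {n : ℤ} : Label.lam ≠ .int n := fun h => by injection h

lemma int_ne {n k : ℤ} (h : n ≠ k) : Label.int n ≠ .int k := fun e => h (by injection e)

lemma bifurcates_cnBothLoops (hL : 0 < L) {n : ℤ} (hn : 0 < n) :
    BifurcatesFrom L ((n : ℝ) ^ 2) ⟨.int n, .int 0, .int n⟩ ⟨.int 0, .int 0, .int 0⟩ := by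
  refine bifurcatesFrom_of_emerges hL (.loop_pos hn) .zero_left (.loop_pos hn)
    (fun h => Label.not_valid_loop_pos hn h.1) (Or.inl ⟨rfl, ⟨0, le_rfl, rfl⟩, ⟨0, le_rfl, rfl⟩⟩)
    Label.valid_zero Label.valid_zero Label.valid_zero (Or.inl ⟨rfl, Or.inl rfl⟩) fun Λ hΛ => ?_
  exact Triple.Base.admissible (Or.inl ⟨rfl, ⟨n, hn.le, rfl⟩, ⟨n, hn.le, rfl⟩⟩)
    (.loop_pos hn hΛ) Label.valid_zero (.loop_pos hn hΛ)

lemma bifurcates_cnOneLoop (hL : 0 < L) {n : ℤ} (hn : 0 < n) :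
    BifurcatesFrom L ((n : ℝ) ^ 2) ⟨.int n, .int 0, .int 0⟩ ⟨.int 0, .int 0, .int 0⟩ := by
  refine bifurcatesFrom_of_emerges hL (.loop_pos hn) .zero_left .zero_left
    (fun h => Label.not_valid_loop_pos hn h.1) (Or.inl ⟨rfl, ⟨0, le_rfl, rfl⟩, ⟨0, le_rfl, rfl⟩⟩)
    Label.valid_zero Label.valid_zero Label.valid_zero (Or.inl ⟨rfl, Or.inl rfl⟩) fun Λ hΛ => ?_
  exact Triple.Base.admissible (Or.inl ⟨rfl, ⟨n, hn.le, rfl⟩, ⟨0, le_rfl, rfl⟩⟩)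
    (.loop_pos hn hΛ) Label.valid_zero Label.valid_zero

lemma bifurcates_cnSecondLoop (hL : 0 < L) {n₁ n₃ : ℤ} (h₁ : 0 < n₁) (h₃ : n₁ < n₃) :
    BifurcatesFrom L ((n₁ : ℝ) ^ 2) ⟨.int n₁, .int 0, .int n₃⟩ ⟨.int 0, .int 0, .int n₃⟩ := by
  have hn₃ := h₁.trans h₃
  have v₃ : (Label.int n₃).Valid (2 * π) ((n₁ : ℝ) ^ 2) := .loop_pos hn₃ (sq_lt_sq_int h₁ h₃)
  refine bifurcatesFrom_of_emerges hL (.loop_pos h₁) .zero_left (.refl v₃)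
    (fun h => Label.not_valid_loop_pos h₁ h.1)
    (Or.inl ⟨rfl, ⟨0, le_rfl, rfl⟩, ⟨n₃, hn₃.le, rfl⟩⟩)
    Label.valid_zero Label.valid_zero v₃ (Or.inl ⟨rfl, Or.inl rfl⟩) fun Λ hΛ => ?_
  exact Triple.Base.admissible (Or.inl ⟨rfl, ⟨n₁, h₁.le, rfl⟩, ⟨n₃, hn₃.le, rfl⟩⟩)
    (.loop_pos h₁ hΛ) Label.valid_zero (v₃.mono hΛ.le)

lemma bifurcates_cnCentre (hL : 0 < L) {n₁ m n₃ : ℤ} (hm : 0 < m)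
    (h₁ : (m : ℝ) < 2 * L * n₁ / π) (h₃ : (m : ℝ) < 2 * L * n₃ / π) :
    BifurcatesFrom L ((m : ℝ) ^ 2 * LamStar L)
      ⟨.int n₁, .int m, .int n₃⟩ ⟨.int n₁, .int 0, .int n₃⟩ := by
  have hm' : (0 : ℝ) < m := by exact_mod_cast hm
  have key : ∀ {n : ℤ}, (m : ℝ) < 2 * L * n / π →
      0 < n ∧ (Label.int n).Valid (2 * π) ((m : ℝ) ^ 2 * LamStar L) := by
    intro n h
    rw [lt_div_iff₀ pi_pos] at h
    have hn' : (0 : ℝ) < n := by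
      by_contra hcon
      push Not at hcon
      nlinarith [mul_pos hm' pi_pos]
    have hn : 0 < n := by exact_mod_cast hn'
    refine ⟨hn, .loop_pos hn ?_⟩
    -- The condition m < 2Ln/π says m²Λ* < n²: the loops are already present when the central label
    -- emerges.
    rw [LamStar, ← mul_pow]
    refine pow_lt_pow_left₀ ?_ (by positivity) two_ne_zero
    rw [← mul_div_assoc, div_lt_iff₀ (by positivity)]
    linarith
  obtain ⟨hn₁, v₁⟩ := key h₁
  obtain ⟨hn₃, v₃⟩ := key h₃
  have hE : Label.Emerges (4 * L) ((m : ℝ) ^ 2 * LamStar L) (.int m) (.int 0) :=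
    .of_pos (by positivity) hm (by rw [two_pi_div_four_mul])
  refine bifurcatesFrom_of_emerges hL (.refl v₁) hE (.refl v₃)
    (fun h => lt_irrefl _ ((Label.valid_centre_int.1 h.2.1).1 hm))
    (Or.inl ⟨rfl, ⟨n₁, hn₁.le, rfl⟩, ⟨n₃, hn₃.le, rfl⟩⟩)
    v₁ Label.valid_zero v₃ (Or.inl ⟨rfl, Or.inr ?_⟩) fun Λ hΛ => ?_
  · have := lamStar_pos hL
    positivity
  · have w₁ := v₁.mono hΛ.le
    have w₃ := v₃.mono hΛ.le
    have w₂ := hE.valid_of_lt hΛ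
    refine ⟨w₁, w₂, w₃, (Label.centre_cn_le_iff hL hn₁ hm w₁ w₂).2 h₁.le,
      (Label.centre_cn_le_iff hL hn₃ hm w₃ w₂).2 h₃.le, ?_⟩
    rintro (h | h)
    · exact absurd h (int_ne hn₁.ne')
    · exact absurd h (int_ne hn₃.ne')

lemma Label.Emerges.besideConst {n : ℤ} (hn : 0 ≤ n) :
    Label.Emerges (2 * π) 0 (Label.besideConst n) (.int n) ∧ Label.besideConst n ≠ .int 0 ∧
      (Label.int n).Valid (2 * π) 0 := by
  rw [Label.besideConst]
  split_ifs with h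
  · subst h; exact ⟨.lam_zero, lam_ne, valid_zero⟩
  · have h' : (0 : ℝ) < (n : ℝ) ^ 2 := by positivity
    have v : (Label.int n).Valid (2 * π) 0 := .loop_pos (by omega) h'
    exact ⟨.refl v, int_ne h, v⟩

lemma bifurcates_constCentre (hL : 0 < L) {n₁ n₃ : ℤ} (h₁ : 0 ≤ n₁) (h₃ : 0 ≤ n₃) :
    BifurcatesFrom L 0 ⟨.besideConst n₁, .lam, .besideConst n₃⟩ ⟨.int n₁, .int 0, .int n₃⟩ := by
  obtain ⟨e₁, z₁, v₁⟩ := Label.Emerges.besideConst h₁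
  obtain ⟨e₃, z₃, v₃⟩ := Label.Emerges.besideConst h₃
  refine bifurcatesFrom_of_emerges hL e₁ .lam_zero e₃ (fun h => lt_irrefl (0 : ℝ) h.2.1)
    (Or.inl ⟨rfl, ⟨n₁, h₁, rfl⟩, ⟨n₃, h₃, rfl⟩⟩) v₁ Label.valid_zero v₃
    (Or.inl ⟨rfl, Or.inr le_rfl⟩) fun Λ hΛ => ?_
  exact Triple.Base.admissible (Or.inr ⟨rfl, z₁, z₃⟩) (e₁.valid_of_lt hΛ) hΛ (e₃.valid_of_lt hΛ)

lemma bifurcates_dnCentre (hL : 0 < L) {n₁ m n₃ : ℤ} (hm : 0 < m) (h₁ : LoopCondition L m n₁)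
    (h₃ : LoopCondition L m n₃) :
    BifurcatesFrom L (-((m : ℝ) ^ 2 * LamStar L / 2))
      ⟨.int n₁, .int (-m), .int n₃⟩ ⟨.int n₁, .lam, .int n₃⟩ := by
  have hm' : (0 : ℝ) < m := by exact_mod_cast hm
  have := lamStar_pos hL
  have hneg : -((m : ℝ) ^ 2 * LamStar L / 2) < 0 := neg_neg_of_pos (by positivity)
  have v₁ := h₁.valid hL le_rfl
  have v₃ := h₃.valid hL le_rfl
  have hE : Label.Emerges (4 * L) (-((m : ℝ) ^ 2 * LamStar L / 2)) (.int (-m)) .lam :=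
    .of_neg (by positivity) hm (by rw [two_pi_div_four_mul])
  refine bifurcatesFrom_of_emerges hL (.refl v₁) hE (.refl v₃) (fun h => ?_)
    (Or.inr ⟨rfl, h₁.ne, h₃.ne⟩) v₁ hneg v₃ (Or.inr ⟨rfl, int_ne (by omega)⟩)
    fun Λ hΛ => admissible_dnCentre hL hm h₁ h₃ hΛ
  have := (Label.valid_centre_int.1 h.2.1).2 (by omega)
  push_cast at this
  rw [neg_sq] at this
  exact lt_irrefl _ this

lemma neg_sq_div_two_neg {n : ℤ} (hn : 0 < n) : -((n : ℝ) ^ 2 / 2) < 0 := by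
  have hn' : (0 : ℝ) < n := by exact_mod_cast hn
  exact neg_neg_of_pos (by positivity)

lemma bifurcates_dnLoops (hL : 0 < L) {n : ℤ} {l k : Label} (hn : 0 < n)
    (hE : Label.Emerges (2 * π) (-((n : ℝ) ^ 2 / 2)) l k)
    (hv : k.Valid (2 * π) (-((n : ℝ) ^ 2 / 2))) (hl : l ≠ .int 0) (hk : k ≠ .int 0) :
    BifurcatesFrom L (-((n : ℝ) ^ 2 / 2)) ⟨.int (-n), .lam, l⟩ ⟨.lam, .lam, k⟩ := by
  have hneg := neg_sq_div_two_neg hn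
  refine bifurcatesFrom_of_emerges hL (.loop_neg hn) (.refl hneg) hE
    (fun h => Label.not_valid_loop_neg hn h.1) (Or.inr ⟨rfl, lam_ne, hk⟩)
    hneg hneg hv (Or.inr ⟨rfl, lam_ne⟩) fun Λ hΛ => ?_
  exact Triple.Base.admissible (Or.inr ⟨rfl, int_ne (by omega), hl⟩)
    ((Label.Emerges.loop_neg hn).valid_of_lt hΛ) (valid_lam (hΛ.trans hneg)) (hE.valid_of_lt hΛ)

lemma bifurcates_dnSecondLoop (hL : 0 < L) {n₁ n₃ : ℤ} (h₁ : 0 < n₁) (h₃ : -n₁ < n₃)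
    (h : n₃ ≠ 0) : BifurcatesFrom L (-((n₁ : ℝ) ^ 2 / 2))
      ⟨.int (-n₁), .lam, .int n₃⟩ ⟨.lam, .lam, .int n₃⟩ := by
  have hneg := neg_sq_div_two_neg h₁
  have v : (Label.int n₃).Valid (2 * π) (-((n₁ : ℝ) ^ 2 / 2)) := by
    rcases lt_or_gt_of_ne h with hn | hn
    · have := sq_lt_sq_int (n := -n₃) (k := n₁) (by omega) (by omega)
      push_cast at this
      rw [neg_sq] at this
      exact .loop_neg hn (by linarith)
    · exact .loop_pos hn (hneg.trans_le (sq_nonneg _))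
  exact bifurcates_dnLoops hL h₁ (.refl v) v (int_ne h) (int_ne h)

theorem BranchTable.bifurcatesFrom (hL : 0 < L) (h : BranchTable L Λ₀ t s) :
    BifurcatesFrom L Λ₀ t s := by
  cases h with
  | cnBothLoops n hn => exact bifurcates_cnBothLoops hL hn
  | cnOneLoop n hn => exact bifurcates_cnOneLoop hL hn
  | cnSecondLoop n₁ n₃ h₁ h₃ => exact bifurcates_cnSecondLoop hL h₁ h₃
  | cnCentre n₁ m n₃ hm h₁ h₃ => exact bifurcates_cnCentre hL hm h₁ h₃
  | const => exact bifurcates_constCentre hL (n₁ := 0) (n₃ := 0) le_rfl le_rfl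
  | constCentre n₁ n₃ h₁ h₃ => exact bifurcates_constCentre hL h₁ h₃
  | dnCentre n₁ m n₃ hm h₁ h₃ => exact bifurcates_dnCentre hL hm h₁ h₃
  | dnBothLoops n hn =>
    exact bifurcates_dnLoops hL hn (.loop_neg hn) (neg_sq_div_two_neg hn) (int_ne (by omega)) lam_ne
  | dnOneLoop n hn =>
    exact bifurcates_dnLoops hL hn (.refl (neg_sq_div_two_neg hn)) (neg_sq_div_two_neg hn) lam_ne
      lam_ne
  | dnSecondLoop n₁ n₃ h₁ h₃ h => exact bifurcates_dnSecondLoop hL h₁ h₃ h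

/-! ### Completeness of the list -/

lemma Triple.Admissible.loop_nonneg_of_zero {l : Label} (hv : l.Valid (2 * π) Λ)
    (h : 0 ≤ l.energy (2 * π) Λ) : ∃ n : ℤ, 0 ≤ n ∧ l = .int n := by
  rcases l with n | _
  · refine ⟨n, ?_, rfl⟩
    by_contra hcon
    push Not at hcon
    linarith [Label.energy_int_neg (by positivity) hcon hv]
  · exfalso
    have : Λ < 0 := hv
    rw [Label.energy_lam] at h
    nlinarith

/-- The central label decides the case, and the energy inequalities restrict the loop labels.
Equality of a loop period with the central one would be a resonance, so the weak inequalities become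
the strict ones of the list. -/
theorem Triple.Admissible.mem_table (hL : 0 < L) (hres : ∀ n m : ℕ, 0 < n → 2 * L * n ≠ m * π)
    (h : t.Admissible L Λ) : t = ⟨.int 0, .int 0, .int 0⟩ ∨
      ∃ Λ₀ s, BranchTable L Λ₀ t s ∨ BranchTable L Λ₀ t.swap s := by
  obtain ⟨t₁, m, t₃⟩ := t
  obtain ⟨v₁, v₂, v₃, le₁, le₃, hz⟩ := h
  simp only at v₁ v₂ v₃ le₁ le₃ hz
  simp only [Triple.swap]
  rcases m with m | _
  · rcases lt_trichotomy m 0 with hm | rfl | hm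
    · obtain ⟨m, rfl⟩ : ∃ k : ℤ, m = -k := ⟨-m, by ring⟩
      have hm' : 0 < m := by omega
      have key : ∀ l : Label, l.Valid (2 * π) Λ →
          (Label.int (-m)).energy (4 * L) Λ ≤ l.energy (2 * π) Λ → l ≠ .int 0 →
          ∃ n, l = .int n ∧ LoopCondition L m n := by
        intro l hv hle hl
        rcases l with n | _
        · refine ⟨n, rfl, ?_⟩
          rcases lt_trichotomy n 0 with hn | rfl | hn
          · refine Or.inr ⟨hn, ?_⟩
            have h1 := (Label.centre_dn_le_iff hL hn hm' hv v₂).1 hle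
            -- Equality would mean -n = mπ/(2L), a resonance.
            have h2 : (n : ℝ) ^ 2 ≠ (m : ℝ) ^ 2 * LamStar L := by
              intro he
              rw [LamStar, ← mul_pow] at he
              have hm'' : (0 : ℝ) < m := by exact_mod_cast hm'
              have hn' : (0 : ℝ) < -n := by
                have : (n : ℝ) < 0 := by exact_mod_cast hn
                linarith
              rw [← neg_sq (n : ℝ), sq_eq_sq₀ hn'.le (by positivity)] at he
              refine hres n.natAbs m.natAbs (by omega) ?_
              have c₁ : ((n.natAbs : ℕ) : ℝ) = -n := by
                rw [Nat.cast_natAbs, abs_of_neg hn]; push_cast; rfl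
              have c₂ : ((m.natAbs : ℕ) : ℝ) = m := by
                rw [Nat.cast_natAbs, abs_of_pos hm']
              rw [c₁, c₂, he]
              field_simp
            have := lt_of_le_of_ne h1 h2
            linarith
          · exact absurd rfl hl
          · exact Or.inl hn
        · exfalso
          have := (Label.energy_int_neg (by positivity) hm v₂).2
          rw [Label.energy_lam] at hle
          linarith
      obtain ⟨n₁, rfl, c₁⟩ := key t₁ v₁ le₁ fun h => by simp [h] at hz; omega
      obtain ⟨n₃, rfl, c₃⟩ := key t₃ v₃ le₃ fun h => by simp [h] at hz; omega
      exact Or.inr ⟨_, _, Or.inl (.dnCentre n₁ m n₃ hm' c₁ c₃)⟩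
    · rw [Label.energy_zero] at le₁ le₃
      obtain ⟨n₁, h₁, rfl⟩ := Triple.Admissible.loop_nonneg_of_zero v₁ le₁
      obtain ⟨n₃, h₃, rfl⟩ := Triple.Admissible.loop_nonneg_of_zero v₃ le₃
      rcases h₁.eq_or_lt with rfl | h₁ <;> rcases h₃.eq_or_lt with rfl | h₃
      · exact Or.inl rfl
      · exact Or.inr ⟨_, _, Or.inr (.cnOneLoop n₃ h₃)⟩
      · exact Or.inr ⟨_, _, Or.inl (.cnOneLoop n₁ h₁)⟩
      · rcases lt_trichotomy n₁ n₃ with h | rfl | h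
        · exact Or.inr ⟨_, _, Or.inl (.cnSecondLoop n₁ n₃ h₁ h)⟩
        · exact Or.inr ⟨_, _, Or.inl (.cnBothLoops n₁ h₁)⟩
        · exact Or.inr ⟨_, _, Or.inr (.cnSecondLoop n₃ n₁ h₃ h)⟩
    · have hE := Label.energy_int_pos (by positivity) hm v₂
      have key : ∀ l : Label, l.Valid (2 * π) Λ →
          (Label.int m).energy (4 * L) Λ ≤ l.energy (2 * π) Λ →
          ∃ n : ℤ, l = .int n ∧ (m : ℝ) < 2 * L * n / π := by
        intro l hv hle
        obtain ⟨n, hn, rfl⟩ := Triple.Admissible.loop_nonneg_of_zero hv (hE.le.trans hle)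
        refine ⟨n, rfl, ?_⟩
        rcases hn.eq_or_lt with rfl | hn
        · rw [Label.energy_zero] at hle; linarith
        · refine lt_of_le_of_ne ((Label.centre_cn_le_iff hL hn hm hv v₂).1 hle) fun he => ?_
          rw [eq_div_iff pi_ne_zero] at he
          refine hres n.natAbs m.natAbs (by omega) ?_
          have c₁ : ((n.natAbs : ℕ) : ℝ) = n := by
            rw [Nat.cast_natAbs, abs_of_pos hn]
          have c₂ : ((m.natAbs : ℕ) : ℝ) = m := by
            rw [Nat.cast_natAbs, abs_of_pos hm]
          rw [c₁, c₂, he]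
      obtain ⟨n₁, rfl, c₁⟩ := key t₁ v₁ le₁
      obtain ⟨n₃, rfl, c₃⟩ := key t₃ v₃ le₃
      exact Or.inr ⟨_, _, Or.inl (.cnCentre n₁ m n₃ hm c₁ c₃)⟩
  · have hz₁ : t₁ ≠ .int 0 := fun h => lam_ne (hz (Or.inl h))
    have hz₃ : t₃ ≠ .int 0 := fun h => lam_ne (hz (Or.inr h))
    refine Or.inr ?_
    have key : ∀ l : Label, l ≠ .int 0 →
        (∃ n : ℤ, 0 < n ∧ l = .int (-n)) ∨ ∃ n : ℤ, 0 ≤ n ∧ l = .besideConst n := by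
      intro l hl
      rcases l with n | _
      · rcases lt_trichotomy n 0 with hn | rfl | hn
        · exact Or.inl ⟨-n, by omega, by rw [neg_neg]⟩
        · exact absurd rfl hl
        · exact Or.inr ⟨n, hn.le, by rw [Label.besideConst, if_neg hn.ne']⟩
      · exact Or.inr ⟨0, le_rfl, rfl⟩
    have mixed : ∀ n : ℤ, 0 < n → ∀ k : ℤ, 0 ≤ k →
        ∃ Λ₀ s, BranchTable L Λ₀ ⟨.int (-n), .lam, .besideConst k⟩ s := by
      intro n hn k hk
      rw [Label.besideConst]
      split_ifs with h
      · exact ⟨_, _, .dnOneLoop n hn⟩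
      · exact ⟨_, _, .dnSecondLoop n k hn (by omega) h⟩
    rcases key t₁ hz₁ with ⟨n, hn, rfl⟩ | ⟨n, hn, rfl⟩ <;>
      rcases key t₃ hz₃ with ⟨k, hk, rfl⟩ | ⟨k, hk, rfl⟩
    · rcases lt_trichotomy n k with h | rfl | h
      · exact ⟨_, _, Or.inr (.dnSecondLoop k (-n) hk (by omega) (by omega))⟩
      · exact ⟨_, _, Or.inl (.dnBothLoops n hn)⟩
      · exact ⟨_, _, Or.inl (.dnSecondLoop n (-k) hn (by omega) (by omega))⟩
    · obtain ⟨Λ₀, s, h⟩ := mixed n hn k hk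
      exact ⟨Λ₀, s, Or.inl h⟩
    · obtain ⟨Λ₀, s, h⟩ := mixed k hk n hn
      exact ⟨Λ₀, s, Or.inr h⟩
    · exact ⟨_, _, Or.inl (.constCentre n k hn hk)⟩

lemma HasType.admissible (hL : 0 < L) (h : HasType L Λ Φ t) : t.Admissible L Λ := by
  obtain ⟨a, b₁, b₃, hd, -⟩ := h.exists_typeData hL
  exact hd.admissible hL

end Table


/-! ### Symmetries of the graph -/

lemma onGraph_eq_iff {L : ℝ} {Φ Ψ : GraphFun} :
    Φ.onGraph L = Ψ.onGraph L ↔ EdgewiseEq L Φ Ψ := by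
  simp only [GraphFun.onGraph, Prod.mk.injEq, domRestrict_eq_domRestrict_iff, EdgewiseEq]

/-- Equality on an edge up to reversal. -/
def EqOrRev (ℓ : ℝ) (f g : ℝ → ℝ) : Prop :=
  EqOn f g (Icc (-ℓ) ℓ) ∨ EqOn f (fun x => g (-x)) (Icc (-ℓ) ℓ)

lemma neg_mem_Icc' {ℓ x : ℝ} (hx : x ∈ Icc (-ℓ) ℓ) : -x ∈ Icc (-ℓ) ℓ :=
  ⟨by linarith [hx.2], by linarith [hx.1]⟩

lemma EqOrRev.trans_eq {ℓ : ℝ} {f f' g : ℝ → ℝ} (h : EqOn f' f (Icc (-ℓ) ℓ)) (h' : EqOrRev ℓ f g) :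
    EqOrRev ℓ f' g := h'.imp h.trans h.trans

lemma EqOrRev.rev {ℓ : ℝ} {f g : ℝ → ℝ} (h : EqOrRev ℓ f g) : EqOrRev ℓ (fun x => f (-x)) g :=
  h.elim (fun h => Or.inr fun _ hx => h (neg_mem_Icc' hx))
    fun h => Or.inl fun x hx => by simpa using h (neg_mem_Icc' hx)

lemma EqOrRev.refl (ℓ : ℝ) (f : ℝ → ℝ) : EqOrRev ℓ f f := Or.inl fun _ _ => rfl

/-- The functions related to `Φ` by a symmetry, by their edges. -/
lemma SymmetryRelated.edges {L : ℝ} {Φ Ψ : GraphFun} (h : SymmetryRelated L Φ Ψ) :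
    (EqOrRev π Ψ.e₁ Φ.e₁ ∧ EqOn Ψ.e₂ Φ.e₂ (Icc (-L) L) ∧ EqOrRev π Ψ.e₃ Φ.e₃) ∨
    (EqOrRev π Ψ.e₁ Φ.e₃ ∧ EqOn Ψ.e₂ (fun x => Φ.e₂ (-x)) (Icc (-L) L) ∧
      EqOrRev π Ψ.e₃ Φ.e₁) := by
  induction h with
  | refl => exact Or.inl ⟨.refl _ _, fun _ _ => rfl, .refl _ _⟩
  | tail _ hs ih =>
    simp only [onGraph_eq_iff] at hs
    rcases hs with ⟨a₁, a₂, a₃⟩ | ⟨a₁, a₂, a₃⟩ | ⟨a₁, a₂, a₃⟩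
    · rcases ih with ⟨b₁, b₂, b₃⟩ | ⟨b₁, b₂, b₃⟩
      · exact Or.inl ⟨b₁.rev.trans_eq a₁, a₂.trans b₂, b₃.trans_eq a₃⟩
      · exact Or.inr ⟨b₁.rev.trans_eq a₁, a₂.trans b₂, b₃.trans_eq a₃⟩
    · rcases ih with ⟨b₁, b₂, b₃⟩ | ⟨b₁, b₂, b₃⟩
      · exact Or.inr ⟨b₃.trans_eq a₁, a₂.trans fun _ hx => b₂ (neg_mem_Icc' hx), b₁.trans_eq a₃⟩
      · refine Or.inl ⟨b₃.trans_eq a₁, a₂.trans fun x hx => ?_, b₁.trans_eq a₃⟩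
        have := b₂ (neg_mem_Icc' hx)
        simp only [neg_neg] at this
        exact this
    · rcases ih with ⟨b₁, b₂, b₃⟩ | ⟨b₁, b₂, b₃⟩
      · exact Or.inl ⟨b₁.trans_eq a₁, a₂.trans b₂, b₃.rev.trans_eq a₃⟩
      · exact Or.inr ⟨b₁.trans_eq a₁, a₂.trans b₂, b₃.rev.trans_eq a₃⟩

section Related

variable {L Λ : ℝ} {Φ Φ' : GraphFun} {m n₁ n₃ : ℤ}

/-- Reversal of the edge changes the sign of the velocity only, hence preserves the energy, hence
the label. -/
lemma SolvesOnEdge.label_eq_of_eqOrRev {φ ψ : ℝ → ℝ} {l k : Label} (h : SolvesOnEdge Λ π φ)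
    (hl : EdgeHasLabel Λ π 1 φ l) (hk : EdgeHasLabel Λ π 1 ψ k) (he : EqOrRev π ψ φ) : l = k := by
  have hr : 2 * π = 1 * (2 * π) := by ring
  obtain ⟨u, v, hs, hu⟩ := h.exists_isSol pi_pos (_root_.exists_isSol Λ)
  have a := hl.elim pi_pos one_pos hr hs hu
  rcases he with he | he
  · have b := hk.elim pi_pos one_pos hr hs (he.trans hu)
    exact Label.eq_of_energy_eq (by positivity) a.1 b.1 ((a.2.1 0).symm.trans (b.2.1 0))
  · have b := hk.elim pi_pos one_pos hr hs.comp_neg (he.trans fun x hx => hu (neg_mem_Icc' hx))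
    refine Label.eq_of_energy_eq (by positivity) a.1 b.1 ((a.2.1 0).symm.trans ?_)
    rw [← b.2.1 0]
    simp [energy]

/-- The velocity vanishes at both ends. With equal end values 2L would be a period, hence jT for an
integer j; but 2L = mT/2, so m = 2j. -/
lemma HasType.ne_reverse_of_odd (hL : 0 < L) (hm : 0 < m) (hodd : Odd m)
    (h : HasType L Λ Φ ⟨.int n₁, .int (-m), .int n₃⟩) : Φ.e₂ (-L) ≠ Φ.e₂ L := by
  intro he
  have hm' : (0 : ℝ) < m := by exact_mod_cast hm
  obtain ⟨a, b₁, b₃, hd, -, hΦ, -⟩ := h.exists_typeData hL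
  have hn := (hd.hasType hL).2
  have hs := (extends_waveOf L Λ a b₁ b₃).sol₂
  rcases h.2.2.1 with ⟨h0, -⟩ | ⟨h0, -⟩ | ⟨-, T, ψ, hψ, hφ, hT⟩
  · omega
  · omega
  · obtain ⟨v, hsol, hT0, -⟩ := hψ.exists_isSol
    obtain ⟨e₁, e₂⟩ := hsol.eq_of_eqOn hL hs (hφ.symm.trans hΦ)
    have p : Function.Periodic ψ (2 * L) := by
      refine (hsol.periodic_of_eq (x := -L) ?_ ?_).1
      · rw [show -L + 2 * L = L by ring, ← hφ (left_mem_Icc' hL), ← hφ (right_mem_Icc' hL), he]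
      · rw [show -L + 2 * L = L by ring, e₂]
        simp [← two_mul, hn]
    obtain ⟨j, hj, hLj⟩ := hψ.eq_mul_of_periodic (by positivity) p
    push_cast at hT
    rw [abs_neg, abs_of_pos hm', hLj] at hT
    have h2 : (2 * j : ℝ) = m := by
      apply mul_right_cancel₀ hT0.ne'; linarith
    have h3 : 2 * j = m := by exact_mod_cast h2
    exact (Int.not_even_iff_odd.2 hodd) ⟨j, by omega⟩

/-- A symmetry that keeps the two loops in place preserves their distinct labels. One that exchanges
them reverses the central edge, whose end values would then coincide. -/
theorem not_symmetryRelated (hL : 0 < L) (hm : 0 < m) (hodd : Odd m) (hne : n₁ ≠ n₃)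
    (h : HasType L Λ Φ ⟨.int n₁, .int (-m), .int n₃⟩)
    (h' : HasType L Λ Φ' ⟨.int n₃, .int (-m), .int n₁⟩) (he : EqOn Φ.e₂ Φ'.e₂ (Icc (-L) L)) :
    ¬ SymmetryRelated L Φ Φ' := by
  intro hrel
  rcases hrel.edges with ⟨h₁, -, -⟩ | ⟨-, h₂, -⟩
  · exact int_ne hne (h.1.eq₁.label_eq_of_eqOrRev h.2.1 h'.2.1 h₁)
  · refine h.ne_reverse_of_odd hL hm hodd ?_
    rw [he (left_mem_Icc' hL), h₂ (left_mem_Icc' hL)]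
    simp only [neg_neg]

lemma exists_reordered (hL : 0 < L) (hm : 0 < m) (h₁ : LoopCondition L m n₁)
    (h₃ : LoopCondition L m n₃) (hΛ : Λ < -((m : ℝ) ^ 2 * LamStar L / 2)) :
    ∃ Φ Φ' : GraphFun, HasType L Λ Φ ⟨.int n₁, .int (-m), .int n₃⟩ ∧
      HasType L Λ Φ' ⟨.int n₃, .int (-m), .int n₁⟩ ∧ EqOn Φ.e₂ Φ'.e₂ (Icc (-L) L) :=
  ⟨_, _, (((admissible_dnCentre hL hm h₁ h₃ hΛ).typeData hL (one_pow 2) (one_pow 2)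
      (one_pow 2)).hasType hL).1,
    (((admissible_dnCentre hL hm h₃ h₁ hΛ).typeData hL (one_pow 2) (one_pow 2)
      (one_pow 2)).hasType hL).1, fun _ _ => rfl⟩

end Related

lemma hasType_zero {L Λ : ℝ} (hL : 0 < L) :
    ∃ Φ, HasType L Λ Φ ⟨.int 0, .int 0, .int 0⟩ :=
  Triple.Admissible.exists_hasType hL <| Triple.Base.admissible
    (Or.inl ⟨rfl, ⟨0, le_rfl, rfl⟩, ⟨0, le_rfl, rfl⟩⟩) Label.valid_zero Label.valid_zero
    Label.valid_zero


/-! ### The phase of a solution of positive energy -/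

lemma cn_param_unique {Λ E κ β : ℝ} (hκ : κ ∈ Ioo (0 : ℝ) 1) (hβ : 0 < β)
    (hΛ : β ^ 2 * (1 - 2 * κ ^ 2) = Λ) (hE : E = κ ^ 2 * β ^ 4 * (1 - κ ^ 2)) :
    cnKappa Λ E = κ ∧ cnBeta Λ E = β := by
  have h₁ : Λ ^ 2 + 4 * E = (β ^ 2) ^ 2 := by rw [hE, ← hΛ]; ring
  have h₂ : √(Λ ^ 2 + 4 * E) = β ^ 2 := by rw [h₁, sqrt_sq (by positivity)]
  rw [cnKappa, cnBeta, h₂, sqrt_sq hβ.le]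
  refine ⟨?_, rfl⟩
  rw [← hΛ, mul_div_cancel_left₀ _ (by positivity),
    show (1 - (1 - 2 * κ ^ 2)) / 2 = κ ^ 2 by ring, sqrt_sq hκ.1.le]

lemma cnBeta_pow_four {Λ E : ℝ} (hE : 0 < E) : cnBeta Λ E ^ 4 = Λ ^ 2 + 4 * E := by
  rw [cnBeta, show √√(Λ ^ 2 + 4 * E) ^ 4 = (√√(Λ ^ 2 + 4 * E) ^ 2) ^ 2 by ring,
    sq_sqrt (sqrt_nonneg _), sq_sqrt (by positivity)]

/-- The number of half-periods, counted from a maximum, that a solution with initial data `(a, b)`,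
`b ≤ 0`, has gone through at time `t`. -/
noncomputable def cnPhase (Λ t : ℝ) (z : ℝ × ℝ) : ℝ :=
  (ellipticF (cnKappa Λ (energy Λ z.1 z.2))
      (arccos (z.1 / (cnKappa Λ (energy Λ z.1 z.2) * cnBeta Λ (energy Λ z.1 z.2)))) +
    cnBeta Λ (energy Λ z.1 z.2) * t) / (2 * ellipticK (cnKappa Λ (energy Λ z.1 z.2)))

lemma continuous_energy (Λ : ℝ) : Continuous fun z : ℝ × ℝ => energy Λ z.1 z.2 := by
  unfold energy; fun_prop

lemma continuousOn_cnBeta (Λ : ℝ) : ContinuousOn (cnBeta Λ) (Ioi 0) := by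
  unfold cnBeta; fun_prop

lemma continuousOn_cnKappa (Λ : ℝ) : ContinuousOn (cnKappa Λ) (Ioi 0) := by
  unfold cnKappa
  refine ContinuousOn.sqrt (ContinuousOn.div_const (continuousOn_const.sub
    (continuousOn_const.div (by fun_prop) fun E hE => ?_)) 2)
  have : (0 : ℝ) < E := hE
  positivity

lemma cnKappa_sq_lt_one {Λ E : ℝ} (hE : 0 < E) : cnKappa Λ E ^ 2 < 1 :=
  sq_lt_one_of_mem_Ico (Ioo_subset_Ico_self (cn_param_of_energy hE).1)

lemma continuousOn_cnPhase (Λ t : ℝ) :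
    ContinuousOn (cnPhase Λ t) {z | 0 < energy Λ z.1 z.2} := by
  have hE : ContinuousOn (fun z : ℝ × ℝ => energy Λ z.1 z.2) {z | 0 < energy Λ z.1 z.2} :=
    (continuous_energy Λ).continuousOn
  have hκ := (continuousOn_cnKappa Λ).comp hE fun _ h => h
  have hβ := (continuousOn_cnBeta Λ).comp hE fun _ h => h
  have hφ : ContinuousOn (fun z : ℝ × ℝ => arccos (z.1 / (cnKappa Λ (energy Λ z.1 z.2) *
      cnBeta Λ (energy Λ z.1 z.2)))) {z | 0 < energy Λ z.1 z.2} := by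
    refine continuous_arccos.comp_continuousOn
      (continuous_fst.continuousOn.div (hκ.mul hβ) fun z hz => ?_)
    have h := cn_param_of_energy (Λ := Λ) hz
    exact (mul_pos h.1.1 h.2.1).ne'
  have hF := continuousOn_ellipticF.comp (hκ.prodMk hφ) fun z hz => cnKappa_sq_lt_one hz
  have hK := continuousOn_ellipticK.comp hκ fun z hz => cnKappa_sq_lt_one hz
  refine (hF.add (hβ.mul continuousOn_const)).div (continuousOn_const.mul hK) fun z hz => ?_
  have := ellipticK_pos (cnKappa_sq_lt_one (Λ := Λ) hz)
  exact (mul_pos two_pos this).ne'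

/-- The hypothesis b ≤ 0 makes the arccosine the correct initial phase. Integral phases are critical
points of the solution and half-integral ones its zeros. -/
lemma flow_eq_of_cnPhase {Λ a b t φ : ℝ} (hE : 0 < energy Λ a b) (hb : b ≤ 0)
    (hφ : ellipticF (cnKappa Λ (energy Λ a b)) φ =
      cnPhase Λ t (a, b) * (2 * ellipticK (cnKappa Λ (energy Λ a b)))) :
    (cos φ = 0 → flowU Λ a b t = 0) ∧ (sin φ = 0 → flowV Λ a b t = 0) := by
  obtain ⟨hκ, hβ, hΛ, hEκ⟩ := cn_param_of_energy (Λ := Λ) hE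
  have hκ1 := cnKappa_sq_lt_one (Λ := Λ) hE
  have hK := ellipticK_pos hκ1
  simp only [cnPhase] at hφ
  rw [div_mul_cancel₀ _ (by positivity)] at hφ
  set κ := cnKappa Λ (energy Λ a b)
  set β := cnBeta Λ (energy Λ a b)
  have hE' : energy (β ^ 2 * (1 - 2 * κ ^ 2)) a b = κ ^ 2 * β ^ 4 * (1 - κ ^ 2) := by
    rw [hΛ]; exact hEκ
  obtain ⟨h1, h2⟩ := abs_div_le_one_of_energy hκ hβ hE'
  obtain ⟨hu, hv⟩ := cn_data_of_cos_eq hκ hβ hE' (cos_arccos h1 h2)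
    (mul_nonpos_of_nonpos_of_nonneg hb (sin_arccos_nonneg _))
  have hs := isSol_cn hκ1 β (-ellipticF κ (arccos (a / (κ * β))))
  rw [hΛ] at hs
  have hf := hs.eq_flow 0 t
  simp only [hu, hv, zero_add] at hf
  rw [hf.1, hf.2]
  have ham : jacobiAm (β * t - -ellipticF κ (arccos (a / (κ * β)))) κ = φ := by
    rw [sub_neg_eq_add, add_comm, ← hφ, jacobiAm_ellipticF hκ1]
  simp only [jacobiCn, cnVel, ham]
  exact ⟨fun h => by rw [h, mul_zero], fun h => by rw [h]; ring⟩

lemma flowV_eq_zero_of_cnPhase {Λ a b t : ℝ} (hE : 0 < energy Λ a b) (hb : b ≤ 0) {i : ℤ}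
    (h : cnPhase Λ t (a, b) = i) : flowV Λ a b t = 0 := by
  refine (flow_eq_of_cnPhase (φ := i * π) hE hb ?_).2 (sin_int_mul_pi i)
  rw [ellipticF_int_mul_pi (cnKappa_sq_lt_one hE), h]

lemma flowU_eq_zero_of_cnPhase {Λ a b t : ℝ} (hE : 0 < energy Λ a b) (hb : b ≤ 0) {i : ℤ}
    (h : cnPhase Λ t (a, b) = i + 1 / 2) : flowU Λ a b t = 0 := by
  refine (flow_eq_of_cnPhase (φ := π / 2 + i * π) hE hb ?_).1
    (by rw [cos_add_int_mul_pi, cos_pi_div_two, mul_zero])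
  rw [ellipticF_add_int_mul_pi (cnKappa_sq_lt_one hE), h, ellipticK]; ring

/-! ### Even solutions on a loop with a prescribed number of periods -/

/-- The modulus of the cnoidal solutions of period `2π / N`. -/
noncomputable def loopKappa (Λ N : ℝ) : ℝ := cnMod (Λ * (2 * π / N) ^ 2 / 16)

/-- The parameter `β` of the cnoidal solutions of period `2π / N`. -/
noncomputable def loopBeta (Λ N : ℝ) : ℝ := 2 * N * ellipticK (loopKappa Λ N) / π

lemma loop_param {Λ N : ℝ} (hN : 0 < N) (h : Λ < N ^ 2) :
    loopKappa Λ N ∈ Ioo (0 : ℝ) 1 ∧ 0 < loopBeta Λ N ∧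
      loopBeta Λ N ^ 2 * (1 - 2 * loopKappa Λ N ^ 2) = Λ := by
  have h' : Λ * (2 * π / N) ^ 2 / 16 < π ^ 2 / 4 := by
    refine (threshold_cn (r := 2 * π) (by positivity) hN).1.2 ?_
    rwa [loop_threshold]
  obtain ⟨κ, hκ, β, hβ, hΛ, hT⟩ := cn_param_of_lt (T := 2 * π / N) (by positivity) h'
  obtain ⟨-, -, -, hm, -⟩ := cn_param_of_period hκ hβ hΛ hT
  have hκ' : loopKappa Λ N = κ := hm
  have hβ' : loopBeta Λ N = β := by
    rw [loopBeta, hκ']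
    field_simp at hT ⊢
    linarith
  rw [hκ', hβ']
  exact ⟨hκ, hβ, hΛ⟩

lemma continuousOn_loopKappa {Λ N₀ : ℝ} (hN₀ : 0 < N₀) (h : Λ < N₀ ^ 2) :
    ContinuousOn (loopKappa Λ) (Ici N₀) := by
  refine continuousOn_cnMod.comp (f := fun N => Λ * (2 * π / N) ^ 2 / 16)
    (ContinuousOn.div_const (continuousOn_const.mul ((continuousOn_const.div continuousOn_id
      fun N hN => ?_).pow 2)) _) fun N hN => ?_
  · exact (hN₀.trans_le hN).ne'
  · have hN' : N₀ ≤ N := hN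
    refine ((threshold_cn (r := 2 * π) (by positivity) (hN₀.trans_le hN)).1.2 ?_).le
    rw [loop_threshold]
    nlinarith

lemma continuousOn_loopBeta {Λ N₀ : ℝ} (hN₀ : 0 < N₀) (h : Λ < N₀ ^ 2) :
    ContinuousOn (loopBeta Λ) (Ici N₀) := by
  have hK := continuousOn_ellipticK.comp (continuousOn_loopKappa hN₀ h) fun N hN => by
    have hN' : N₀ ≤ N := hN
    exact sq_lt_one_of_mem_Ico (Ioo_subset_Ico_self
      (loop_param (hN₀.trans_le hN') (h.trans_le (by nlinarith))).1)
  exact ((continuousOn_const.mul continuousOn_id).mul hK).div_const _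

/-- This is K ≥ π/2; it makes β, and with it the energy, unbounded in N. -/
lemma le_loopBeta {Λ N : ℝ} (hN : 0 < N) (h : Λ < N ^ 2) : N ≤ loopBeta Λ N := by
  have hK := ellipticK_mono le_rfl (loop_param hN h).1.1.le (loop_param hN h).1.2
  rw [ellipticK_zero] at hK
  rw [loopBeta, le_div_iff₀ pi_pos]
  nlinarith

/-- The even solutions with amplitude `κβ`, at the end of the loop. -/
lemma flow_loop {Λ n δ : ℝ} {k : ℤ} (hn : n = 2 * k) (hN : 0 < n + δ) (h : Λ < (n + δ) ^ 2) :
    flowU Λ (loopKappa Λ (n + δ) * loopBeta Λ (n + δ)) 0 π =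
      loopKappa Λ (n + δ) * loopBeta Λ (n + δ) *
        cos (jacobiAm (2 * δ * ellipticK (loopKappa Λ (n + δ))) (loopKappa Λ (n + δ))) ∧
    flowV Λ (loopKappa Λ (n + δ) * loopBeta Λ (n + δ)) 0 π =
      -(loopKappa Λ (n + δ) * loopBeta Λ (n + δ) ^ 2 *
        (sin (jacobiAm (2 * δ * ellipticK (loopKappa Λ (n + δ))) (loopKappa Λ (n + δ))) *
          jacobiDn (loopBeta Λ (n + δ) * π) (loopKappa Λ (n + δ)))) := by
  obtain ⟨hκ, hβ, hΛ⟩ := loop_param hN h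
  have hβπ : loopBeta Λ (n + δ) * π = 2 * (n + δ) * ellipticK (loopKappa Λ (n + δ)) := by
    rw [loopBeta]; field_simp
  set κ := loopKappa Λ (n + δ)
  set β := loopBeta Λ (n + δ)
  have hκ1 := sq_lt_one_of_mem_Ico (Ioo_subset_Ico_self hκ)
  have hs := isSol_cn hκ1 β 0
  rw [hΛ] at hs
  have hm0 : jacobiAm 0 κ = 0 := by
    have := jacobiAm_ellipticF hκ1 0
    rwa [ellipticF_zero] at this
  have hf := hs.eq_flow 0 π
  simp only [cnVel, jacobiCn, mul_zero, sub_zero, zero_add, hm0, cos_zero, sin_zero, zero_mul,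
    mul_one, neg_zero] at hf
  rw [hf.1, hf.2]
  -- From midpoint to end the loop holds (n + δ)/2 periods; as n = 2k these are k whole periods and
  -- a remainder of argument 2δK.
  have ham : jacobiAm (β * π) κ = jacobiAm (2 * δ * ellipticK κ) κ + k * (2 * π) := by
    rw [hβπ, hn, show 2 * (2 * (k : ℝ) + δ) * ellipticK κ =
      2 * δ * ellipticK κ + ((2 * k : ℤ) : ℝ) * (2 * ellipticK κ) by push_cast; ring,
      jacobiAm_add hκ1]
    push_cast; ring
  rw [ham, cos_add_int_mul_two_pi, sin_add_int_mul_two_pi]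
  exact ⟨rfl, rfl⟩


/-- The data at the vertex, on the central edge, of a standing wave that is even on the first loop
with the value `p` at its midpoint. -/
noncomputable def loopEnd (Λ p : ℝ) : ℝ × ℝ := (flowU Λ p 0 π, 2 * flowV Λ p 0 π)

lemma continuous_flow_loop (Λ : ℝ) :
    Continuous (fun p => flowU Λ p 0 π) ∧ Continuous (fun p => flowV Λ p 0 π) := by
  have h : Continuous fun p : ℝ => flowMap π (Λ, p, 0) :=
    (contDiff_flowMap π).continuous.comp (by fun_prop)
  exact ⟨continuous_fst.comp (continuous_snd.comp h), continuous_snd.comp (continuous_snd.comp h)⟩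

lemma continuous_loopEnd (Λ : ℝ) : Continuous (loopEnd Λ) :=
  (continuous_flow_loop Λ).1.prodMk (continuous_const.mul (continuous_flow_loop Λ).2)

/-- The two ends of an even loop contribute equally to the flux, so the velocity doubles on entering
the central edge and its square gains 3v². -/
lemma energy_loopEnd (Λ p : ℝ) :
    energy Λ (loopEnd Λ p).1 (loopEnd Λ p).2 = energy Λ p 0 + 3 * flowV Λ p 0 π ^ 2 := by
  rw [← energy_flow Λ p 0 π, loopEnd, energy, energy]; ring

/-! ### The phase on the central edge as the number of periods on the loop varies -/

section LoopPhase

variable {Λ ℓ : ℝ}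

/-- The amplitude of the cnoidal solutions of period `2π / N`. -/
noncomputable def loopAmp (Λ N : ℝ) : ℝ := loopKappa Λ N * loopBeta Λ N

lemma energy_loopAmp {N : ℝ} (hN : 0 < N) (h : Λ < N ^ 2) :
    energy Λ (loopAmp Λ N) 0 = loopKappa Λ N ^ 2 * loopBeta Λ N ^ 4 * (1 - loopKappa Λ N ^ 2) ∧
    energy Λ (loopAmp Λ N) 0 = (loopBeta Λ N ^ 4 - Λ ^ 2) / 4 ∧ 0 < energy Λ (loopAmp Λ N) 0 := by
  obtain ⟨hκ, hβ, hΛ⟩ := loop_param hN h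
  have hκ1 := sq_lt_one_of_mem_Ico (Ioo_subset_Ico_self hκ)
  have h₁ : energy Λ (loopAmp Λ N) 0 =
      loopKappa Λ N ^ 2 * loopBeta Λ N ^ 4 * (1 - loopKappa Λ N ^ 2) := by
    rw [energy, loopAmp]; linear_combination (-(loopKappa Λ N * loopBeta Λ N) ^ 2) * hΛ
  refine ⟨h₁, ?_, ?_⟩
  · rw [h₁]; linear_combination (-(loopBeta Λ N ^ 2 * (1 - 2 * loopKappa Λ N ^ 2) + Λ) / 4) * hΛ
  · rw [h₁]
    have := hκ.1
    have : 0 < 1 - loopKappa Λ N ^ 2 := by linarith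
    positivity

lemma energy_loopEnd_pos {N : ℝ} (hN : 0 < N) (h : Λ < N ^ 2) :
    0 < energy Λ (loopEnd Λ (loopAmp Λ N)).1 (loopEnd Λ (loopAmp Λ N)).2 := by
  rw [energy_loopEnd]
  have := (energy_loopAmp hN h).2.2
  positivity

/-- For 0 < δ ≤ 1/2 the loop ends in the first quarter period after a maximum. -/
lemma flowV_loop_neg {n δ : ℝ} {k : ℤ} (hn : n = 2 * k) (hN : 0 < n + δ) (h : Λ < (n + δ) ^ 2)
    (h0 : 0 < δ) (h1 : δ ≤ 1 / 2) : flowV Λ (loopAmp Λ (n + δ)) 0 π < 0 := by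
  obtain ⟨hκ, hβ, hΛ⟩ := loop_param hN h
  have hκ1 := sq_lt_one_of_mem_Ico (Ioo_subset_Ico_self hκ)
  have hK := ellipticK_pos hκ1
  rw [loopAmp, (flow_loop hn hN h).2]
  have hd := jacobiDn_pos hκ1 (loopBeta Λ (n + δ) * π)
  have hmono := strictMono_jacobiAm hκ1
  have e0 := jacobiAm_ellipticF hκ1 0
  have e1 := jacobiAm_ellipticF hκ1 (π / 2)
  rw [ellipticF_zero] at e0
  have h2 : 0 < jacobiAm (2 * δ * ellipticK (loopKappa Λ (n + δ))) (loopKappa Λ (n + δ)) := by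
    rw [← e0]
    exact hmono (by positivity)
  have h3 : jacobiAm (2 * δ * ellipticK (loopKappa Λ (n + δ))) (loopKappa Λ (n + δ)) ≤ π / 2 := by
    conv_rhs => rw [← e1]
    refine hmono.monotone ?_
    change _ ≤ ellipticK _
    nlinarith
  have hs := sin_pos_of_pos_of_lt_pi h2 (by linarith [pi_pos])
  have := hκ.1
  rw [neg_lt_zero]
  positivity

/-- The loop ends at a maximum, so there is no velocity to double: the same oscillation continues on
the central edge, with half-period π/n. -/
lemma cnPhase_loopEnd_even {n : ℝ} {k : ℤ} (hn : n = 2 * k) (hN : 0 < n) (h : Λ < n ^ 2) :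
    flowV Λ (loopAmp Λ n) 0 π = 0 ∧ cnPhase Λ ℓ (loopEnd Λ (loopAmp Λ n)) = n * ℓ / π := by
  obtain ⟨hκ, hβ, hΛ⟩ := loop_param hN h
  have hκ1 := sq_lt_one_of_mem_Ico (Ioo_subset_Ico_self hκ)
  have hK := ellipticK_pos hκ1
  have hf := flow_loop (Λ := Λ) (δ := 0) hn (by linarith) (by simpa using h)
  have e0 := jacobiAm_ellipticF hκ1 0
  rw [ellipticF_zero] at e0
  simp only [add_zero, mul_zero, zero_mul, e0, cos_zero, sin_zero, mul_one, neg_zero] at hf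
  have hE := (energy_loopAmp hN h).1
  obtain ⟨c₁, c₂⟩ := cn_param_unique hκ hβ hΛ hE
  have hz : loopEnd Λ (loopAmp Λ n) = (loopAmp Λ n, 0) := by
    rw [loopEnd, loopAmp, hf.1, hf.2, mul_zero]
  refine ⟨hf.2, ?_⟩
  rw [hz]
  simp only [cnPhase, c₁, c₂]
  have hA : loopKappa Λ n * loopBeta Λ n ≠ 0 := (mul_pos hκ.1 hβ).ne'
  rw [loopAmp, div_self hA, arccos_one, ellipticF_zero]
  nth_rewrite 1 [loopBeta]
  field_simp
  ring

/-- The loop ends at a zero, where the energy is entirely kinetic; doubling the velocity multiplies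
the energy by 4. The phase starts at 1/2. -/
lemma cnPhase_loopEnd_odd {n : ℝ} {k : ℤ} (hn : n = 2 * k) (hN : 0 < n) (h : Λ < n ^ 2) :
    energy Λ (loopEnd Λ (loopAmp Λ (n + 1 / 2))).1 (loopEnd Λ (loopAmp Λ (n + 1 / 2))).2 =
      loopBeta Λ (n + 1 / 2) ^ 4 - Λ ^ 2 ∧
    cnPhase Λ ℓ (loopEnd Λ (loopAmp Λ (n + 1 / 2))) =
      1 / 2 + cnBeta Λ (loopBeta Λ (n + 1 / 2) ^ 4 - Λ ^ 2) * ℓ /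
        (2 * ellipticK (cnKappa Λ (loopBeta Λ (n + 1 / 2) ^ 4 - Λ ^ 2))) := by
  have hN' : 0 < n + 1 / 2 := by linarith
  have h' : Λ < (n + 1 / 2) ^ 2 := by nlinarith
  obtain ⟨hκ, hβ, hΛ⟩ := loop_param hN' h'
  have hκ1 := sq_lt_one_of_mem_Ico (Ioo_subset_Ico_self hκ)
  have hf := (flow_loop (Λ := Λ) (δ := 1 / 2) hn hN' h').1
  have e1 : jacobiAm (2 * (1 / 2) * ellipticK (loopKappa Λ (n + 1 / 2)))
      (loopKappa Λ (n + 1 / 2)) = π / 2 := by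
    rw [show (2 : ℝ) * (1 / 2) = 1 by norm_num, one_mul, ellipticK, jacobiAm_ellipticF hκ1]
  rw [e1, cos_pi_div_two, mul_zero] at hf
  have hE := (energy_loopAmp hN' h').2.1
  have hEp := energy_loopEnd_pos hN' h'
  have hz : (loopEnd Λ (loopAmp Λ (n + 1 / 2))).1 = 0 := hf
  have hE2 : energy Λ (loopEnd Λ (loopAmp Λ (n + 1 / 2))).1 (loopEnd Λ (loopAmp Λ (n + 1 / 2))).2 =
      loopBeta Λ (n + 1 / 2) ^ 4 - Λ ^ 2 := by
    have e := energy_flow Λ (loopAmp Λ (n + 1 / 2)) 0 π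
    rw [hE, loopAmp, hf] at e
    rw [hz, loopEnd, loopAmp]
    simp only [energy] at e ⊢
    linarith
  refine ⟨hE2, ?_⟩
  have hκ2 := cnKappa_sq_lt_one (Λ := Λ) hEp
  have hK := ellipticK_pos hκ2
  rw [hE2] at hK
  rw [cnPhase, hE2, hz, zero_div, arccos_zero, ← ellipticK]
  have : ∀ K B : ℝ, 0 < K → (K + B * ℓ) / (2 * K) = 1 / 2 + B * ℓ / (2 * K) := by
    intro K B h; field_simp
  exact this _ _ hK

lemma sqrt_half_mem : √(1 / 2 : ℝ) ∈ Ico (0 : ℝ) 1 :=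
  ⟨sqrt_nonneg _, by rw [sqrt_lt' one_pos]; norm_num⟩

lemma tendsto_ellipticK_sqrt_half :
    Tendsto ellipticK (𝓝 √(1 / 2 : ℝ)) (𝓝 (ellipticK √(1 / 2 : ℝ))) := by
  refine (continuousOn_ellipticK.continuousAt (IsOpen.mem_nhds ?_ ?_)).tendsto
  · exact isOpen_lt (continuous_id.pow 2) continuous_const
  · exact sq_lt_one_of_mem_Ico sqrt_half_mem

lemma tendsto_loopKappa (Λ : ℝ) : Tendsto (loopKappa Λ) atTop (𝓝 √(1 / 2 : ℝ)) := by
  have h0 : cnMod 0 = √(1 / 2 : ℝ) := by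
    rw [← cnMod_cnFreq sqrt_half_mem, cnFreq, sq_sqrt (by norm_num)]; norm_num
  rw [← h0]
  have h1 : Tendsto (fun N : ℝ => Λ * (2 * π / N) ^ 2 / 16) atTop (𝓝 (Λ * 0 ^ 2 / 16)) :=
    (((tendsto_const_nhds.div_atTop tendsto_id).pow 2).const_mul Λ).div_const 16
  rw [show Λ * 0 ^ 2 / 16 = 0 by ring] at h1
  have hc : ContinuousAt cnMod 0 :=
    continuousOn_cnMod.continuousAt (Iic_mem_nhds (by positivity))
  exact hc.tendsto.comp h1

lemma tendsto_cnKappa (Λ : ℝ) : Tendsto (cnKappa Λ) atTop (𝓝 √(1 / 2 : ℝ)) := by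
  unfold cnKappa
  have h1 : Tendsto (fun E : ℝ => Λ / √(Λ ^ 2 + 4 * E)) atTop (𝓝 0) :=
    tendsto_const_nhds.div_atTop (tendsto_sqrt_atTop.comp
      (tendsto_atTop_add_const_left _ _ (tendsto_id.const_mul_atTop (by norm_num))))
  have h2 := ((h1.const_sub 1).div_const 2).sqrt
  rwa [sub_zero] at h2

lemma tendsto_loopBeta (Λ : ℝ) : Tendsto (loopBeta Λ) atTop atTop := by
  refine tendsto_atTop_mono' _ ?_ tendsto_id
  filter_upwards [eventually_gt_atTop (1 + |Λ|)] with N hN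
  have := abs_nonneg Λ
  have := le_abs_self Λ
  rw [id]
  exact le_loopBeta (by linarith) (by nlinarith)

/-- For large N both moduli tend to √(1/2), so the complete integrals are close to a common value
K₀, while energy 4E in place of E multiplies β by about √2. The factor 11/10 survives because
(5/4)(19/21) > 11/10. -/
lemma eventually_loop_bounds (Λ P : ℝ) : ∀ᶠ N in atTop, 0 < N ∧ Λ < N ^ 2 ∧ P < loopAmp Λ N ∧
    11 / 10 * (2 * N / π) ≤ cnBeta Λ (loopBeta Λ N ^ 4 - Λ ^ 2) /
      ellipticK (cnKappa Λ (loopBeta Λ N ^ 4 - Λ ^ 2)) := by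
  have hK₀ := ellipticK_pos (sq_lt_one_of_mem_Ico sqrt_half_mem)
  set K₀ := ellipticK √(1 / 2 : ℝ)
  have hβ := tendsto_loopBeta Λ
  have hE : Tendsto (fun N => loopBeta Λ N ^ 4 - Λ ^ 2) atTop atTop :=
    tendsto_atTop_add_const_right _ _ ((tendsto_pow_atTop (by norm_num)).comp hβ)
  have h₁ : ∀ᶠ N in atTop, ellipticK (cnKappa Λ (loopBeta Λ N ^ 4 - Λ ^ 2)) < 21 / 20 * K₀ :=
    (tendsto_ellipticK_sqrt_half.comp ((tendsto_cnKappa Λ).comp hE)).eventually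
      (gt_mem_nhds (by linarith))
  have h₂ : ∀ᶠ N in atTop, 19 / 20 * K₀ < ellipticK (loopKappa Λ N) :=
    (tendsto_ellipticK_sqrt_half.comp (tendsto_loopKappa Λ)).eventually
      (lt_mem_nhds (by linarith))
  have h₃ : ∀ᶠ N in atTop, 1 / 2 < loopKappa Λ N :=
    (tendsto_loopKappa Λ).eventually (lt_mem_nhds (by
      rw [lt_sqrt (by norm_num)]; norm_num))
  filter_upwards [h₁, h₂, h₃, hE.eventually_gt_atTop (2 * Λ ^ 2),
    hβ.eventually_gt_atTop (2 * |P|), eventually_gt_atTop (1 + |Λ|)] with N h₁ h₂ h₃ h₄ h₅ h₆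
  have := abs_nonneg Λ
  have := le_abs_self Λ
  have hN : 0 < N := by linarith
  have hΛN : Λ < N ^ 2 := by nlinarith
  have hβ0 := (loop_param hN hΛN).2.1
  have hE0 : 0 < loopBeta Λ N ^ 4 - Λ ^ 2 := lt_of_le_of_lt (by positivity) h₄
  refine ⟨hN, hΛN, ?_, ?_⟩
  · rw [loopAmp]
    nlinarith [le_abs_self P, abs_nonneg P]
  · have hK2 := ellipticK_pos (cnKappa_sq_lt_one (Λ := Λ) hE0)
    have hB := cnBeta_pow_four (Λ := Λ) hE0
    have hBpos := (cn_param_of_energy (Λ := Λ) hE0).2.1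
    rw [le_div_iff₀ hK2]
    -- The fourth power on the right is 4β⁴ - 3Λ²; 5/4 is a safe replacement for √2.
    have hle : 5 / 4 * loopBeta Λ N ≤ cnBeta Λ (loopBeta Λ N ^ 4 - Λ ^ 2) := by
      refine le_of_pow_le_pow_left₀ (n := 4) (by norm_num) hBpos.le ?_
      rw [hB, mul_pow]
      have : 0 < loopBeta Λ N ^ 4 := by positivity
      nlinarith
    refine le_trans ?_ hle
    have hc : 0 < N / π := by positivity
    have e₁ := mul_lt_mul_of_pos_left h₁ hc
    have e₂ := mul_lt_mul_of_pos_left h₂ hc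
    have e₃ := mul_pos hc hK₀
    rw [mul_div_assoc]
    have e₄ : loopBeta Λ N = 2 * (N / π * ellipticK (loopKappa Λ N)) := by rw [loopBeta]; ring
    linarith

/-- All phases in intervals of length `2` occur at a given point of the central edge. -/
theorem exists_cnPhase_eq (Λ P : ℝ) (hℓ : 0 < ℓ) : ∃ y₀ : ℝ, ∀ y ∈ Ioc y₀ (y₀ + 2), ∃ p > P,
    flowV Λ p 0 π < 0 ∧ 0 < energy Λ (loopEnd Λ p).1 (loopEnd Λ p).2 ∧
      cnPhase Λ ℓ (loopEnd Λ p) = y := by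
  obtain ⟨N₁, hN₁⟩ := eventually_atTop.1 (eventually_loop_bounds Λ P)
  -- The bound 10π/ℓ makes the phase nℓ/π exceed 20, so that a gain of one tenth amounts to at least
  -- 2.
  obtain ⟨k, hk⟩ := exists_nat_gt (max N₁ (10 * π / ℓ))
  set n : ℝ := 2 * ((k : ℤ) : ℝ) with hn
  have hkk : ((k : ℤ) : ℝ) = k := by push_cast; rfl
  have hk0 : (0 : ℝ) ≤ k := Nat.cast_nonneg k
  have hkN : N₁ < k := (le_max_left _ _).trans_lt hk
  have hkℓ : 10 * π / ℓ < k := (le_max_right _ _).trans_lt hk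
  have hnN : N₁ ≤ n := by rw [hn, hkk]; linarith
  obtain ⟨hn0, hΛn, -, -⟩ := hN₁ n hnN
  have hcont : ContinuousOn (fun N => cnPhase Λ ℓ (loopEnd Λ (loopAmp Λ N)))
      (Icc n (n + 1 / 2)) := by
    have h₁ : ContinuousOn (loopAmp Λ) (Icc n (n + 1 / 2)) :=
      ((continuousOn_loopKappa hn0 hΛn).mul (continuousOn_loopBeta hn0 hΛn)).mono
        Icc_subset_Ici_self
    refine (continuousOn_cnPhase Λ ℓ).comp ((continuous_loopEnd Λ).comp_continuousOn h₁)
      fun N hN => ?_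
    obtain ⟨c₁, c₂, -, -⟩ := hN₁ N (hnN.trans hN.1)
    exact energy_loopEnd_pos c₁ c₂
  have e₁ := (cnPhase_loopEnd_even (ℓ := ℓ) hn hn0 hΛn).2
  have e₂ := (cnPhase_loopEnd_odd (ℓ := ℓ) hn hn0 hΛn).2
  have hb := (hN₁ (n + 1 / 2) (by linarith)).2.2.2
  have hgap : n * ℓ / π + 2 ≤ cnPhase Λ ℓ (loopEnd Λ (loopAmp Λ (n + 1 / 2))) := by
    rw [e₂]
    set B := cnBeta Λ (loopBeta Λ (n + 1 / 2) ^ 4 - Λ ^ 2)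
    set K := ellipticK (cnKappa Λ (loopBeta Λ (n + 1 / 2) ^ 4 - Λ ^ 2))
    have h1 : B * ℓ / (2 * K) = B / K * (ℓ / 2) := by ring
    rw [h1]
    have h2 := mul_le_mul_of_nonneg_right hb (show 0 ≤ ℓ / 2 by positivity)
    have h3 : 20 < n * ℓ / π := by
      rw [lt_div_iff₀ pi_pos]
      rw [div_lt_iff₀ hℓ] at hkℓ
      rw [hn, hkk]; linarith
    have h4 : 11 / 10 * (2 * (n + 1 / 2) / π) * (ℓ / 2) =
        11 / 10 * (n * ℓ / π) + 11 / 20 * (ℓ / π) := by ring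
    have h5 : 0 < ℓ / π := by positivity
    linarith
  refine ⟨n * ℓ / π, fun y hy => ?_⟩
  obtain ⟨N, hN, hNy⟩ := intermediate_value_Icc (by linarith) hcont
    (⟨by rw [e₁]; exact hy.1.le, hy.2.trans hgap⟩ : y ∈ Icc _ _)
  obtain ⟨c₁, c₂, c₃, -⟩ := hN₁ N (hnN.trans hN.1)
  -- The left end of the phase interval is excluded, so N > n and the velocity at the vertex is
  -- nonzero.
  have hne : n ≠ N := by
    rintro rfl
    simp only [e₁] at hNy
    linarith [hy.1]
  have hlt : n < N := lt_of_le_of_ne hN.1 hne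
  refine ⟨loopAmp Λ N, c₃, ?_, energy_loopEnd_pos c₁ c₂, hNy⟩
  have := flowV_loop_neg (Λ := Λ) (n := n) (δ := N - n) hn (by linarith)
    (by rwa [add_sub_cancel]) (by linarith) (by linarith [hN.2])
  rwa [add_sub_cancel] at this

end LoopPhase

/-- Data on the central edge at distance `t` from the first vertex. -/
noncomputable def centreEnd (Λ p t : ℝ) : ℝ × ℝ :=
  (flowU Λ (loopEnd Λ p).1 (loopEnd Λ p).2 t, flowV Λ (loopEnd Λ p).1 (loopEnd Λ p).2 t)

lemma energy_centreEnd (Λ p t : ℝ) : energy Λ (centreEnd Λ p t).1 (centreEnd Λ p t).2 =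
    energy Λ (loopEnd Λ p).1 (loopEnd Λ p).2 := energy_flow _ _ _ _

/-- An integral phase lies in the swept interval. Position and velocity cannot both vanish, as the
energy is positive. -/
lemma exists_centreEnd_snd_eq_zero (Λ P : ℝ) {ℓ : ℝ} (hℓ : 0 < ℓ) :
    ∃ p > P, flowV Λ p 0 π ≠ 0 ∧ (centreEnd Λ p ℓ).2 = 0 ∧ (centreEnd Λ p ℓ).1 ≠ 0 := by
  obtain ⟨y₀, h⟩ := exists_cnPhase_eq Λ P hℓ
  obtain ⟨p, hp, hv, hE, hy⟩ := h ((⌊y₀⌋ + 1 : ℤ) : ℝ)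
    ⟨by push_cast; exact Int.lt_floor_add_one y₀, by push_cast; linarith [Int.floor_le y₀]⟩
  have h0 : (centreEnd Λ p ℓ).2 = 0 :=
    flowV_eq_zero_of_cnPhase hE (by simp only [loopEnd]; linarith) hy
  refine ⟨p, hp, hv.ne, h0, fun h1 => ?_⟩
  rw [← energy_centreEnd Λ p ℓ, h0, h1, energy] at hE
  norm_num at hE

/-- The same with a half-integral phase, at which the position vanishes instead. -/
lemma exists_centreEnd_snd_ne_zero (Λ : ℝ) {ℓ : ℝ} (hℓ : 0 < ℓ) :
    ∃ p, (centreEnd Λ p ℓ).2 ≠ 0 := by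
  obtain ⟨y₀, h⟩ := exists_cnPhase_eq Λ 0 hℓ
  obtain ⟨p, hp, hv, hE, hy⟩ := h ((⌊y₀⌋ + 1 : ℤ) + 1 / 2)
    ⟨by push_cast; linarith [Int.lt_floor_add_one y₀], by push_cast; linarith [Int.floor_le y₀]⟩
  have h0 : (centreEnd Λ p ℓ).1 = 0 :=
    flowU_eq_zero_of_cnPhase hE (by simp only [loopEnd]; linarith) hy
  refine ⟨p, fun h1 => ?_⟩
  rw [← energy_centreEnd Λ p ℓ, h0, h1, energy] at hE
  norm_num at hE


/-! ### Countability -/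

section Countability

open scoped ContDiff

/-- The zeros of an analytic function that is not identically 0 are discrete, and discrete subsets
of the line are countable. -/
lemma countable_zeros {f : ℝ → ℝ} (hf : ContDiff ℝ ω f) {x : ℝ} (hx : f x ≠ 0) :
    {x | f x = 0}.Countable := by
  have h := (hf.analyticOnNhd (s := univ)).preimage_zero_mem_codiscrete hx
  have hd : IsDiscrete ({x | f x = 0} ∩ univ) := by
    refine isDiscrete_of_codiscreteWithin ?_
    exact h
  rw [inter_univ] at hd
  exact (HereditarilyLindelofSpace.isLindelof _).countable_of_isDiscrete hd

instance : Countable Label :=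
  Function.Injective.countable (f := fun l : Label => match l with
    | .int n => some n
    | .lam => none) (by rintro (_ | _) (_ | _) h <;> simp_all)

lemma countable_image_onGraph {ι : Type*} {L : ℝ} {S : Set GraphFun} {T : Set ι}
    (hT : T.Countable) (f : ι → GraphFun) (h : ∀ Φ ∈ S, ∃ i ∈ T, EdgewiseEq L Φ (f i)) :
    (GraphFun.onGraph L '' S).Countable := by
  refine (hT.image fun i => (f i).onGraph L).mono ?_
  rintro _ ⟨Φ, hΦ, rfl⟩
  obtain ⟨i, hi, he⟩ := h Φ hΦ
  exact ⟨i, hi, (onGraph_eq_iff.2 he).symm⟩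

lemma countable_sq_mem {S : Set ℝ} (hS : S.Countable) : {b : ℝ | b ^ 2 ∈ S}.Countable := by
  refine ((hS.image fun s => √s).union (hS.image fun s => -√s)).mono fun b hb => ?_
  rcases le_total 0 b with h | h
  · exact Or.inl ⟨_, hb, sqrt_sq h⟩
  · refine Or.inr ⟨_, hb, ?_⟩
    beta_reduce
    rw [sqrt_sq_eq_abs, abs_of_nonpos h, neg_neg]

lemma countable_energy_right (Λ a : ℝ) {S : Set ℝ} (hS : S.Countable) :
    {b : ℝ | energy Λ a b ∈ S}.Countable := by
  refine (countable_sq_mem (hS.image fun s => s - energy Λ a 0)).mono fun b hb => ?_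
  refine (⟨_, hb, ?_⟩ : b ^ 2 ∈ (fun s => s - energy Λ a 0) '' S)
  beta_reduce
  rw [energy_eq_sq_add, add_sub_cancel_right]

lemma countable_energy_left (Λ : ℝ) {S : Set ℝ} (hS : S.Countable) :
    {a : ℝ | energy Λ a 0 ∈ S}.Countable := by
  have h := countable_sq_mem (hS.image fun s => s + Λ ^ 2 / 4)
  refine (countable_sq_mem (h.image fun s => s - Λ / 2)).mono fun a ha => ?_
  have : (a ^ 2 + Λ / 2) ^ 2 ∈ (fun s => s + Λ ^ 2 / 4) '' S :=
    ⟨_, ha, by simp only [energy]; ring⟩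
  exact (⟨a ^ 2 + Λ / 2, this, by ring⟩ : a ^ 2 ∈ (fun s => s - Λ / 2) ''
    {x | x ^ 2 ∈ (fun s => s + Λ ^ 2 / 4) '' S})

/-- The three data of `waveOf` solve polynomial equations whose constants are energies of labels, of
which there are countably many. -/
lemma countable_twoComplete {L Λ : ℝ} (hL : 0 < L) :
    (GraphFun.onGraph L '' TwoComplete L Λ).Countable := by
  have hA := countable_energy_left Λ (countable_range fun l : Label => l.energy (4 * L) Λ)
  have hB := countable_sq_mem (countable_range fun l : Label × Label =>
    l.1.energy (2 * π) Λ - l.2.energy (4 * L) Λ)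
  refine countable_image_onGraph (hA.prod (hB.prod hB))
    (fun z => waveOf L Λ z.1 z.2.1 z.2.2) fun Φ hΦ => ?_
  obtain ⟨t, ht, -⟩ := (mem_twoComplete_iff hL).1 hΦ
  obtain ⟨a, b₁, b₃, hd, he⟩ := ht.exists_typeData hL
  refine ⟨(a, b₁, b₃), ⟨⟨_, hd.energy₂.symm⟩, ⟨(t.n₁, t.m), ?_⟩, ⟨(t.n₃, t.m), ?_⟩⟩, he⟩
  · simp only [← hd.energy₁]; ring
  · simp only [← hd.energy₃]; ring

end Countability

/-! ### Standing waves with an incomplete first loop -/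

section HalfWave

open scoped ContDiff

lemma flow_neg_right (Λ a b t : ℝ) :
    flowU Λ a (-b) t = flowU Λ a b (-t) ∧ flowV Λ a (-b) t = -flowV Λ a b (-t) := by
  obtain ⟨h₁, h₂⟩ := (isSol_flow Λ a (-b)).unique (isSol_flow Λ a b).comp_neg (x₀ := 0)
    (by simp) (by simp)
  exact ⟨congrFun h₁ t, congrFun h₂ t⟩

lemma flow_neg (Λ a b t : ℝ) :
    flowU Λ (-a) (-b) t = -flowU Λ a b t ∧ flowV Λ (-a) (-b) t = -flowV Λ a b t := by
  obtain ⟨h₁, h₂⟩ := (isSol_flow Λ (-a) (-b)).unique (isSol_flow Λ a b).neg (x₀ := 0)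
    (by simp) (by simp)
  exact ⟨congrFun h₁ t, congrFun h₂ t⟩

lemma flow_even (Λ p t : ℝ) :
    flowU Λ p 0 (-t) = flowU Λ p 0 t ∧ flowV Λ p 0 (-t) = -flowV Λ p 0 t := by
  have := flow_neg_right Λ p 0 (-t)
  rw [neg_zero, neg_neg] at this
  exact this

lemma flow_flow_neg (Λ a b t : ℝ) :
    flowU Λ (flowU Λ a b t) (flowV Λ a b t) (-t) = a ∧
      flowV Λ (flowU Λ a b t) (flowV Λ a b t) (-t) = b := by
  have := flow_add Λ a b t (-t)
  simpa using this

lemma contDiff_flow {Λ : ℝ} {f g : ℝ → ℝ} (hf : ContDiff ℝ ω f) (hg : ContDiff ℝ ω g) (t : ℝ) :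
    ContDiff ℝ ω (fun p => flowU Λ (f p) (g p) t) ∧
      ContDiff ℝ ω (fun p => flowV Λ (f p) (g p) t) := by
  have h : ContDiff ℝ ω fun p => flowMap t (Λ, f p, g p) :=
    (contDiff_flowMap t).comp (contDiff_const.prodMk (hf.prodMk hg))
  exact ⟨contDiff_fst.comp (contDiff_snd.comp h), contDiff_snd.comp (contDiff_snd.comp h)⟩

lemma contDiff_centreEnd (Λ t : ℝ) : ContDiff ℝ ω (fun p => (centreEnd Λ p t).1) ∧
    ContDiff ℝ ω (fun p => (centreEnd Λ p t).2) := by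
  have h := contDiff_flow (Λ := Λ) contDiff_id contDiff_const (g := fun _ => 0) π
  exact contDiff_flow (f := fun p => (loopEnd Λ p).1) (g := fun p => (loopEnd Λ p).2) h.1
    (contDiff_const.mul h.2) t

variable {L Λ p b : ℝ}

/-- The value at the midpoint of the second loop of the solution that leaves the central edge as
from an incomplete loop. -/
noncomputable def midValue (L Λ p : ℝ) : ℝ :=
  flowU Λ (centreEnd Λ p (2 * L)).1 (-((centreEnd Λ p (2 * L)).2 / 2)) (-π)

/-- The corresponding velocity; the second loop closes up when it vanishes. -/
noncomputable def midVelocity (L Λ p : ℝ) : ℝ :=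
  flowV Λ (centreEnd Λ p (2 * L)).1 (-((centreEnd Λ p (2 * L)).2 / 2)) (-π)

lemma contDiff_mid (L Λ : ℝ) :
    ContDiff ℝ ω (midValue L Λ) ∧ ContDiff ℝ ω (midVelocity L Λ) :=
  have h := contDiff_centreEnd Λ (2 * L)
  contDiff_flow (f := fun p => (centreEnd Λ p (2 * L)).1) h.1 (h.2.div_const 2).neg (-π)

/-- A solution on the central edge that is symmetric about the middle hands the second loop the
mirrored data of the first, and the flow back to the midpoint retraces that loop. -/
lemma midVelocity_eq_zero_of_symm (h : (centreEnd Λ p L).2 = 0) :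
    centreEnd Λ p (2 * L) = (flowU Λ p 0 π, -(2 * flowV Λ p 0 π)) ∧ midVelocity L Λ p = 0 := by
  have e := (isSol_flow Λ (loopEnd Λ p).1 (loopEnd Λ p).2).eq_reflect h 0
  have h₁ : centreEnd Λ p (2 * L) = (flowU Λ p 0 π, -(2 * flowV Λ p 0 π)) := by
    rw [sub_zero] at e
    rw [centreEnd, e.1, e.2]; simp [loopEnd]
  refine ⟨h₁, ?_⟩
  rw [midVelocity, h₁]
  simp only [neg_div, neg_neg, mul_div_cancel_left₀ _ (two_ne_zero' ℝ)]
  exact (flow_flow_neg Λ p 0 π).2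

/-- If the second loop closes up, the same wave can be shot from the midpoint of that loop, with the
central edge run backwards. -/
lemma loopEnd_midValue (h : midVelocity L Λ p = 0) : loopEnd Λ (midValue L Λ p) =
    ((centreEnd Λ p (2 * L)).1, -(centreEnd Λ p (2 * L)).2) := by
  have := flow_flow_neg Λ (centreEnd Λ p (2 * L)).1 (-((centreEnd Λ p (2 * L)).2 / 2)) (-π)
  rw [← midValue, ← midVelocity, h, neg_neg] at this
  rw [loopEnd, this.1, this.2]
  congr 1; ring

lemma centreEnd_midValue (h : midVelocity L Λ p = 0) :
    centreEnd Λ (midValue L Λ p) (2 * L) = ((loopEnd Λ p).1, -(loopEnd Λ p).2) := by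
  have e := flow_neg_right Λ (centreEnd Λ p (2 * L)).1 (centreEnd Λ p (2 * L)).2 (2 * L)
  have e' := flow_flow_neg Λ (loopEnd Λ p).1 (loopEnd Λ p).2 (2 * L)
  rw [centreEnd, loopEnd_midValue h]
  simp only [e.1, e.2]
  rw [centreEnd, e'.1, e'.2]

/-- Shooting from the second loop recovers the first. -/
lemma midValue_midValue (h : midVelocity L Λ p = 0) : midValue L Λ (midValue L Λ p) = p := by
  rw [midValue, centreEnd_midValue h]
  simp only [loopEnd, neg_div, neg_neg, mul_div_cancel_left₀ _ (two_ne_zero' ℝ)]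
  exact (flow_flow_neg Λ p 0 π).1

lemma loopEnd_neg (Λ p : ℝ) : loopEnd Λ (-p) = -loopEnd Λ p := by
  have := flow_neg Λ p 0 π
  rw [neg_zero] at this
  rw [loopEnd, loopEnd, this.1, this.2]
  simp

lemma midValue_neg (L Λ p : ℝ) : midValue L Λ (-p) = -midValue L Λ p := by
  have h : centreEnd Λ (-p) (2 * L) = -centreEnd Λ p (2 * L) := by
    rw [centreEnd, loopEnd_neg]
    exact Prod.ext (flow_neg _ _ _ _).1 (flow_neg _ _ _ _).2
  rw [midValue, h, midValue, Prod.fst_neg, Prod.snd_neg, neg_div]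
  exact (flow_neg _ _ _ _).1

lemma StrictMono.eq_id_of_involutive {f : ℝ → ℝ} (h : StrictMono f) (hf : ∀ x, f (f x) = x)
    (x : ℝ) : f x = x := by
  rcases lt_trichotomy (f x) x with h1 | h1 | h1
  · have := h h1; rw [hf] at this; exact absurd this h1.not_gt
  · exact h1
  · have := h h1; rw [hf] at this; exact absurd this h1.not_gt

/-- A solution that is symmetric about `L` with data related by reflection. -/
lemma centreEnd_snd_eq_zero_of_reflect
    (h : centreEnd Λ p (2 * L) = ((loopEnd Λ p).1, -(loopEnd Λ p).2)) :
    (centreEnd Λ p L).2 = 0 := by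
  have hs := isSol_flow Λ (loopEnd Λ p).1 (loopEnd Λ p).2
  obtain ⟨-, e⟩ := hs.unique ((hs.comp_add (2 * L)).comp_neg) (x₀ := 0)
    (by simpa [centreEnd] using (congrArg Prod.fst h).symm)
    (by
      have := congrArg Prod.snd h
      simp only [centreEnd] at this
      simp [this])
  have := congrFun e L
  simp only [show -L + 2 * L = L by ring] at this
  simp only [centreEnd]
  linarith

lemma centreEnd_fst_eq_zero_of_reflect
    (h : centreEnd Λ p (2 * L) = (-(loopEnd Λ p).1, (loopEnd Λ p).2)) :
    (centreEnd Λ p L).1 = 0 := by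
  have hs := isSol_flow Λ (loopEnd Λ p).1 (loopEnd Λ p).2
  obtain ⟨e, -⟩ := hs.unique ((hs.comp_add (2 * L)).comp_neg.neg) (x₀ := 0)
    (by
      have := congrArg Prod.fst h
      simp only [centreEnd] at this
      simp [this])
    (by simpa [centreEnd] using (congrArg Prod.snd h).symm)
  have := congrFun e L
  simp only [show -L + 2 * L = L by ring] at this
  simp only [centreEnd]
  linarith

/-- If every p closed up the second loop, then `midValue` would be a continuous involution, hence
monotone. It is odd as well, so it would be p or -p, and all central solutions would be even, or all
odd, about the middle. The phase count excludes both. -/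
lemma exists_midVelocity_ne_zero (hL : 0 < L) (Λ : ℝ) : ∃ p, midVelocity L Λ p ≠ 0 := by
  by_contra! h
  have hQ := fun p => midValue_midValue (h p)
  have hc : Continuous (midValue L Λ) := (contDiff_mid L Λ).1.continuous
  have hi : Function.Injective (midValue L Λ) := Function.LeftInverse.injective hQ
  rcases hc.strictMono_of_inj hi with hm | hm
  -- Increasing case: an increasing involution is the identity, so every central solution would be
  -- at rest in the middle.
  · obtain ⟨p, hp⟩ := exists_centreEnd_snd_ne_zero Λ hL
    refine hp (centreEnd_snd_eq_zero_of_reflect ?_)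
    rw [← centreEnd_midValue (h p), hm.eq_id_of_involutive hQ]
  -- Decreasing case: the negative is an increasing involution by oddness, so every central solution
  -- would vanish in the middle.
  · obtain ⟨p, -, -, -, hp⟩ := exists_centreEnd_snd_eq_zero Λ 0 hL
    have hid := (show StrictMono fun p => -midValue L Λ p from hm.neg).eq_id_of_involutive
      (fun x => by rw [midValue_neg, neg_neg, hQ]) p
    refine hp (centreEnd_fst_eq_zero_of_reflect ?_)
    have := loopEnd_midValue (h p)
    rw [← neg_eq_iff_eq_neg.2 hid.symm, loopEnd_neg] at this
    have h₁ := congrArg Prod.fst this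
    have h₂ := congrArg Prod.snd this
    simp only [Prod.fst_neg, Prod.snd_neg] at h₁ h₂
    exact Prod.ext h₁.symm (neg_inj.1 h₂).symm

/-- The function on the graph that is made up of the solution on the first loop which is even, with
the value `p` at the midpoint, of its continuation to the central edge, and of a solution on the
second loop that ends with velocity `b`. -/
noncomputable def halfWave (L Λ p b : ℝ) : GraphFun where
  e₁ := flowU Λ p 0
  e₂ x := flowU Λ (loopEnd Λ p).1 (loopEnd Λ p).2 (x + L)
  e₃ x := flowU Λ (centreEnd Λ p (2 * L)).1 b (x + -π)

lemma extends_halfWave (L Λ p b : ℝ) :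
    Extends L Λ (halfWave L Λ p b) (flowU Λ p 0) (flowV Λ p 0)
      (fun x => flowU Λ (loopEnd Λ p).1 (loopEnd Λ p).2 (x + L))
      (fun x => flowV Λ (loopEnd Λ p).1 (loopEnd Λ p).2 (x + L))
      (fun x => flowU Λ (centreEnd Λ p (2 * L)).1 b (x + -π))
      (fun x => flowV Λ (centreEnd Λ p (2 * L)).1 b (x + -π)) :=
  ⟨isSol_flow _ _ _, (isSol_flow _ _ _).comp_add _, (isSol_flow _ _ _).comp_add _,
    fun _ _ => rfl, fun _ _ => rfl, fun _ _ => rfl⟩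

lemma isStandingWave_halfWave (hL : 0 < L)
    (hu : flowU Λ (centreEnd Λ p (2 * L)).1 b (-π + -π) = (centreEnd Λ p (2 * L)).1)
    (hv : flowV Λ (centreEnd Λ p (2 * L)).1 b (-π + -π) = b + (centreEnd Λ p (2 * L)).2) :
    IsStandingWave L Λ (halfWave L Λ p b) := by
  refine ((extends_halfWave L Λ p b).isStandingWave_iff hL).2
    ⟨(flow_even Λ p π).1, ?_, ?_, ?_, ?_, ?_⟩
  · simp [loopEnd]
  · beta_reduce; rw [hu]; simp
  · simp [centreEnd, two_mul]
  · rw [(flow_even Λ p π).2]; simp [loopEnd]; ring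
  · beta_reduce; rw [hv]; simp [centreEnd, two_mul]

lemma incompleteLoop_halfWave (L Λ p b : ℝ) : IncompleteLoop (halfWave L Λ p b).e₁ := by
  have hE := extends_halfWave L Λ p b
  rw [incompleteLoop_iff hE.sol₁ hE.eqOn₁, (flow_even Λ p π).2, neg_neg]

lemma not_completeLoop_halfWave (h : flowV Λ p 0 π ≠ 0) :
    ¬ CompleteLoop (halfWave L Λ p b).e₁ := by
  have hE := extends_halfWave L Λ p b
  rw [completeLoop_iff hE.sol₁ hE.eqOn₁, (flow_even Λ p π).2]
  exact fun h1 => h (by linarith)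

/-- An incomplete loop has the same data at π as its reflection, so it is even and at rest at its
midpoint. Flux then determines the centre, and the far end carries one condition on p and one on b.
-/
lemma IsStandingWave.exists_halfWave {Φ : GraphFun} (hL : 0 < L) (h : IsStandingWave L Λ Φ)
    (h₁ : IncompleteLoop Φ.e₁) : ∃ p b, EdgewiseEq L Φ (halfWave L Λ p b) ∧
      (CompleteLoop Φ.e₃ → (centreEnd Λ p (2 * L)).2 = 0 ∧
        energy Λ (centreEnd Λ p (2 * L)).1 b ∈ range fun l : Label => l.energy (2 * π) Λ) ∧
      (IncompleteLoop Φ.e₃ → midVelocity L Λ p = 0 ∧ b = -((centreEnd Λ p (2 * L)).2 / 2)) := by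
  obtain ⟨u₁, v₁, u₂, v₂, u₃, v₃, hE⟩ := h.exists_extends hL
  obtain ⟨c₁, c₁', c₃, c₃', f₁, f₃⟩ := (hE.isStandingWave_iff hL).1 h
  rw [incompleteLoop_iff hE.sol₁ hE.eqOn₁] at h₁
  obtain ⟨-, e₁⟩ := hE.sol₁.unique hE.sol₁.comp_neg (x₀ := π) c₁.symm h₁
  have h0 : v₁ 0 = 0 := by
    have := congrFun e₁ 0
    simp only [neg_zero] at this
    linarith
  have g₁ := fun x => hE.sol₁.eq_flow 0 x
  simp only [h0, zero_add] at g₁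
  have hl : loopEnd Λ (u₁ 0) = (u₂ (-L), v₂ (-L)) := by
    rw [loopEnd, (g₁ π).1, (g₁ π).2, c₁']
    congr 1; linarith
  have g₂ := fun x => hE.sol₂.eq_flow (-L) x
  have hc : centreEnd Λ (u₁ 0) (2 * L) = (u₂ L, v₂ L) := by
    rw [centreEnd, hl]
    simp only [(g₂ _).1, (g₂ _).2, show -L + 2 * L = L by ring]
  have g₃ := fun x => hE.sol₃.eq_flow π x
  rw [c₃'] at g₃
  refine ⟨u₁ 0, v₃ π, ⟨fun x hx => ?_, fun x hx => ?_, fun x hx => ?_⟩, fun hk => ?_, fun hk => ?_⟩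
  · rw [hE.eqOn₁ hx]; exact (g₁ x).1.symm
  · simp only [hE.eqOn₂ hx, halfWave, hl, (g₂ _).1]
    congr 1; ring
  · simp only [hE.eqOn₃ hx, halfWave, hc, (g₃ _).1]
    congr 1; ring
  · rw [completeLoop_iff hE.sol₃ hE.eqOn₃] at hk
    have eπ : -π + 2 * π = π := by ring
    have hr : 2 * π = 1 * (2 * π) := by ring
    have hp := (hE.sol₃.periodic_of_eq (x := -π) (T := 2 * π) (by rw [eπ, c₃])
      (by rw [eπ, hk])).1
    obtain ⟨l, hl⟩ := hE.sol₃.exists_label pi_pos one_pos hr hE.eqOn₃ hp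
    have ha := hl.elim pi_pos one_pos hr hE.sol₃ hE.eqOn₃
    rw [hc]
    refine ⟨by linarith, l, ?_⟩
    simp only
    rw [← c₃', ha.2.1 π]
  · rw [incompleteLoop_iff hE.sol₃ hE.eqOn₃] at hk
    obtain ⟨-, e₃⟩ := hE.sol₃.unique hE.sol₃.comp_neg (x₀ := π) c₃.symm hk
    have h0 : v₃ 0 = 0 := by
      have := congrFun e₃ 0
      simp only [neg_zero] at this
      linarith
    have hb : v₃ π = -((centreEnd Λ (u₁ 0) (2 * L)).2 / 2) := by rw [hc]; linarith
    refine ⟨?_, hb⟩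
    rw [midVelocity, ← hb, hc, (g₃ _).2, add_neg_cancel, h0]

lemma countable_twoIncomplete (hL : 0 < L) :
    (GraphFun.onGraph L '' TwoIncomplete L Λ).Countable := by
  obtain ⟨x, hx⟩ := exists_midVelocity_ne_zero hL Λ
  refine countable_image_onGraph (countable_zeros (contDiff_mid L Λ).2 hx)
    (fun p => halfWave L Λ p (-((centreEnd Λ p (2 * L)).2 / 2))) ?_
  rintro Φ ⟨h, h₁, h₃⟩
  obtain ⟨p, b, he, -, hi⟩ := h.exists_halfWave hL h₁
  obtain ⟨hp, rfl⟩ := hi h₃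
  exact ⟨p, hp, he⟩

lemma IsStandingWave.R₂ {Φ : GraphFun} (hL : 0 < L) (h : IsStandingWave L Λ Φ) :
    IsStandingWave L Λ Φ.R₂ := by
  obtain ⟨u₁, v₁, u₂, v₂, u₃, v₃, hE⟩ := h.exists_extends hL
  obtain ⟨c₁, c₁', c₃, c₃', f₁, f₃⟩ := (hE.isStandingWave_iff hL).1 h
  have hE' : Extends L Λ Φ.R₂ u₃ v₃ (fun x => u₂ (-x)) (fun x => -v₂ (-x)) u₁ v₁ :=
    ⟨hE.sol₃, hE.sol₂.comp_neg, hE.sol₁, hE.eqOn₃, fun x hx => hE.eqOn₂ (neg_mem_Icc' hx),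
      hE.eqOn₁⟩
  refine (hE'.isStandingWave_iff hL).2 ⟨c₃, ?_, c₁, ?_, ?_, ?_⟩
  · simpa using c₃'
  · simpa using c₁'
  · simp only [neg_neg]; linarith
  · simp only [neg_neg]; linarith

/-- A complete second loop forces rest at the far end of the centre, an analytic equation for p, and
the energies of labels leave countably many b. The exchange `R₂` covers the other order. -/
lemma countable_oneOfEach (hL : 0 < L) : (GraphFun.onGraph L '' OneOfEach L Λ).Countable := by
  obtain ⟨x, hx⟩ := exists_centreEnd_snd_ne_zero Λ (show 0 < 2 * L by positivity)
  have hT : (⋃ p ∈ {p | (centreEnd Λ p (2 * L)).2 = 0}, Prod.mk p ''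
      {b | energy Λ (centreEnd Λ p (2 * L)).1 b ∈
        range fun l : Label => l.energy (2 * π) Λ}).Countable :=
    (countable_zeros (contDiff_centreEnd Λ (2 * L)).2 hx).biUnion fun p _ =>
      (countable_energy_right _ _ (countable_range _)).image _
  have key : ∀ Φ, IsStandingWave L Λ Φ → IncompleteLoop Φ.e₁ → CompleteLoop Φ.e₃ →
      ∃ z ∈ ⋃ p ∈ {p | (centreEnd Λ p (2 * L)).2 = 0}, Prod.mk p ''
        {b | energy Λ (centreEnd Λ p (2 * L)).1 b ∈ range fun l : Label => l.energy (2 * π) Λ},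
        EdgewiseEq L Φ (halfWave L Λ z.1 z.2) := by
    intro Φ h h₁ h₃
    obtain ⟨p, b, he, hc, -⟩ := h.exists_halfWave hL h₁
    obtain ⟨hp, hb⟩ := hc h₃
    exact ⟨(p, b), mem_biUnion (show p ∈ {p | _} from hp) ⟨b, hb, rfl⟩, he⟩
  have hsub : OneOfEach L Λ ⊆
      {Φ | IsStandingWave L Λ Φ ∧ IncompleteLoop Φ.e₁ ∧ CompleteLoop Φ.e₃} ∪
      {Φ | IsStandingWave L Λ Φ ∧ CompleteLoop Φ.e₁ ∧ IncompleteLoop Φ.e₃} := by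
    rintro Φ ⟨h, h' | h'⟩
    exacts [Or.inl ⟨h, h'⟩, Or.inr ⟨h, h'⟩]
  refine Countable.mono (image_mono hsub) ?_
  rw [image_union]
  refine (countable_image_onGraph hT _ fun Φ hΦ => key Φ hΦ.1 hΦ.2.1 hΦ.2.2).union
    (countable_image_onGraph hT (fun z => (halfWave L Λ z.1 z.2).R₂) fun Φ hΦ => ?_)
  obtain ⟨z, hz, e₁, e₂, e₃⟩ := key Φ.R₂ (hΦ.1.R₂ hL) hΦ.2.2 hΦ.2.1
  refine ⟨z, hz, e₃, fun x hx => ?_, e₁⟩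
  have := e₂ (neg_mem_Icc' hx)
  simpa [GraphFun.R₂] using this

end HalfWave


/-! ### Infinite families -/

section Infinite

variable {L Λ : ℝ}

/-- The value at the midpoint of the first loop is unbounded on the family. -/
lemma infinite_image_onGraph {S : Set GraphFun} (h : ∀ P, ∃ Φ ∈ S, P < Φ.e₁ 0) :
    (GraphFun.onGraph L '' S).Infinite := by
  have h0 : (0 : ℝ) ∈ Icc (-π) π := ⟨by linarith [pi_pos], pi_pos.le⟩
  refine Set.Infinite.of_image
    (fun q : (Icc (-π) π → ℝ) × (Icc (-L) L → ℝ) × (Icc (-π) π → ℝ) => q.1 ⟨0, h0⟩) ?_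
  refine infinite_of_not_bddAbove ?_
  rintro ⟨P, hP⟩
  obtain ⟨Φ, hΦ, hlt⟩ := h P
  exact absurd (hP ⟨_, ⟨Φ, hΦ, rfl⟩, rfl⟩) (not_le.2 hlt)

lemma halfWave_fst_zero (L Λ p b : ℝ) : (halfWave L Λ p b).e₁ 0 = p := flowU_zero Λ p 0

/-- Waves symmetric about the middle of the central edge. Their velocity at the vertices does not
vanish on the loops, so no loop is complete. -/
lemma infinite_twoIncomplete (hL : 0 < L) : (GraphFun.onGraph L ''
    (TwoIncomplete L Λ \ (TwoComplete L Λ ∪ OneOfEach L Λ))).Infinite := by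
  refine infinite_image_onGraph fun P => ?_
  obtain ⟨p, hp, hv, h0, -⟩ := exists_centreEnd_snd_eq_zero Λ P hL
  obtain ⟨hc, hm⟩ := midVelocity_eq_zero_of_symm h0
  have hE := extends_halfWave L Λ p (flowV Λ p 0 π)
  have hb : -((centreEnd Λ p (2 * L)).2 / 2) = flowV Λ p 0 π := by rw [hc]; ring
  rw [midVelocity, hb] at hm
  have hr := (isSol_flow Λ (centreEnd Λ p (2 * L)).1 (flowV Λ p 0 π)).eq_reflect hm 0
  rw [show 2 * -π - 0 = -π + -π by ring, flowU_zero, flowV_zero] at hr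
  have hw := isStandingWave_halfWave hL hr.1 (by rw [hr.2, hc]; ring)
  have h₁ := not_completeLoop_halfWave (L := L) (b := flowV Λ p 0 π) hv
  have h₃ : ¬ CompleteLoop (halfWave L Λ p (flowV Λ p 0 π)).e₃ := by
    rw [completeLoop_iff hE.sol₃ hE.eqOn₃, hr.2]
    simp only [add_neg_cancel, flowV_zero]
    exact fun h => hv (by linarith)
  refine ⟨_, ⟨⟨hw, incompleteLoop_halfWave _ _ _ _, ?_⟩, ?_⟩, by rwa [halfWave_fst_zero]⟩
  · rw [incompleteLoop_iff hE.sol₃ hE.eqOn₃, hr.2]; simp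
  · rintro (⟨-, h, -⟩ | ⟨-, ⟨-, h⟩ | ⟨h, -⟩⟩)
    exacts [h₁ h, h₃ h, h₁ h]

lemma valid_of_lt_sq {n : ℤ} (h : Λ < (n : ℝ) ^ 2) (hn : 0 < n) :
    (Label.int n).Valid (2 * π) Λ :=
  Label.valid_loop_int.2 ⟨fun _ => h, fun h' => absurd hn h'.not_gt⟩

/-- The loop energy is (β⁴ - Λ²)/4 with β ≥ n. -/
lemma exists_loop_energy_gt (Λ C : ℝ) : ∃ n : ℤ, 0 < n ∧ (Label.int n).Valid (2 * π) Λ ∧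
    C < (Label.int n).energy (2 * π) Λ := by
  obtain ⟨k, hk⟩ := exists_nat_gt (1 + |Λ| + 4 * |C| + Λ ^ 2)
  have h₁ := abs_nonneg Λ
  have h₂ := le_abs_self Λ
  have h₃ := abs_nonneg C
  have h₄ := le_abs_self C
  have hk1 : (1 : ℝ) < k := by nlinarith [sq_nonneg Λ]
  have hΛ : Λ < (k : ℝ) ^ 2 := by nlinarith [sq_nonneg Λ]
  have hk0 : (0 : ℤ) < k := by exact_mod_cast (zero_lt_one.trans hk1)
  refine ⟨k, hk0, valid_of_lt_sq (by exact_mod_cast hΛ) hk0, ?_⟩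
  have hE : (Label.int k).energy (2 * π) Λ = (loopBeta Λ k ^ 4 - Λ ^ 2) / 4 := by
    obtain ⟨hκ, hβ, hp⟩ := loop_param (by linarith) hΛ
    rw [← (energy_loopAmp (by linarith) hΛ).2.1, (energy_loopAmp (by linarith) hΛ).1,
      Label.energy_pos_eq hk0]
    refine (cn_param_of_period hκ hβ hp ?_).2.2.2.2
    have hK := ellipticK_pos (sq_lt_one_of_mem_Ico (Ioo_subset_Ico_self hκ))
    rw [loopBeta]
    push_cast
    field_simp
    norm_num
  rw [hE]
  have h₅ : (k : ℝ) ^ 4 ≤ loopBeta Λ k ^ 4 :=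
    pow_le_pow_left₀ (by linarith) (le_loopBeta (by linarith) hΛ) 4
  have h₆ : (k : ℝ) ≤ (k : ℝ) ^ 4 := le_self_pow₀ hk1.le (by norm_num)
  linarith

/-- The centre is at rest at its far end, where a cnoidal loop of higher energy is attached. Its
velocity b > 0 there keeps the second loop from being incomplete as well. -/
lemma infinite_oneOfEach (hL : 0 < L) : (GraphFun.onGraph L ''
    (OneOfEach L Λ \ (TwoIncomplete L Λ ∪ TwoComplete L Λ))).Infinite := by
  refine infinite_image_onGraph fun P => ?_
  obtain ⟨p, hp, hv, h0, -⟩ :=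
    exists_centreEnd_snd_eq_zero Λ P (show 0 < 2 * L by positivity)
  set c := (centreEnd Λ p (2 * L)).1 with hc
  obtain ⟨n, hn, hval, hlt⟩ := exists_loop_energy_gt Λ (energy Λ c 0)
  set b := √((Label.int n).energy (2 * π) Λ - energy Λ c 0) with hb
  have hb0 : 0 < b := sqrt_pos.2 (by linarith)
  have hEb : energy Λ c b = (Label.int n).energy (2 * π) Λ := by
    rw [energy_eq_sq_add, hb, sq_sqrt (by linarith)]; ring
  have hE := extends_halfWave L Λ p b
  have hr : 2 * π = 1 * (2 * π) := by ring
  have hl : EdgeHasLabel Λ π 1 (halfWave L Λ p b).e₃ (.int n) := by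
    refine hE.sol₃.edgeHasLabel pi_pos one_pos hr hE.eqOn₃ hval (x := π) ?_ fun h => ?_
    · simp only [add_neg_cancel, flowU_zero, flowV_zero]
      exact hEb
    · exact absurd h (int_ne hn.ne')
  obtain ⟨-, -, -, q, q'⟩ := hl.elim pi_pos one_pos hr hE.sol₃ hE.eqOn₃
  have q := q (-π)
  have q' := q' (-π)
  simp only [show -π + 2 * π = π by ring, add_neg_cancel, flowU_zero, flowV_zero] at q q'
  have hw := isStandingWave_halfWave hL q.symm (by rw [← q', h0, add_zero])
  have h₁ := not_completeLoop_halfWave (L := L) (b := b) hv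
  refine ⟨_, ⟨⟨hw, Or.inl ⟨incompleteLoop_halfWave _ _ _ _, ?_⟩⟩, ?_⟩, by rwa [halfWave_fst_zero]⟩
  · rw [completeLoop_iff hE.sol₃ hE.eqOn₃, ← q']; simp
  · rintro (⟨-, -, h⟩ | ⟨-, h, -⟩)
    · rw [incompleteLoop_iff hE.sol₃ hE.eqOn₃, ← q'] at h
      simp only [add_neg_cancel, flowV_zero] at h
      linarith
    · exact h₁ h

/-- The types of the standing waves that vanish on the central edge and have the same number of
periods on the two loops. -/
def equalLoops (n : ℤ) : Triple := ⟨.int n, .int 0, .int n⟩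

lemma admissible_equalLoops {n : ℤ} (hn : 0 < n) (h : Λ < (n : ℝ) ^ 2) :
    (equalLoops n).Admissible L Λ :=
  Triple.Base.admissible (Or.inl ⟨rfl, ⟨n, hn.le, rfl⟩, ⟨n, hn.le, rfl⟩⟩) (valid_of_lt_sq h hn)
    Label.valid_zero (valid_of_lt_sq h hn)

lemma exists_forall_lt_sq (Λ : ℝ) : ∃ N : ℕ, ∀ k : ℕ, 0 < ((N + k + 1 : ℕ) : ℤ) ∧
    Λ < (((N + k + 1 : ℕ) : ℤ) : ℝ) ^ 2 := by
  obtain ⟨N, hN⟩ := exists_nat_gt Λ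
  refine ⟨N, fun k => ⟨by positivity, ?_⟩⟩
  push_cast
  have := Nat.cast_nonneg (α := ℝ) N
  have := Nat.cast_nonneg (α := ℝ) k
  nlinarith

lemma infinite_types (hL : 0 < L) : {t : Triple | ∃ Φ : GraphFun, HasType L Λ Φ t}.Infinite := by
  obtain ⟨N, hN⟩ := exists_forall_lt_sq Λ
  refine infinite_of_injective_forall_mem (f := fun k : ℕ => equalLoops ((N + k + 1 : ℕ) : ℤ))
    (fun k j h => ?_) fun k => (admissible_equalLoops (hN k).1 (hN k).2).exists_hasType hL
  injection h with h
  injection h with h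
  omega

/-- Waves that vanish on the centre, with n periods on each loop; nonzero velocities at the vertices
keep the loops from being incomplete, and the label of the first loop tells different n apart. -/
lemma infinite_twoComplete (hL : 0 < L) : (GraphFun.onGraph L ''
    (TwoComplete L Λ \ (TwoIncomplete L Λ ∪ OneOfEach L Λ))).Infinite := by
  obtain ⟨N, hN⟩ := exists_forall_lt_sq Λ
  have key : ∀ n : ℤ, 0 < n → Λ < (n : ℝ) ^ 2 → ∃ Φ, HasType L Λ Φ (equalLoops n) ∧
      Φ ∈ TwoComplete L Λ \ (TwoIncomplete L Λ ∪ OneOfEach L Λ) := by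
    intro n hn h
    have hd := (admissible_equalLoops (L := L) hn h).typeData hL (one_pow 2) (one_pow 2) (one_pow 2)
    have ht := (hd.hasType hL).1
    simp only [equalLoops, one_mul, Label.energy_zero, sub_zero] at ht
    set b := √((Label.int n).energy (2 * π) Λ) with hb
    have hb0 : 0 < b :=
      sqrt_pos.2 (Label.energy_int_pos (by positivity) hn (valid_of_lt_sq h hn))
    set a := (Label.int 0).topValue (4 * L) Λ
    have hE := extends_waveOf L Λ a b b
    have hr : 2 * π = 1 * (2 * π) := by ring
    have q₁ := (ht.2.1.elim pi_pos one_pos hr hE.sol₁ hE.eqOn₁).2.2.2.2 (-π)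
    have q₃ := (ht.2.2.2.elim pi_pos one_pos hr hE.sol₃ hE.eqOn₃).2.2.2.2 (-π)
    simp only [show -π + 2 * π = π by ring, add_neg_cancel, flowV_zero] at q₁ q₃
    have n₁ : ¬ IncompleteLoop (waveOf L Λ a b b).e₁ := by
      rw [incompleteLoop_iff hE.sol₁ hE.eqOn₁, ← q₁]
      simp only [add_neg_cancel, flowV_zero]
      intro h; linarith
    have n₃ : ¬ IncompleteLoop (waveOf L Λ a b b).e₃ := by
      rw [incompleteLoop_iff hE.sol₃ hE.eqOn₃, ← q₃]
      simp only [add_neg_cancel, flowV_zero]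
      intro h; linarith
    refine ⟨_, ht, ⟨ht.1, ?_, ?_⟩, ?_⟩
    · rw [completeLoop_iff hE.sol₁ hE.eqOn₁, ← q₁]; simp
    · rw [completeLoop_iff hE.sol₃ hE.eqOn₃, ← q₃]; simp
    · rintro (⟨-, h, -⟩ | ⟨-, ⟨h, -⟩ | ⟨-, h⟩⟩)
      exacts [n₁ h, n₁ h, n₃ h]
  choose Φ hΦ using fun k : ℕ => key _ (hN k).1 (hN k).2
  refine infinite_of_injective_forall_mem (f := fun k => (Φ k).onGraph L) (fun k j h => ?_)
    fun k => mem_image_of_mem _ (hΦ k).2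
  have := (hΦ k).1.1.eq₁.label_eq_of_eqOrRev (hΦ k).1.2.1 (hΦ j).1.2.1
    (Or.inl (onGraph_eq_iff.1 h).1.symm)
  injection this with this
  omega

end Infinite

/-! ### Periods -/

lemma isLeast_period {Λ T : ℝ} {ψ : ℝ → ℝ} (h : IsCnoidal Λ T ψ ∨ IsDnoidal Λ T ψ) :
    ContDiff ℝ 2 ψ ∧ (∀ x, -deriv (deriv ψ) x - 2 * ψ x ^ 3 - Λ * ψ x = 0) ∧
      IsLeast {t : ℝ | 0 < t ∧ Function.Periodic ψ t} T := by
  rcases h with h | h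
  · obtain ⟨v, hs, hT, -⟩ := h.exists_isSol
    exact ⟨hs.contDiff, hs.deriv_deriv,
      isLeast_of_periodic hT h.periodic fun t ht hp => h.eq_mul_of_periodic ht hp⟩
  · obtain ⟨v, hs, hT, -⟩ := h.exists_isSol
    exact ⟨hs.contDiff, hs.deriv_deriv,
      isLeast_of_periodic hT h.periodic fun t ht hp => h.eq_mul_of_periodic ht hp⟩


theorem mainTheorem5 (L : ℝ) (hL : 0 < L) :
    -- periods of the cnoidal and dnoidal solutions
    (∀ Λ T : ℝ, ∀ ψ : ℝ → ℝ, IsCnoidal Λ T ψ ∨ IsDnoidal Λ T ψ →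
      ContDiff ℝ 2 ψ ∧ (∀ x, -deriv (deriv ψ) x - 2 * ψ x ^ 3 - Λ * ψ x = 0) ∧
      IsLeast {t : ℝ | 0 < t ∧ Function.Periodic ψ t} T) ∧
    (∀ Λ : ℝ, 0 < Λ → {T : ℝ | ∃ ψ, IsCnoidal Λ T ψ} = Ioo 0 (TcnMax Λ)) ∧
    (∀ Λ : ℝ, Λ ≤ 0 → {T : ℝ | ∃ ψ, IsCnoidal Λ T ψ} = Ioi 0) ∧
    (∀ Λ : ℝ, Λ < 0 → {T : ℝ | ∃ ψ, IsDnoidal Λ T ψ} = Ioi (TdnMin Λ)) ∧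
    -- every standing wave lies in one of the three families
    (∀ Λ : ℝ, ∀ Φ : GraphFun, IsStandingWave L Λ Φ →
      Φ ∈ TwoIncomplete L Λ ∪ TwoComplete L Λ ∪ OneOfEach L Λ) ∧
    -- classification of the standing waves with two complete loops by triples
    (∀ Λ : ℝ, ∀ Φ : GraphFun, Φ ∈ TwoComplete L Λ ↔ ∃! t : Triple, HasType L Λ Φ t) ∧
    -- the frequencies at which a label can occur
    (∀ Λ : ℝ, ∀ Φ : GraphFun, ∀ t : Triple, HasType L Λ Φ t → ∀ n : ℤ,
      (t.n₁ = .int n ∨ t.n₃ = .int n →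
        (0 < n → Λ < (n : ℝ) ^ 2) ∧ (n < 0 → Λ < -((n : ℝ) ^ 2 / 2))) ∧
      (t.m = .int n →
        (0 < n → Λ < (n : ℝ) ^ 2 * LamStar L) ∧
        (n < 0 → Λ < -((n : ℝ) ^ 2 * LamStar L / 2)))) ∧
    -- the trivial solution, and the bifurcations of the other ones
    (∀ Λ : ℝ, ∃ Φ : GraphFun, HasType L Λ Φ ⟨.int 0, .int 0, .int 0⟩) ∧
    (∀ Λ₀ : ℝ, ∀ t s : Triple, BranchTable L Λ₀ t s → BifurcatesFrom L Λ₀ t s) ∧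
    -- in the absence of resonances the list is complete up to the exchange of the loops
    ((∀ n m : ℕ, 0 < n → 2 * L * n ≠ m * π) →
      ∀ Λ : ℝ, ∀ Φ : GraphFun, ∀ t : Triple, HasType L Λ Φ t →
        t = ⟨.int 0, .int 0, .int 0⟩ ∨
        ∃ Λ₀ s, BranchTable L Λ₀ t s ∨ BranchTable L Λ₀ t.swap s) ∧
    -- for an odd number of half-periods of dn on the central edge, reversing the order of two
    -- distinct loop labels does not amount to a symmetry
    (∀ m n₁ n₃ : ℤ, 0 < m → Odd m → n₁ ≠ n₃ →
      (0 < n₁ ∨ (n₁ < 0 ∧ -((m : ℝ) ^ 2 * LamStar L / 2) < -((n₁ : ℝ) ^ 2 / 2))) →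
      (0 < n₃ ∨ (n₃ < 0 ∧ -((m : ℝ) ^ 2 * LamStar L / 2) < -((n₃ : ℝ) ^ 2 / 2))) →
      ∀ Λ : ℝ, Λ < -((m : ℝ) ^ 2 * LamStar L / 2) →
        (∃ Φ Φ' : GraphFun, HasType L Λ Φ ⟨.int n₁, .int (-m), .int n₃⟩ ∧
          HasType L Λ Φ' ⟨.int n₃, .int (-m), .int n₁⟩ ∧ EqOn Φ.e₂ Φ'.e₂ (Icc (-L) L)) ∧
        ∀ Φ Φ' : GraphFun, HasType L Λ Φ ⟨.int n₁, .int (-m), .int n₃⟩ →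
          HasType L Λ Φ' ⟨.int n₃, .int (-m), .int n₁⟩ → EqOn Φ.e₂ Φ'.e₂ (Icc (-L) L) →
          ¬ SymmetryRelated L Φ Φ') ∧
    -- at every frequency each of the three families is countably infinite, even after the removal
    -- of the solutions that it shares with the other two
    (∀ Λ : ℝ,
      (GraphFun.onGraph L '' TwoIncomplete L Λ).Countable ∧
      (GraphFun.onGraph L '' (TwoIncomplete L Λ \ (TwoComplete L Λ ∪ OneOfEach L Λ))).Infinite ∧
      (GraphFun.onGraph L '' TwoComplete L Λ).Countable ∧
      (GraphFun.onGraph L '' (TwoComplete L Λ \ (TwoIncomplete L Λ ∪ OneOfEach L Λ))).Infinite ∧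
      (GraphFun.onGraph L '' OneOfEach L Λ).Countable ∧
      (GraphFun.onGraph L '' (OneOfEach L Λ \ (TwoIncomplete L Λ ∪ TwoComplete L Λ))).Infinite ∧
      {t : Triple | ∃ Φ : GraphFun, HasType L Λ Φ t}.Infinite) := by
  refine ⟨fun Λ T ψ h => isLeast_period h, fun Λ hΛ => setOf_isCnoidal_of_pos hΛ,
    fun Λ hΛ => setOf_isCnoidal_of_nonpos hΛ, fun Λ hΛ => setOf_isDnoidal hΛ,
    fun Λ Φ h => h.mem_families hL, fun Λ Φ => mem_twoComplete_iff hL,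
    fun Λ Φ t h n => h.thresholds hL n, fun Λ => hasType_zero hL,
    fun Λ₀ t s h => h.bifurcatesFrom hL,
    fun hres Λ Φ t h => (h.admissible hL).mem_table hL hres,
    fun m n₁ n₃ hm hodd hne h₁ h₃ Λ hΛ => ⟨exists_reordered hL hm h₁ h₃ hΛ,
      fun Φ Φ' h h' he => not_symmetryRelated hL hm hodd hne h h' he⟩,
    fun Λ => ⟨countable_twoIncomplete hL, infinite_twoIncomplete hL, countable_twoComplete hL,
      infinite_twoComplete hL, countable_oneOfEach hL, infinite_oneOfEach hL, infinite_types hL⟩⟩
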